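/- Let $F$ be a local field of characteristic $0$ ($\mathbb{R}$, $\mathbb{C}$ or a nonarchimedean local field), with normalised absolute value $|\cdot|$ (the square of the usual one if $F=\mathbb{C}$). **Standard nilpotent.** Let $r\ge 1$ and $d_1,\dots,d_r\ge 0$ be integers with $d_r>0$, and let $E$ be the $F$-vector space with basis $e=(e^i_{k,j})_{1\le i\le j\le r,\ 1\le k\le d_j}$. Let $G=GL(E)$, $\mathfrak g=\mathrm{End}(E)$, and let $X\in\mathfrak g(F)$ be the nilpotent endomorphism with $Xe^i_{k,j}=e^{i-1}_{k,j}$ if $i>1$ and $Xe^1_{k,j}=0$. Let $K\subset G(F)$ be the orthogonal group, the unitary group (for which $e$ is orthonormal), or $GL(\mathcal O)$ in the basis $e$, according as $F$ is $\mathbb R$, $\mathbb C$, or nonarchimedean with ring of integers $\mathcal O$. Let $W\subset G(F)$ be the group of permutation matrices in the basis $e$. Let $M$ be the Levi factor, containing the diagonal torus, of the stabiliser of the flag of iterated kernels of $X$; so $M=\prod_{b=1}^r GL(E^b)$ with $E^b$ spanned by the $e^b_{k,j}$. Let $A_M$ be the centre of $M$, and $\mathcal P(M)$ the set of parabolic subgroups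 of $G$ with Levi factor $M$. For a parabolic subgroup $P$, let $N_P$ be its unipotent radical and $\mathfrak n_P$ the Lie algebra of $N_P$. The determinants of the factors of $M$ are a basis of the group of rational characters $X^*(M)$, which identifies $a_M=\mathrm{Hom}(X^*(M),\mathbb R)$ with $\mathbb R^r$ and $a_{M,\mathbb C}^*=X^*(M)\otimes\mathbb C$ with $\mathbb C^r$. Let $\Sigma(P,A_M)$ be the set of roots of $A_M$ in $\mathrm{Lie}(P)$, and, for a root $\alpha$ of $A_M$ in $\mathfrak g$, let $\alpha^\vee\in a_M$ be its coroot. Let $\mathfrak a_M=\mathrm{Lie}(A_M)$ and let $\mathfrak a_M^{\rm reg}$ be the set of its elements on which no root of $A_M$ in $\mathfrak g$ vanishes. **The points $R_P(g)$.** For $P\in\mathcal P(M)$ and $g=mnk\in G(F)$ with $m\in M(F)$, $n\in N_P(F)$, $k\in K$, let $H_P(g)\in a_M$ be defined by $\langle\chi,H_P(g)\rangle=\log|\chi(m)|$ for $\chi\in X^*(M)$. For a parabolic subgroup $P$, let $I_P^G(0)$ be its Richardson orbit, i.e. the nilpotent orbit whose intersection with $\mathfrak n_P$ is Zariski open and dense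 in $\mathfrak n_P$; let $\mathcal R(X)$ be the set of parabolic subgroups $P$ with $X\in\mathfrak n_P\cap I_P^G(0)$. For $P\in\mathcal P(M)$ and $g\in G(F)$ put $R_P(g)=H_P(w_Pg)$, where $w_P\in W$ is such that $w_P^{-1}Pw_P\in\mathcal R(X)$. **Arthur's weights.** Fix a base point $P_1\in\mathcal P(M)$. For $P\in\mathcal P(M)$, $Z\in\mathfrak a_M^{\rm reg}(F)$ and $Y\in\mathfrak n_P(F)$ let $n_P(Z,Y)\in N_P(F)$ be the element $n$ such that $n^{-1}Zn=Z+Y$. For a root $\alpha$ of $A_M$ in $\mathfrak g$, let $\mathfrak l_\alpha$ be the Lie algebra of the Levi subgroup containing $M$ whose roots are $\pm\alpha$, and let $\rho(\alpha)\ge 0$ be the real number such that, for all $P,P'\in\mathcal P(M)$ with $-\alpha\in\Sigma(P,A_M)$ and $\alpha\in\Sigma(P',A_M)$ and all $\lambda\in a_{M,\mathbb C}^*$ with $\mathrm{Re}\langle\lambda,\alpha^\vee\rangle>0$, the limit $$\lim_{Z\in\mathfrak a_M^{\rm reg}(F),\,Z\to 0}|\alpha(Z)|^{\rho(\alpha)\langle\lambda,\alpha^\vee\rangle}\exp(-\langle\lambda,H_{P'}(n_P(Z,Y))\rangle)$$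 exists for every $Y\in\mathfrak n_P(F)\cap\mathfrak l_\alpha(F)$ and is not identically zero in $Y$. For $P_2\in\mathcal P(M)$, $\lambda\in a_{M,\mathbb C}^*$, $Z\in\mathfrak a_M^{\rm reg}(F)$ and $Y\in\mathfrak n_{P_1}(F)$ put $$w_{P_2}(\lambda,Z,Y)=\Big(\prod_{\alpha\in\Sigma(P_2,A_M),\,-\alpha\in\Sigma(P_1,A_M)}|\alpha(Z)|^{\rho(\alpha)\langle\lambda,\alpha^\vee\rangle}\Big)\exp(-\langle\lambda,H_{P_2}(n_{P_1}(Z,Y))\rangle),$$ and $w_{P_2}(\lambda,Y)=\lim_{Z\in\mathfrak a_M^{\rm reg}(F),\,Z\to 0}w_{P_2}(\lambda,Z,Y)$ for $Y\in\mathfrak n_{P_1}(F)\cap I_{P_1}^G(0)$. **Statement.** For every root $\alpha$ of $A_M$ in $\mathfrak g$ the number $\rho(\alpha)$ exists and is unique; for all $Z\in\mathfrak a_M^{\rm reg}(F)$ and $Y\in\mathfrak n_{P_1}(F)$ the element $n_{P_1}(Z,Y)$ exists and is unique. For all $P_2\in\mathcal P(M)$, $\lambda\in a_{M,\mathbb C}^*$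 and $Y\in\mathfrak n_{P_1}(F)\cap I_{P_1}^G(0)$, the limit $w_{P_2}(\lambda,Y)$ exists; for all $g\in G(F)$ and $k\in K$ such that $k^{-1}Yk=g^{-1}Xg$ one has $$w_{P_2}(\lambda,Y)=\exp(\langle\lambda,R_{P_1}(g)-R_{P_2}(g)\rangle);$$ and $w_{P_2}(\lambda,pYp^{-1})=w_{P_2}(\lambda,Y)$ for every $p\in P_1(F)\cap K$. -/

import Mathlib

open Matrix Filter Topology

namespace ArthurGM

noncomputable section

/-! ### Local fields of characteristic zero -/

/-- A presentation of the topological field `F` as a local field of characteristic zero: `F` is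
(as a topological field) `ℝ`, or `ℂ`, or a nonarchimedean local field of characteristic zero. -/
inductive LocalField (F : Type*) [Field F] [TopologicalSpace F]
  | real (e : F ≃+* ℝ) (he : IsHomeomorph e)
  | complex (e : F ≃+* ℂ) (he : IsHomeomorph e)
  | nonarch (v : ValuativeRel F) (hv : IsNonarchimedeanLocalField F) (h0 : CharZero F)

open scoped ValuativeRel NNReal in
/-- The absolute value `q ^ (-v(x))` of a nonarchimedean local field, where `v` is the normalised
(surjective onto `ℤ`) valuation and `q` is the cardinality of the residue field. -/
def nonarchAbs (F : Type*) [Field F] [TopologicalSpace F] [ValuativeRel F]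
    [IsNonarchimedeanLocalField F] (x : F) : ℝ :=
  (WithZeroMulInt.toNNReal (e := (Nat.card 𝓀[F] : ℝ≥0))
    (Nat.cast_ne_zero.mpr Nat.card_pos.ne')
    (IsNonarchimedeanLocalField.valueGroupWithZeroIsoInt F (ValuativeRel.valuation F x)) : ℝ)

section Field

variable {F : Type*} [Field F]

/-- The normalised absolute value of a local field; on `ℂ` it is the square of the usual one. -/
def LocalField.abs [TopologicalSpace F] : LocalField F → F → ℝ
  | .real e _, x => |e x|
  | .complex e _, x => ‖e x‖ ^ 2
  | .nonarch _ _ _, x => nonarchAbs F x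

variable {ι β : Type*} [Fintype ι] [DecidableEq ι] [Fintype β] [DecidableEq β]

open scoped ValuativeRel in
/-- The standard maximal compact subgroup `K` of `GL(F^ι)`: the orthogonal group, the unitary
group, or the group of integral matrices with integral inverse. -/
def LocalField.maxCompact [TopologicalSpace F] :
    LocalField F → Set (GL ι F)
  | .real e _ => {g | (g : Matrix ι ι F).map e ∈ Matrix.orthogonalGroup ι ℝ}
  | .complex e _ => {g | (g : Matrix ι ι F).map e ∈ Matrix.unitaryGroup ι ℂ}
  | .nonarch _ _ _ => {g | ∀ a b, (g : Matrix ι ι F) a b ∈ 𝒪[F] ∧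
      ((g⁻¹ : GL ι F) : Matrix ι ι F) a b ∈ 𝒪[F]}

/-! ### Parabolic subgroups of `GL(F^ι)` -/

/-- The image of a subspace of `F^ι` under a matrix. -/
def mapSub (A : Matrix ι ι F) (W : Submodule F (ι → F)) : Submodule F (ι → F) :=
  W.map A.mulVecLin

variable (F ι) in
/-- A parabolic subgroup of `GL(F^ι)`, given by the flag (a chain of subspaces, containing `0` and
the whole space) of which it is the stabiliser. -/
@[ext]
structure Parabolic where
  flag : Set (Submodule F (ι → F))
  isChain : IsChain (· ≤ ·) flag
  bot_mem : ⊥ ∈ flag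
  top_mem : ⊤ ∈ flag

namespace Parabolic

/-- The group `P(F)`. -/
def points (P : Parabolic F ι) : Set (GL ι F) :=
  {g | ∀ W ∈ P.flag, mapSub (g : Matrix ι ι F) W = W}

/-- The Lie algebra `𝔭` of `P`. -/
def lie (P : Parabolic F ι) : Set (Matrix ι ι F) :=
  {Y | ∀ W ∈ P.flag, mapSub Y W ≤ W}

/-- The Lie algebra `𝔫_P` of the unipotent radical of `P`: it maps every nonzero member of the flag
into a strictly smaller one. -/
def nil (P : Parabolic F ι) : Set (Matrix ι ι F) :=
  {Y | ∀ W ∈ P.flag, W ≠ ⊥ → ∃ W' ∈ P.flag, W' < W ∧ mapSub Y W ≤ W'}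

/-- The group `N_P(F)` of points of the unipotent radical of `P`. -/
def unip (P : Parabolic F ι) : Set (GL ι F) :=
  {g | (g : Matrix ι ι F) - 1 ∈ P.nil}

/-- The conjugate parabolic subgroup `g P g⁻¹`, stabiliser of the translated flag. -/
def conj (g : GL ι F) (P : Parabolic F ι) : Parabolic F ι where
  flag := mapSub (g : Matrix ι ι F) '' P.flag
  isChain := by
    rintro _ ⟨W, hW, rfl⟩ _ ⟨W', hW', rfl⟩ _
    exact (P.isChain.total hW hW').imp (fun h => Submodule.map_mono h)
      (fun h => Submodule.map_mono h)
  bot_mem := ⟨⊥, P.bot_mem, by simp [mapSub]⟩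
  top_mem := ⟨⊤, P.top_mem, by
    rw [mapSub, Submodule.map_top, LinearMap.range_eq_top]
    intro v
    exact ⟨((g⁻¹ : GL ι F) : Matrix ι ι F) *ᵥ v, by
      simp [Matrix.mulVec_mulVec]⟩⟩

end Parabolic

/-! ### The Levi subgroup attached to a partition of the basis

A map `c : ι → β` cuts the basis into blocks. `M` denotes the group of block diagonal matrices.
The block determinants `det_b`, `b : β`, form a basis of the group `X^*(M)` of rational characters
(the blocks being nonempty). Accordingly `a_M = Hom(X^*(M), ℝ)` is identified with `β → ℝ`, its
complexified dual with `β → ℂ`, and the pairing is `⟨λ, H⟩ = ∑ b, λ b * H b`.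
A root of `A_M` is a pair `α = (b, b')` of distinct blocks: on the element `Z` of `𝔞_M` with
eigenvalue `z b` on the block `b`, it takes the value `z b - z b'`; its coroot pairs with `λ` to
`λ b - λ b'`; and `-α = (b', b) = α.swap`. -/

/-- The points of the Levi subgroup `M`. -/
def levi (F : Type*) [Field F] (c : ι → β) : Set (GL ι F) :=
  {g | ∀ a a', c a ≠ c a' → (g : Matrix ι ι F) a a' = 0}

/-- The set `𝒫(M)` of parabolic subgroups `P` of which `M` is a Levi factor: `P = M ⋉ N_P`. -/
def parabolicsWithLevi (F : Type*) [Field F] (c : ι → β) : Set (Parabolic F ι) :=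
  {P | levi F c ⊆ P.points ∧ levi F c ∩ P.unip = {1} ∧
    ∀ p ∈ P.points, ∃ m ∈ levi F c, ∃ n ∈ P.unip, p = m * n}

/-- The element of `𝔞_M(F)` with eigenvalue `z b` on the block `b`. -/
def center (c : ι → β) (z : β → F) : Matrix ι ι F := Matrix.diagonal fun a => z (c a)

/-- The regular elements of `𝔞_M(F)`, where no root of `A_M` vanishes. -/
def regular (F β : Type*) [Field F] : Set (β → F) := {z | ∀ b b', b ≠ b' → z b - z b' ≠ 0}

/-- `Σ(P, A_M)`: the roots of `A_M` in the Lie algebra of `P`. -/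
def roots (c : ι → β) (P : Parabolic F ι) : Set (β × β) :=
  {α | α.1 ≠ α.2 ∧ ∃ Y ∈ P.lie, Y ≠ 0 ∧
    ∀ z : β → F, center c z * Y - Y * center c z = (z α.1 - z α.2) • Y}

/-- The Lie algebra of the Levi subgroup `L ⊇ M` whose roots are `± α`. -/
def leviLie (F : Type*) [Field F] (c : ι → β) (α : β × β) : Set (Matrix ι ι F) :=
  {Y | ∀ a a', Y a a' ≠ 0 →
    c a = c a' ∨ (c a = α.1 ∧ c a' = α.2) ∨ (c a = α.2 ∧ c a' = α.1)}

/-- The pairing `⟨λ, H⟩` of `a_{M,ℂ}^*` with `a_M`. -/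
def pairing (l : β → ℂ) (H : β → ℝ) : ℂ := ∑ b, l b * (H b : ℂ)

/-- The pairing `⟨λ, α^∨⟩` with the coroot of `α`. -/
def coroot (l : β → ℂ) (α : β × β) : ℂ := l α.1 - l α.2

/-! ### Induced orbits -/

/-- `U` is a Zariski open and Zariski dense subset of the set `V` of matrices. -/
def IsZariskiOpenDense (U V : Set (Matrix ι ι F)) : Prop :=
  U ⊆ V ∧
  (∃ S : Set (MvPolynomial (ι × ι) F), ∀ Y ∈ V,
    (Y ∈ U ↔ ∃ f ∈ S, MvPolynomial.eval (fun q => Y q.1 q.2) f ≠ 0)) ∧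
  ∀ f : MvPolynomial (ι × ι) F, (∀ Y ∈ U, MvPolynomial.eval (fun q => Y q.1 q.2) f = 0) →
    ∀ Y ∈ V, MvPolynomial.eval (fun q => Y q.1 q.2) f = 0

/-- The conjugacy class of a matrix. -/
def orbit (Y : Matrix ι ι F) : Set (Matrix ι ι F) :=
  {Y' | ∃ g : GL ι F, Y' = (g : Matrix ι ι F) * Y * ((g⁻¹ : GL ι F) : Matrix ι ι F)}

/-- The Richardson orbit `I_P^G(0)`, i.e. the orbit that meets `𝔫_P` in an open dense subset. -/
def richardson (P : Parabolic F ι) : Set (Matrix ι ι F) :=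
  {Y | IsZariskiOpenDense (orbit Y ∩ P.nil) P.nil}

/-- The set `ℛ(X)` of Richardson parabolic subgroups of `X`. -/
def richardsonParabolics (X : Matrix ι ι F) : Set (Parabolic F ι) :=
  {P | X ∈ P.nil ∧ X ∈ richardson P}

/-- The Weyl group `W`, realised as the permutation matrices. -/
def weyl (F ι : Type*) [Field F] [Fintype ι] [DecidableEq ι] : Set (GL ι F) :=
  {w | ∃ σ : Equiv.Perm ι, (w : Matrix ι ι F) = σ.permMatrix F}

section Local

variable [TopologicalSpace F] (hF : LocalField F) (c : ι → β)

/-! ### The functions `H_P` and `R_P` -/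

/-- `H_P(g)`, for `P` in `𝒫(M)`: its coordinates are `log |det_b(m)|`, where `g = m n k` is an
Iwasawa decomposition with `m` in `M(F)`, `n` in `N_P(F)` and `k` in `K`. -/
def iwasawaH (P : Parabolic F ι) (g : GL ι F) (b : β) : ℝ :=
  let m : GL ι F := Classical.epsilon fun m =>
    m ∈ levi F c ∧ ∃ n ∈ P.unip, ∃ k ∈ hF.maxCompact, g = m * n * k
  Real.log (hF.abs ((m : Matrix ι ι F).toSquareBlock c b).det)

/-- `R_P(g) = H_P(w_P g)`, where `w_P` in `W` is such that `w_P⁻¹ P w_P` lies in `ℛ(X)`. -/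
def richardsonH (X : Matrix ι ι F) (P : Parabolic F ι) (g : GL ι F) : β → ℝ :=
  iwasawaH hF c P
    ((Classical.epsilon fun w : GL ι F =>
      w ∈ weyl F ι ∧ P.conj w⁻¹ ∈ richardsonParabolics X) * g)

/-! ### Arthur's weights for the zero orbit of the Lie algebra of `M` -/

/-- The element `n(Z, Y)` of `N_P(F)`: it is determined by `n⁻¹ Z n = Z + Y`. -/
def unipSol (P : Parabolic F ι) (z : β → F) (Y : Matrix ι ι F) : GL ι F :=
  Classical.epsilon fun n : GL ι F => n ∈ P.unip ∧
    ((n⁻¹ : GL ι F) : Matrix ι ι F) * center c z * (n : Matrix ι ι F) = center c z + Y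

/-- `|α(Z)| ^ (ρ ⟨λ, α^∨⟩)`. -/
def rootFactor (α : β × β) (ρ : ℝ) (l : β → ℂ) (z : β → F) : ℂ :=
  ((hF.abs (z α.1 - z α.2) : ℝ) : ℂ) ^ ((ρ : ℂ) * coroot l α)

/-- The property that characterises the exponent `ρ(α)`: it is nonnegative and, for `P` and `P'` in
`𝒫(M)` such that `-α` is a root in `P` and `α` is a root in `P'`, and for every `λ` with
`Re ⟨λ, α^∨⟩ > 0`, the limit of `|α(Z)| ^ (ρ ⟨λ, α^∨⟩) exp(-⟨λ, H_{P'}(n(Z, Y))⟩)` as the regular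
element `Z` tends to `0` exists for every `Y` in `𝔫_P ∩ 𝔩`, and is not identically zero in `Y`. -/
def IsExponent (α : β × β) (ρ : ℝ) : Prop :=
  0 ≤ ρ ∧
  ∀ P ∈ parabolicsWithLevi F c, ∀ P' ∈ parabolicsWithLevi F c,
    α.swap ∈ roots c P → α ∈ roots c P' →
    ∀ l : β → ℂ, 0 < (coroot l α).re →
      ∃ w : Matrix ι ι F → ℂ,
        (∀ Y ∈ P.nil ∩ leviLie F c α,
          Tendsto (fun z => rootFactor hF α ρ l z *
              Complex.exp (-pairing l (iwasawaH hF c P' (unipSol c P z Y))))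
            (𝓝[regular F β] 0) (𝓝 (w Y))) ∧
        ∃ Y ∈ P.nil ∩ leviLie F c α, w Y ≠ 0

/-- The exponent `ρ(α)`. -/
def exponent (α : β × β) : ℝ := Classical.epsilon (IsExponent hF c α)

open Classical in
/-- `w_{P'}(λ, Z, Y)`, with base point `P`. The product is over `Σ(P', A_M) ∩ Σ(P̄, A_M)`, where
`P̄` is opposite to `P`, so that `Σ(P̄, A_M) = -Σ(P, A_M)`. -/
def weightAt (P P' : Parabolic F ι) (l : β → ℂ) (z : β → F) (Y : Matrix ι ι F) : ℂ :=
  (∏ α ∈ Finset.univ.filter (fun α : β × β => α ∈ roots c P' ∧ α.swap ∈ roots c P),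
      rootFactor hF α (exponent hF c α) l z) *
    Complex.exp (-pairing l (iwasawaH hF c P' (unipSol c P z Y)))

/-- `w_{P'}(λ, Y)`, with base point `P`: the limit of `w_{P'}(λ, Z, Y)` as the regular element `Z`
tends to `0`. -/
def weight (P P' : Parabolic F ι) (l : β → ℂ) (Y : Matrix ι ι F) : ℂ :=
  limUnder (𝓝[regular F β] 0) fun z => weightAt hF c P P' l z Y

end Local

end Field

/-! ### Standard nilpotent endomorphisms -/

/-- The index set of the basis `e^i_{k,j}` with `1 ≤ i ≤ j ≤ r` and `1 ≤ k ≤ d_j`. The element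
`⟨j, i, k⟩` stands for `e^{i+1}_{k+1,j+1}`. -/
abbrev StdIndex (r : ℕ) (d : ℕ → ℕ) : Type :=
  Σ j : Fin r, Fin ((j : ℕ) + 1) × Fin (d ((j : ℕ) + 1))

/-- The standard nilpotent `X`, with `X e^i_{k,j} = e^{i-1}_{k,j}` for `i > 1` and
`X e^1_{k,j} = 0`. -/
def stdNilpotent (F : Type*) [Field F] (r : ℕ) (d : ℕ → ℕ) :
    Matrix (StdIndex r d) (StdIndex r d) F :=
  fun a b => if a.1 = b.1 ∧ (a.2.1 : ℕ) + 1 = b.2.1 ∧ (a.2.2 : ℕ) = b.2.2 then 1 else 0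

/-- The index `i` of `e^i_{k,j}` (shifted by one). The kernel of `X ^ k` is spanned by the basis
vectors of index `i ≤ k`, so the blocks of this map are the successive steps of the flag of iterated
kernels, and the Levi subgroup attached to it is the Levi factor, containing the diagonal torus, of
the stabiliser of that flag. -/
def stdLevel (r : ℕ) (d : ℕ → ℕ) (a : StdIndex r d) : Fin r :=
  ⟨a.2.1, by have := a.2.1.isLt; have := a.1.isLt; omega⟩

end

end ArthurGM

/-!
A parabolic subgroup `P` with Levi factor `M` amounts to an ordering `q` of the blocks of `M`
(`exists_height`), and everything is computed for the parabolic subgroups `ofHeight F (q ∘ c)`. For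
these, `H_P(g)` can be read off from any decomposition `g = pk` with `p ∈ P(F)` and `k ∈ K`
(`iwasawaH_mul_eq_log`), and it is a continuous function of `g` (`tendsto_iwasawaH`). The three
kinds of local fields enter only through the properties of `K` collected in `IsStandardCompact` and
through the absolute value being multiplicative and continuous.

Let `w_q` be the permutation matrix which sorts each Jordan chain of `X` in the order `q`
(`stdPerm`), and let `X_q = w_q X w_q⁻¹`. Modulo `[𝔭, X]` every element of the nilradical vanishes
(`single_mem_map_adStd`), so that `X_q` is a Richardson element of `P_q` (`mem_richardson`).
Comparing dimensions, `gXg⁻¹ ∈ 𝔫_P` forces `g ∈ P` when `X` itself is a Richardson element of `P`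
(`mem_upper_of_conj_mem`): the centraliser of `X` lies in `𝔭`. Consequently the choice of `w_P` in
the definition of `R_P` is immaterial, `R_P(g) = H_P(w_q g)` (`richardsonH_ofHeight`), and every `Y
∈ 𝔫_P` in the Richardson orbit is `p₀X_qp₀⁻¹` for some `p₀ ∈ P`.

The heart of the matter is Newton interpolation. Let `V` be the block matrix of the Vandermonde
matrices of all Jordan chains at the point `Z`, let `C_q` be the matrix of coefficients of the
Newton polynomials `∏ (T - z_u)` of the chains, the levels being taken in the order `q`, and let
`Δ_q` be the diagonal part of the triangular matrix `C_q V` of their values. The recursion of the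
Newton polynomials says that the columns of `C_q V` are eigenvectors of `Z + X_q`, whence `n_q(Z,
X_q) C_q V = Δ_q` (`exists_unip_newton`). As `V` does not depend on `q`,

  `n_{q₁}(Z, X_{q₁}) = Δ_{q₁} Δ_{q₂}⁻¹ · n_{q₂}(Z, X_{q₂}) · C_{q₂} C_{q₁}⁻¹`,

where `C_q` is polynomial in `Z` and equal to `w_q` at `Z = 0` (`newtonCoeff_zero`). Applying
`H_{P₂}`, the singularity at `Z = 0` is that of the explicit diagonal factor. It is cancelled
exactly by the factors `|α(Z)|^(ρ(α)⟨λ, α^∨⟩)` (`sum_roots_eq`), and `H_{P₂}(w_{q₂} w_{q₁}⁻¹)` is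
what remains.

For general `Y = p₀X_{q₁}p₀⁻¹`, a polynomial family of intertwiners (`exists_intertwiner`)
conjugates `Z + X_{q₁}` to `Z + Y` by elements of `P₁` that tend to `p₀`. This changes the limit of
`H_{P₂}(n_{P₁}(Z, Y))` into the sum of the Levi part of `p₀` and of `H_{P₂}(w_{q₂} w_{q₁}⁻¹ p₀⁻¹)`,
which is `R_{P₂}(g) - R_{P₁}(g)` (`tendsto_weightAt`). The invariance under `P₁ ∩ K` follows, since
`Y` and `pYp⁻¹` satisfy the comparison formula with the same `g`.

As to `ρ(α)`, the weight of a matrix `Y` of rank `s` supported in a single block reduces to a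
computation with `2 × 2` matrices, through a factorization `Y = BC` of rank `s`, and it grows like a
power of `|α(Z)|` with exponent `-s⟨λ, α^∨⟩` (`BlockFactorization.tendsto_weight`). Hence `ρ(α)` is
the largest possible rank, the smaller of the sizes of the two blocks (`isExponent_min`). This is
the number of Jordan chains through both levels (`stdExponent_eq_min`), which is the multiplicity of
`α(Z)` in the diagonal factors above.
-/

set_option linter.unusedSectionVars false

namespace ArthurGM

/-! ### Standard compact subgroups and the Iwasawa decomposition -/

section Iwasawa

variable {F : Type*} [Field F] {ι : Type*} [Fintype ι] [DecidableEq ι]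

/-- The properties of the standard maximal compact subgroup `K` of `GL(F^ι)` that the theory of
the Iwasawa decomposition rests on. The field `step` says that the stabiliser in `K` of a set `U`
of basis vectors and of the span of the others acts transitively on the lines of (rows
supported in) that span; this is what allows one to triangularise a matrix row by row. -/
structure IsStandardCompact [TopologicalSpace F] (K : Set (GL ι F)) : Prop where
  one_mem : 1 ∈ K
  mul_mem : ∀ {g h}, g ∈ K → h ∈ K → g * h ∈ K
  inv_mem : ∀ {g}, g ∈ K → g⁻¹ ∈ K
  perm_mem : ∀ (σ : Equiv.Perm ι) (g : GL ι F), (g : Matrix ι ι F) = σ.permMatrix F → g ∈ K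
  isCompact : IsCompact ((fun g : GL ι F => (g : Matrix ι ι F)) '' K)
  step : ∀ (U : Finset ι) (a₀ : ι), a₀ ∉ U → ∀ v : ι → F, ∃ k ∈ K,
    (∀ a, ∀ a' ∈ U, (k : Matrix ι ι F) a a' = if a = a' then 1 else 0) ∧
    (∀ a ∈ U, ∀ a' ∉ U, (k : Matrix ι ι F) a a' = 0) ∧
    ∀ a' ∉ insert a₀ U, ∑ a, v a * (k : Matrix ι ι F) a a' = 0

/-- Triangularisation by `K`, one row at a time, in decreasing order of the heights `κ`. -/
theorem IsStandardCompact.exists_blockTriangular [TopologicalSpace F] {K : Set (GL ι F)}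
    (hK : IsStandardCompact K) (κ : ι → ℕ) (g : GL ι F) :
    ∃ p k : GL ι F, (p : Matrix ι ι F).BlockTriangular κ ∧ k ∈ K ∧ g = p * k := by
  have key : ∀ U : Finset ι, ∃ k ∈ K,
      (∀ a ∈ U, ∀ a' ∉ U, ((g * k : GL ι F) : Matrix ι ι F) a a' = 0) ∧
      (∀ a ∈ U, ∀ a' ∈ U, κ a' < κ a → ((g * k : GL ι F) : Matrix ι ι F) a a' = 0) := by
    intro U
    induction U using Finset.induction_on_min_value κ with
    | empty => exact ⟨1, hK.one_mem, by simp, by simp⟩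
    | insert a₀ U ha₀ hmin ih =>
      obtain ⟨k, hk, h1, h2⟩ := ih
      obtain ⟨k', hk', e1, e2, e3⟩ := hK.step U a₀ ha₀
        (fun a => ((g * k : GL ι F) : Matrix ι ι F) a₀ a)
      have hout : ∀ a ∈ U, ∀ a' ∉ U, ((g * (k * k') : GL ι F) : Matrix ι ι F) a a' = 0 := by
        intro a ha a' ha'
        rw [← mul_assoc, Units.val_mul, Matrix.mul_apply]
        refine Finset.sum_eq_zero fun x _ => ?_
        by_cases hx : x ∈ U
        · rw [e2 x hx a' ha', mul_zero]
        · rw [h1 a ha x hx, zero_mul]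
      have hin : ∀ a, ∀ a' ∈ U, ((g * (k * k') : GL ι F) : Matrix ι ι F) a a' =
          ((g * k : GL ι F) : Matrix ι ι F) a a' := by
        intro a a' ha'
        rw [← mul_assoc, Units.val_mul, Matrix.mul_apply]
        rw [Finset.sum_eq_single a' (fun x _ hx => by rw [e1 x a' ha', if_neg hx, mul_zero])
          (by simp), e1 a' a' ha', if_pos rfl, mul_one]
      refine ⟨k * k', hK.mul_mem hk hk', ?_, ?_⟩
      · intro a ha a' ha'
        rcases Finset.mem_insert.1 ha with rfl | ha
        · rw [← mul_assoc, Units.val_mul, Matrix.mul_apply]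
          exact e3 a' ha'
        · exact hout a ha a' fun h => ha' (Finset.mem_insert_of_mem h)
      · intro a ha a' ha' hlt
        rcases Finset.mem_insert.1 ha with rfl | ha
        · rcases Finset.mem_insert.1 ha' with rfl | ha'
          · exact absurd hlt (lt_irrefl _)
          · exact absurd (hmin a' ha') (not_le.2 hlt)
        · by_cases h : a' ∈ U
          · rw [hin a a' h]
            exact h2 a ha a' h hlt
          · exact hout a ha a' h
  obtain ⟨k, hk, -, h2⟩ := key Finset.univ
  refine ⟨g * k, k⁻¹, fun a a' h => h2 a (Finset.mem_univ _) a' (Finset.mem_univ _) h,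
    hK.inv_mem hk, by simp⟩

end Iwasawa

section Archimedean

variable {𝕜 : Type*} [RCLike 𝕜] {F : Type*} [Field F] {ι : Type*} [Fintype ι] [DecidableEq ι]

theorem isCompact_unitaryGroup :
    IsCompact (Matrix.unitaryGroup ι 𝕜 : Set (Matrix ι ι 𝕜)) := by
  have h1 : IsCompact (Set.univ.pi fun _ : ι => Set.univ.pi fun _ : ι =>
      Metric.closedBall (0 : 𝕜) 1 : Set (Matrix ι ι 𝕜)) :=
    isCompact_univ_pi fun _ => isCompact_univ_pi fun _ => isCompact_closedBall _ _
  refine h1.of_isClosed_subset ?_ ?_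
  · have : (Matrix.unitaryGroup ι 𝕜 : Set (Matrix ι ι 𝕜)) =
        {A : Matrix ι ι 𝕜 | A * star A = 1} := by
      ext A; exact Matrix.mem_unitaryGroup_iff
    rw [this]
    exact isClosed_eq (by fun_prop) continuous_const
  · intro A hA
    simp only [Set.mem_pi, Set.mem_univ, forall_true_left, mem_closedBall_zero_iff]
    exact fun i j => entry_norm_bound_of_unitary hA i j

/-- A unitary matrix fixing the basis vectors in `U` and moving the part outside `U` of a
given row into one coordinate. -/
theorem exists_unitary_step (U : Finset ι) (a₀ : ι) (ha₀ : a₀ ∉ U) (v : ι → 𝕜) :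
    ∃ k ∈ Matrix.unitaryGroup ι 𝕜,
      (∀ a, ∀ a' ∈ U, k a a' = if a = a' then 1 else 0) ∧
      (∀ a ∈ U, ∀ a' ∉ U, k a a' = 0) ∧
      ∀ a' ∉ insert a₀ U, ∑ a, v a * k a a' = 0 := by
  let v' : EuclideanSpace 𝕜 ι := WithLp.toLp 2 fun a => if a ∈ U then 0 else star (v a)
  by_cases hv' : v' = 0
  · refine ⟨1, one_mem _, fun a a' _ => Matrix.one_apply, fun a ha a' ha' =>
      Matrix.one_apply_ne (fun h => ha' (h ▸ ha)), fun a' ha' => ?_⟩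
    have hnot : a' ∉ U := fun h => ha' (Finset.mem_insert_of_mem h)
    have h0 : v a' = 0 := by
      have := congrArg (fun w : EuclideanSpace 𝕜 ι => w a') hv'
      simpa [v', hnot] using this
    simp [Matrix.one_apply, h0]
  · let w : ι → EuclideanSpace 𝕜 ι := fun a =>
      if a = a₀ then (‖v'‖⁻¹ : 𝕜) • v' else EuclideanSpace.single a 1
    have hperp : ∀ a ∈ U, inner 𝕜 (EuclideanSpace.single a (1 : 𝕜)) v' = 0 := by
      intro a ha
      simp [v', EuclideanSpace.inner_single_left, ha]
    have hw : Orthonormal 𝕜 ((insert a₀ (U : Set ι)).domRestrict w) := by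
      have hne : ∀ a ∈ U, a ≠ a₀ := fun a ha h => ha₀ (h ▸ ha)
      constructor
      · rintro ⟨a, ha⟩
        by_cases h : a = a₀
        · simp [w, h, norm_smul, norm_ne_zero_iff.2 hv']
        · simp [w, h]
      · rintro ⟨a, ha⟩ ⟨b, hb⟩ hsub
        have hab : a ≠ b := fun h => hsub (Subtype.ext h)
        rcases ha with rfl | ha <;> rcases hb with rfl | hb
        · exact absurd rfl hab
        · simp only [Set.domRestrict_apply, w, if_true, hab.symm, if_false, inner_smul_left]
          refine mul_eq_zero_of_right _ ?_
          rw [← inner_conj_symm]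
          rw [hperp b hb, map_zero]
        · simp only [Set.domRestrict_apply, w, if_true, hab, if_false, inner_smul_right]
          exact mul_eq_zero_of_right _ (hperp a ha)
        · simp [w, hne a ha, hne b hb, EuclideanSpace.inner_single_left, hab]
    obtain ⟨b, hb⟩ := hw.exists_orthonormalBasis_extension_of_card_eq (by simp)
    have hbU : ∀ a ∈ U, b a = EuclideanSpace.single a 1 := by
      intro a ha
      rw [hb a (Or.inr ha)]
      simp [w, show a ≠ a₀ from fun h => ha₀ (h ▸ ha)]
    have h1 : ∀ a ∈ U, ∀ a' ∉ U, b a' a = 0 := by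
      intro a ha a' ha'
      have := b.orthonormal.2 (show a ≠ a' from fun h => ha' (h ▸ ha))
      simpa [hbU a ha, EuclideanSpace.inner_single_left] using this
    refine ⟨(EuclideanSpace.basisFun ι 𝕜).toBasis.toMatrix b,
      OrthonormalBasis.toMatrix_orthonormalBasis_mem_unitary _ _, ?_, ?_, ?_⟩
    · intro a a' ha'
      simp [Module.Basis.toMatrix_apply, hbU a' ha']
    · intro a ha a' ha'
      simpa [Module.Basis.toMatrix_apply] using h1 a ha a' ha'
    · intro a' ha'
      rw [Finset.mem_insert, not_or] at ha'
      have h2 : inner 𝕜 (b a₀) (b a') = 0 := b.orthonormal.2 (Ne.symm ha'.1)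
      rw [hb a₀ (Or.inl rfl)] at h2
      simp only [w, if_true, inner_smul_left] at h2
      have h3 : inner 𝕜 v' (b a') = 0 := by
        rcases mul_eq_zero.1 h2 with h | h
        · simp [norm_ne_zero_iff.2 hv'] at h
        · exact h
      rw [PiLp.inner_apply] at h3
      rw [← h3]
      refine Finset.sum_congr rfl fun a _ => ?_
      by_cases ha : a ∈ U
      · simp [Module.Basis.toMatrix_apply, h1 a ha a' ha'.2]
      · simp [Module.Basis.toMatrix_apply, v', ha, mul_comm]

/-- The unitary groups: a vector is moved to a basis vector by completing it, normalised, to an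
orthonormal basis. -/
theorem isStandardCompact_unitary [TopologicalSpace F] (e : F ≃+* 𝕜) (he : IsHomeomorph e) :
    IsStandardCompact {g : GL ι F | (g : Matrix ι ι F).map e ∈ Matrix.unitaryGroup ι 𝕜} := by
  have hlift : ∀ A ∈ Matrix.unitaryGroup ι 𝕜, ∃ g : GL ι F, (g : Matrix ι ι F).map e = A := by
    intro A hA
    refine ⟨⟨A.map e.symm, (star A).map e.symm, ?_, ?_⟩, ?_⟩
    · rw [← Matrix.map_mul, Matrix.mem_unitaryGroup_iff.1 hA, Matrix.map_one _ (by simp) (by simp)]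
    · rw [← Matrix.map_mul, Matrix.mem_unitaryGroup_iff'.1 hA, Matrix.map_one _ (by simp) (by simp)]
    · ext i j; simp
  have hmul : ∀ g h : GL ι F, ((g * h : GL ι F) : Matrix ι ι F).map e =
      (g : Matrix ι ι F).map e * (h : Matrix ι ι F).map e := by
    intro g h
    rw [Units.val_mul, Matrix.map_mul]
  refine ⟨?_, ?_, ?_, ?_, ?_, ?_⟩
  · simp [Matrix.map_one, one_mem]
  · intro g h hg hh
    simp only [Set.mem_ofPred_eq] at *
    rw [hmul]
    exact mul_mem hg hh
  · intro g hg
    simp only [Set.mem_ofPred_eq] at *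
    have h1 := hmul g g⁻¹
    rw [mul_inv_cancel, Units.val_one, Matrix.map_one _ (by simp) (by simp)] at h1
    have h2 : ((g⁻¹ : GL ι F) : Matrix ι ι F).map e = star ((g : Matrix ι ι F).map e) := by
      calc _ = star ((g : Matrix ι ι F).map e) * ((g : Matrix ι ι F).map e) *
            ((g⁻¹ : GL ι F) : Matrix ι ι F).map e := by
              rw [Matrix.mem_unitaryGroup_iff'.1 hg, one_mul]
        _ = _ := by rw [mul_assoc, ← h1, mul_one]
    rw [h2]
    exact Unitary.star_mem hg
  · intro σ g hg
    simp only [Set.mem_ofPred_eq]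
    have : (g : Matrix ι ι F).map e = σ.permMatrix 𝕜 := by
      rw [hg]
      ext i j
      simp [Equiv.Perm.permMatrix, PEquiv.toMatrix_apply, apply_ite e]
    rw [this, Matrix.mem_unitaryGroup_iff]
    ext i j
    simp [Matrix.mul_apply, Matrix.star_apply, Equiv.Perm.permMatrix, PEquiv.toMatrix_apply,
      Matrix.one_apply, eq_comm]
  · have : ((fun g : GL ι F => (g : Matrix ι ι F)) ''
        {g : GL ι F | (g : Matrix ι ι F).map e ∈ Matrix.unitaryGroup ι 𝕜}) =
        (fun A : Matrix ι ι 𝕜 => A.map e.symm) '' (Matrix.unitaryGroup ι 𝕜) := by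
      ext A
      constructor
      · rintro ⟨g, hg, rfl⟩
        exact ⟨_, hg, by ext i j; simp⟩
      · rintro ⟨B, hB, rfl⟩
        obtain ⟨g, hg⟩ := hlift B hB
        exact ⟨g, by simpa [hg] using hB, by rw [← hg]; ext i j; simp⟩
    rw [this]
    refine isCompact_unitaryGroup.image ?_
    have : Continuous e.symm := by
      have := he.homeomorph.symm.continuous
      convert this using 1
      ext x
      apply e.injective
      rw [RingEquiv.apply_symm_apply]
      exact (he.homeomorph.apply_symm_apply x).symm
    exact Continuous.matrix_map continuous_id this
  · intro U a₀ ha₀ v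
    obtain ⟨k, hk, h1, h2, h3⟩ := exists_unitary_step U a₀ ha₀ (fun a => e (v a))
    obtain ⟨g, hg⟩ := hlift k hk
    have hgk : ∀ a a', e ((g : Matrix ι ι F) a a') = k a a' := fun a a' => by
      rw [← hg, Matrix.map_apply]
    refine ⟨g, by simpa [hg] using hk, ?_, ?_, ?_⟩
    · intro a a' ha'
      apply e.injective
      rw [hgk, h1 a a' ha']
      simp [apply_ite e]
    · intro a ha a' ha'
      apply e.injective
      rw [hgk, h2 a ha a' ha', map_zero]
    · intro a' ha'
      apply e.injective
      rw [map_sum, map_zero, ← h3 a' ha']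
      simp [hgk]

end Archimedean

section Nonarchimedean

open scoped ValuativeRel
open ValuativeRel

variable {F : Type*} [Field F] {ι : Type*} [Fintype ι] [DecidableEq ι]

/-- The group `GL(𝒪)`: a row is cleared by a transvection, whose entries are integral once an entry
of maximal absolute value has been moved to the pivot by a transposition. -/
theorem isStandardCompact_integral [TopologicalSpace F] [ValuativeRel F]
    [IsNonarchimedeanLocalField F] :
    IsStandardCompact {g : GL ι F | ∀ a b, (g : Matrix ι ι F) a b ∈ 𝒪[F] ∧
      ((g⁻¹ : GL ι F) : Matrix ι ι F) a b ∈ 𝒪[F]} := by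
  have hmul : ∀ A B : Matrix ι ι F, (∀ a b, A a b ∈ 𝒪[F]) → (∀ a b, B a b ∈ 𝒪[F]) →
      ∀ a b, (A * B) a b ∈ 𝒪[F] := by
    intro A B hA hB a b
    rw [Matrix.mul_apply]
    exact sum_mem fun x _ => mul_mem (hA a x) (hB x b)
  have hone : ∀ a b, (1 : Matrix ι ι F) a b ∈ 𝒪[F] := by
    intro a b
    rw [Matrix.one_apply]
    split_ifs
    exacts [one_mem _, zero_mem _]
  have hperm : ∀ (σ : Equiv.Perm ι) a b, σ.permMatrix F a b ∈ 𝒪[F] := by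
    intro σ a b
    simp only [Equiv.Perm.permMatrix, PEquiv.toMatrix_apply]
    split_ifs
    exacts [one_mem _, zero_mem _]
  have mul_mem' : ∀ {g h : GL ι F}, (∀ a b, (g : Matrix ι ι F) a b ∈ 𝒪[F] ∧
      ((g⁻¹ : GL ι F) : Matrix ι ι F) a b ∈ 𝒪[F]) → (∀ a b, (h : Matrix ι ι F) a b ∈ 𝒪[F] ∧
      ((h⁻¹ : GL ι F) : Matrix ι ι F) a b ∈ 𝒪[F]) →
      ∀ a b, ((g * h : GL ι F) : Matrix ι ι F) a b ∈ 𝒪[F] ∧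
      (((g * h)⁻¹ : GL ι F) : Matrix ι ι F) a b ∈ 𝒪[F] := by
    intro g h hg hh a b
    refine ⟨?_, ?_⟩
    · rw [Units.val_mul]
      exact hmul _ _ (fun a b => (hg a b).1) (fun a b => (hh a b).1) a b
    · rw [_root_.mul_inv_rev, Units.val_mul]
      exact hmul _ _ (fun a b => (hh a b).2) (fun a b => (hg a b).2) a b
  have perm_mem' : ∀ (σ : Equiv.Perm ι) (g : GL ι F), (g : Matrix ι ι F) = σ.permMatrix F →
      ∀ a b, (g : Matrix ι ι F) a b ∈ 𝒪[F] ∧ ((g⁻¹ : GL ι F) : Matrix ι ι F) a b ∈ 𝒪[F] := by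
    intro σ g hg a b
    have h1 : ((g⁻¹ : GL ι F) : Matrix ι ι F) = (σ⁻¹).permMatrix F := by
      calc _ = ((g⁻¹ : GL ι F) : Matrix ι ι F) * ((g : Matrix ι ι F) * (σ⁻¹).permMatrix F) := by
            rw [hg, ← Matrix.permMatrix_mul, inv_mul_cancel, Matrix.permMatrix_one, mul_one]
        _ = _ := by rw [← mul_assoc, Units.inv_mul, one_mul]
    rw [hg, h1]
    exact ⟨hperm σ a b, hperm _ a b⟩
  refine ⟨?_, mul_mem', ?_, perm_mem', ?_, ?_⟩
  · simp only [Set.mem_ofPred_eq, inv_one, Units.val_one, and_self]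
    exact hone
  · intro g hg a b
    rw [inv_inv]
    exact ⟨(hg a b).2, (hg a b).1⟩
  · have : T2Space F := by
      let := IsTopologicalAddGroup.rightUniformSpace F
      have := isUniformAddGroup_of_addCommGroup (G := F)
      infer_instance
    have hO : IsCompact (𝒪[F] : Set F) := IsNonarchimedeanLocalField.isCompact_closedBall F 1
    have h1 : IsCompact (Set.univ.pi fun _ : ι => Set.univ.pi fun _ : ι =>
        (𝒪[F] : Set F) : Set (Matrix ι ι F)) :=
      isCompact_univ_pi fun _ => isCompact_univ_pi fun _ => hO
    have h2 := (h1.prod h1).inter_right (t := {q : Matrix ι ι F × Matrix ι ι F | q.1 * q.2 = 1})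
      (isClosed_eq (by fun_prop) continuous_const)
    convert! h2.image continuous_fst using 1
    ext A
    constructor
    · rintro ⟨g, hg, rfl⟩
      refine ⟨((g : Matrix ι ι F), ((g⁻¹ : GL ι F) : Matrix ι ι F)), ⟨⟨?_, ?_⟩, ?_⟩, rfl⟩
      · exact fun a _ b _ => (hg a b).1
      · exact fun a _ b _ => (hg a b).2
      · exact g.mul_inv
    · rintro ⟨⟨A, B⟩, ⟨⟨hA, hB⟩, hAB⟩, rfl⟩
      refine ⟨⟨A, B, hAB, mul_eq_one_comm.1 hAB⟩, fun a b => ⟨?_, ?_⟩, rfl⟩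
      · exact hA a trivial b trivial
      · exact hB a trivial b trivial
  · intro U a₀ ha₀ v
    obtain ⟨m, hm, hmax⟩ := Finset.exists_max_image (Finset.univ.filter fun a => a ∉ U)
      (fun a => valuation F (v a)) ⟨a₀, by simp [ha₀]⟩
    have hm : m ∉ U := by simpa using hm
    have hmax : ∀ a ∉ U, valuation F (v a) ≤ valuation F (v m) := fun a ha =>
      hmax a (by simp [ha])
    let σ := Equiv.swap m a₀
    have hσU : ∀ a, a ∈ U → σ a = a := fun a ha =>
      Equiv.swap_apply_of_ne_of_ne (fun h => hm (h ▸ ha)) (fun h => ha₀ (h ▸ ha))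
    have hσσ : ∀ a, σ (σ a) = a := Equiv.swap_apply_self _ _
    have hσU' : ∀ a, a ∉ U → σ a ∉ U := fun a ha h => ha (by rwa [← hσσ a, hσU _ h])
    let w : GL ι F := ⟨σ.permMatrix F, (σ⁻¹).permMatrix F,
      by rw [← Matrix.permMatrix_mul, inv_mul_cancel, Matrix.permMatrix_one],
      by rw [← Matrix.permMatrix_mul, mul_inv_cancel, Matrix.permMatrix_one]⟩
    let N : Matrix ι ι F := fun a a' =>
      if a = a₀ ∧ a' ∉ insert a₀ U then v (σ a') / v m else 0
    have hNO : ∀ a b, N a b ∈ 𝒪[F] := by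
      intro a b
      simp only [N]
      split_ifs with h
      · change valuation F _ ≤ 1
        rw [map_div₀]
        exact div_le_one_of_le₀
          (hmax _ (hσU' _ fun h' => h.2 (Finset.mem_insert_of_mem h'))) zero_le
      · exact zero_mem _
    have hNN : N * N = 0 := by
      ext a b
      rw [Matrix.mul_apply]
      refine Finset.sum_eq_zero fun x _ => ?_
      by_cases hx : x = a₀
      · simp [N, hx]
      · simp [N, hx]
    let u : GL ι F := ⟨1 - N, 1 + N, by rw [mul_add, sub_mul, sub_mul, hNN]; simp,
      by rw [mul_sub, add_mul, add_mul, hNN]; simp⟩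
    have hw : ∀ a a', (w : Matrix ι ι F) a a' = if σ a = a' then 1 else 0 := by
      intro a a'
      simp [w, Equiv.Perm.permMatrix, PEquiv.toMatrix_apply, eq_comm]
    have hwu : ∀ a a', ((w * u : GL ι F) : Matrix ι ι F) a a' = (1 - N) (σ a) a' := by
      intro a a'
      rw [Units.val_mul, Matrix.mul_apply, Finset.sum_eq_single (σ a)]
      · simp [hw, u]
      · intro x _ hx
        rw [hw, if_neg hx.symm, zero_mul]
      · simp
    refine ⟨w * u, mul_mem' (perm_mem' σ w rfl) ?_, ?_, ?_, ?_⟩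
    · exact fun a b => ⟨sub_mem (hone a b) (hNO a b), add_mem (hone a b) (hNO a b)⟩
    · intro a a' ha'
      rw [hwu, Matrix.sub_apply, Matrix.one_apply]
      have : (σ a = a') ↔ a = a' := by
        conv_lhs => rw [← hσU a' ha']
        simp only [EmbeddingLike.apply_eq_iff_eq]
      simp [N, ha', this]
    · intro a ha a' ha'
      have hne : a ≠ a' := fun h => ha' (h ▸ ha)
      rw [hwu, Matrix.sub_apply, hσU a ha, Matrix.one_apply_ne hne]
      simp [N, show a ≠ a₀ from fun h => ha₀ (h ▸ ha)]
    · intro a' ha'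
      simp only [hwu]
      rw [← Equiv.sum_comp σ]
      simp only [hσσ, Matrix.sub_apply, mul_sub, Finset.sum_sub_distrib, Matrix.one_apply]
      have h3 : ∑ x, v (σ x) * N x a' = v m * (v (σ a') / v m) := by
        rw [Finset.sum_eq_single a₀]
        · simp only [N, ha', not_false_eq_true, and_self, if_true]
          simp [σ]
        · intro x _ hx
          simp [N, hx]
        · simp
      rw [h3]
      by_cases h0 : v m = 0
      · have : v (σ a') = 0 := by
          have := hmax (σ a') (hσU' _ fun h' => ha' (Finset.mem_insert_of_mem h'))
          rw [h0, map_zero, le_zero_iff, map_eq_zero] at this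
          exact this
        simp [this]
      · rw [mul_div_cancel₀ _ h0]
        simp

/-- The absolute value of a nonarchimedean local field as a multiplicative homomorphism. -/
noncomputable def nonarchAbsHom (F : Type*) [Field F] [TopologicalSpace F] [ValuativeRel F]
    [IsNonarchimedeanLocalField F] : F →*₀ ℝ where
  toFun := nonarchAbs F
  map_zero' := by simp [nonarchAbs]
  map_one' := by simp [nonarchAbs]
  map_mul' x y := by simp [nonarchAbs]

theorem nonarchAbsHom_apply [TopologicalSpace F] [ValuativeRel F]
    [IsNonarchimedeanLocalField F] (x : F) : nonarchAbsHom F x = nonarchAbs F x := rfl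

theorem nonarchAbs_lt_of_valuation_lt [TopologicalSpace F] [ValuativeRel F]
    [IsNonarchimedeanLocalField F] {x y : F} (h : valuation F x < valuation F y) :
    nonarchAbs F x < nonarchAbs F y := by
  have hq : (1 : NNReal) < (Nat.card 𝓀[F] : NNReal) := by
    exact_mod_cast Finite.one_lt_card
  have := WithZeroMulInt.toNNReal_strictMono hq
    ((IsNonarchimedeanLocalField.valueGroupWithZeroIsoInt F).strictMono h)
  exact_mod_cast this

theorem exists_nonarchAbs_pos_lt_one [TopologicalSpace F] [ValuativeRel F]
    [IsNonarchimedeanLocalField F] : ∃ x : F, x ≠ 0 ∧ nonarchAbs F x < 1 := by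
  obtain ⟨x, hx, hx1⟩ := Valuation.IsNontrivial.exists_lt_one (v := valuation F)
  refine ⟨x, by simpa using hx, ?_⟩
  have := nonarchAbs_lt_of_valuation_lt (x := x) (y := 1) (by simpa using hx1)
  rwa [← nonarchAbsHom_apply 1, map_one] at this

theorem continuous_nonarchAbs [TopologicalSpace F] [ValuativeRel F]
    [IsNonarchimedeanLocalField F] : Continuous (nonarchAbs F) := by
  rw [continuous_iff_continuousAt]
  intro x
  by_cases hx : x = 0
  · subst hx
    obtain ⟨y, hy, hy1⟩ := exists_nonarchAbs_pos_lt_one (F := F)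
    rw [ContinuousAt, ← nonarchAbsHom_apply 0, map_zero, Metric.tendsto_nhds]
    intro ε hε
    obtain ⟨n, hn⟩ := exists_pow_lt_of_lt_one hε hy1
    have hmem := (IsValuativeTopology.hasBasis_nhds_zero' F).mem_of_mem
      (i := valuation F (y ^ n)) (by simp [hy])
    filter_upwards [hmem] with z hz
    have h1 := nonarchAbs_lt_of_valuation_lt hz
    rw [← nonarchAbsHom_apply (y ^ n), map_pow, nonarchAbsHom_apply] at h1
    rw [Real.dist_eq, sub_zero, abs_of_nonneg]
    · exact h1.trans hn
    · exact NNReal.coe_nonneg _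
  · have hmem := (IsValuativeTopology.hasBasis_nhds_zero' F).mem_of_mem
      (i := valuation F x) (by simpa using hx)
    have ht : Tendsto (fun z => z - x) (𝓝 x) (𝓝 0) := by
      have : Continuous fun z : F => z - x := by fun_prop
      simpa using this.tendsto x
    refine Tendsto.congr' ?_ tendsto_const_nhds
    filter_upwards [ht hmem] with z hz
    have : valuation F z = valuation F x := Valuation.map_eq_of_sub_lt _ hz
    rw [nonarchAbs, nonarchAbs, this]

end Nonarchimedean

section LocalField

open ValuativeRel

variable {F : Type*} [Field F] [TopologicalSpace F] {ι : Type*} [Fintype ι] [DecidableEq ι]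

theorem LocalField.isStandardCompact (hF : LocalField F) :
    IsStandardCompact (hF.maxCompact : Set (GL ι F)) := by
  cases hF with
  | real e he => exact isStandardCompact_unitary e he
  | complex e he => exact isStandardCompact_unitary e he
  | nonarch v hv h0 => exact isStandardCompact_integral

theorem LocalField.isTopologicalDivisionRing (hF : LocalField F) : IsTopologicalDivisionRing F := by
  have key : ∀ {𝕜 : Type} [RCLike 𝕜] (e : F ≃+* 𝕜), IsHomeomorph e →
      IsTopologicalDivisionRing F := by
    intro 𝕜 _ e he
    have hi := he.isInducing
    have hc := he.continuous
    refine { continuous_add := ?_, continuous_mul := ?_, continuous_neg := ?_,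
             continuousAt_inv₀ := ?_ }
    · rw [hi.continuous_iff]
      exact ((hc.comp continuous_fst).add (hc.comp continuous_snd)).congr fun x => by simp
    · rw [hi.continuous_iff]
      exact ((hc.comp continuous_fst).mul (hc.comp continuous_snd)).congr fun x => by simp
    · rw [hi.continuous_iff]
      exact hc.neg.congr fun x => by simp
    · intro x hx
      rw [hi.continuousAt_iff]
      exact (hc.continuousAt.inv₀ (by simpa using hx)).congr (.of_forall fun x => by simp)
  cases hF with
  | real e he => exact key e he
  | complex e he => exact key e he
  | nonarch v hv h0 => infer_instance

theorem LocalField.charZero (hF : LocalField F) : CharZero F := by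
  cases hF with
  | real e he => exact (RingHom.charZero_iff (ϕ := (e : F →+* ℝ)) e.injective).2 inferInstance
  | complex e he => exact (RingHom.charZero_iff (ϕ := (e : F →+* ℂ)) e.injective).2 inferInstance
  | nonarch v hv h0 => exact h0

/-- The normalised absolute value as a multiplicative homomorphism. -/
theorem LocalField.exists_absHom (hF : LocalField F) : ∃ N : F →*₀ ℝ, ⇑N = hF.abs := by
  cases hF with
  | real e he =>
    exact ⟨⟨⟨fun x => |e x|, by simp⟩, by simp, by simp [abs_mul]⟩, rfl⟩
  | complex e he =>
    exact ⟨⟨⟨fun x => ‖e x‖ ^ 2, by simp⟩, by simp, by simp [mul_pow]⟩, rfl⟩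
  | nonarch v hv h0 => exact ⟨nonarchAbsHom F, rfl⟩

theorem LocalField.continuous_abs (hF : LocalField F) : Continuous hF.abs := by
  cases hF with
  | real e he => exact he.continuous.abs
  | complex e he => exact he.continuous.norm.pow 2
  | nonarch v hv h0 => exact continuous_nonarchAbs

theorem LocalField.abs_nonneg (hF : LocalField F) (x : F) : 0 ≤ hF.abs x := by
  cases hF with
  | real e he => exact _root_.abs_nonneg _
  | complex e he => exact sq_nonneg _
  | nonarch v hv h0 => exact NNReal.coe_nonneg _

theorem LocalField.t2Space (hF : LocalField F) : T2Space F := by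
  have := hF.isTopologicalDivisionRing
  cases hF with
  | real e he => exact T2Space.of_injective_continuous e.injective he.continuous
  | complex e he => exact T2Space.of_injective_continuous e.injective he.continuous
  | nonarch v hv h0 =>
    let := IsTopologicalAddGroup.rightUniformSpace F
    have := isUniformAddGroup_of_addCommGroup (G := F)
    infer_instance

theorem LocalField.exists_tendsto_zero (hF : LocalField F) :
    ∃ u : ℕ → F, (∀ n, u n ≠ 0) ∧ Tendsto u atTop (𝓝 0) := by
  cases hF with
  | real e he =>
    refine ⟨fun n => e.symm ((n : ℝ) + 1)⁻¹, fun n => ?_, ?_⟩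
    · have : (n : ℝ) + 1 ≠ 0 := by positivity
      exact (map_ne_zero _).2 (inv_ne_zero this)
    · rw [he.isInducing.tendsto_nhds_iff]
      simpa [Function.comp_def] using tendsto_one_div_add_atTop_nhds_zero_nat (𝕜 := ℝ)
  | complex e he =>
    refine ⟨fun n => e.symm ((n : ℂ) + 1)⁻¹, fun n => ?_, ?_⟩
    · have : (n : ℂ) + 1 ≠ 0 := by exact_mod_cast n.succ_ne_zero
      exact (map_ne_zero _).2 (inv_ne_zero this)
    · rw [he.isInducing.tendsto_nhds_iff]
      simpa [Function.comp_def] using tendsto_one_div_add_atTop_nhds_zero_nat (𝕜 := ℂ)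
  | nonarch v hv h0 =>
    obtain ⟨y, hy, hy1⟩ := exists_nonarchAbs_pos_lt_one (F := F)
    refine ⟨fun n => y ^ n, fun n => pow_ne_zero n hy, ?_⟩
    rw [(IsValuativeTopology.hasBasis_nhds_zero' F).tendsto_right_iff]
    intro γ hγ
    obtain ⟨x, rfl⟩ := ValuativeRel.valuation_surjective γ
    have hx : nonarchAbs F x ≠ 0 := by
      rw [← nonarchAbsHom_apply]
      exact (map_ne_zero _).2 (by simpa using hγ)
    have hx : 0 < nonarchAbs F x := lt_of_le_of_ne (NNReal.coe_nonneg _) hx.symm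
    filter_upwards [(tendsto_pow_atTop_nhds_zero_of_lt_one (r := nonarchAbs F y)
      (NNReal.coe_nonneg _) hy1).eventually_lt_const hx] with n hn
    rw [← nonarchAbsHom_apply y, ← map_pow, nonarchAbsHom_apply] at hn
    rcases lt_trichotomy (valuation F (y ^ n)) (valuation F x) with h | h | h
    · exact h
    · rw [nonarchAbs, nonarchAbs, h] at hn
      exact absurd hn (lt_irrefl _)
    · exact absurd (hn.trans (nonarchAbs_lt_of_valuation_lt h)) (lt_irrefl _)

end LocalField

/-! ### Parabolic subgroups attached to height functions -/

section Heights

variable {F : Type*} [Field F] {ι : Type*} [Fintype ι] [DecidableEq ι]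

variable (F) in
/-- The span of the basis vectors of height less than `s`. -/
def lowerSpan (κ : ι → ℕ) (s : ℕ) : Submodule F (ι → F) where
  carrier := {v | ∀ a, s ≤ κ a → v a = 0}
  add_mem' := fun hv hw a ha => by simp [hv a ha, hw a ha]
  zero_mem' := fun _ _ => rfl
  smul_mem' := fun t v hv a ha => by simp [hv a ha]

theorem mem_lowerSpan {κ : ι → ℕ} {s : ℕ} {v : ι → F} :
    v ∈ lowerSpan F κ s ↔ ∀ a, s ≤ κ a → v a = 0 := Iff.rfl

theorem single_mem_lowerSpan {κ : ι → ℕ} {s : ℕ} {a : ι} :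
    (Pi.single a 1 : ι → F) ∈ lowerSpan F κ s ↔ κ a < s := by
  rw [mem_lowerSpan]
  constructor
  · intro h
    by_contra hs
    simpa using h a (not_lt.1 hs)
  · intro h b hb
    rw [Pi.single_eq_of_ne]
    rintro rfl
    omega

theorem lowerSpan_mono {κ : ι → ℕ} {s t : ℕ} (h : s ≤ t) : lowerSpan F κ s ≤ lowerSpan F κ t :=
  fun _ hv a ha => hv a (h.trans ha)

variable (F) in
/-- The parabolic subgroup attached to a height function on the basis: its flag consists of the
spans of the basis vectors of bounded height. -/
def ofHeight (κ : ι → ℕ) : Parabolic F ι where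
  flag := Set.range (lowerSpan F κ)
  isChain := by
    rintro _ ⟨s, rfl⟩ _ ⟨t, rfl⟩ _
    exact (le_total s t).imp lowerSpan_mono lowerSpan_mono
  bot_mem := ⟨0, by
    rw [eq_bot_iff]
    intro v hv
    rw [Submodule.mem_bot]
    exact funext fun a => hv a (Nat.zero_le _)⟩
  top_mem := ⟨Finset.univ.sup κ + 1, by
    rw [eq_top_iff]
    intro v _ a ha
    have := Finset.le_sup (f := κ) (Finset.mem_univ a)
    omega⟩

variable (F) in
/-- The Lie algebra of the parabolic subgroup attached to a height function: matrices which do not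
raise the height. -/
def upper (κ : ι → ℕ) : Submodule F (Matrix ι ι F) where
  carrier := {M | ∀ a b, κ b < κ a → M a b = 0}
  add_mem' := fun hv hw a b h => by simp [hv a b h, hw a b h]
  zero_mem' := fun _ _ _ => rfl
  smul_mem' := fun t v hv a b h => by simp [hv a b h]

variable (F) in
/-- The nilradical of `upper F κ`: matrices which lower the height. -/
def strictUpper (κ : ι → ℕ) : Submodule F (Matrix ι ι F) where
  carrier := {M | ∀ a b, κ b ≤ κ a → M a b = 0}
  add_mem' := fun hv hw a b h => by simp [hv a b h, hw a b h]
  zero_mem' := fun _ _ _ => rfl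
  smul_mem' := fun t v hv a b h => by simp [hv a b h]

variable {κ : ι → ℕ}

theorem strictUpper_le_upper : strictUpper F κ ≤ upper F κ := fun _ h a b hab => h a b hab.le

theorem one_mem_upper : (1 : Matrix ι ι F) ∈ upper F κ := fun a b h =>
  Matrix.one_apply_ne fun h' => by subst h'; omega

theorem upper_mul {A B : Matrix ι ι F} (hA : A ∈ upper F κ) (hB : B ∈ upper F κ) :
    A * B ∈ upper F κ := by
  intro a b hab
  rw [Matrix.mul_apply]
  refine Finset.sum_eq_zero fun x _ => ?_
  rcases lt_or_ge (κ x) (κ a) with h | h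
  · rw [hA a x h, zero_mul]
  · rw [hB x b (by omega), mul_zero]

theorem upper_mul_strictUpper {A B : Matrix ι ι F} (hA : A ∈ upper F κ)
    (hB : B ∈ strictUpper F κ) : A * B ∈ strictUpper F κ := by
  intro a b hab
  rw [Matrix.mul_apply]
  refine Finset.sum_eq_zero fun x _ => ?_
  rcases lt_or_ge (κ x) (κ a) with h | h
  · rw [hA a x h, zero_mul]
  · rw [hB x b (by omega), mul_zero]

theorem strictUpper_mul_upper {A B : Matrix ι ι F} (hA : A ∈ strictUpper F κ)
    (hB : B ∈ upper F κ) : A * B ∈ strictUpper F κ := by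
  intro a b hab
  rw [Matrix.mul_apply]
  refine Finset.sum_eq_zero fun x _ => ?_
  rcases le_or_gt (κ x) (κ a) with h | h
  · rw [hA a x h, zero_mul]
  · rw [hB x b (by omega), mul_zero]

theorem upper_inv {g : GL ι F} (hg : (g : Matrix ι ι F) ∈ upper F κ) :
    ((g⁻¹ : GL ι F) : Matrix ι ι F) ∈ upper F κ := by
  have h : (g : Matrix ι ι F).BlockTriangular κ := fun a b h => hg a b h
  have : Invertible (g : Matrix ι ι F) := g.invertible
  have := Matrix.blockTriangular_inv_of_blockTriangular h
  rw [Matrix.coe_units_inv]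
  exact fun a b h => this h

theorem mapSub_lowerSpan_le {Y : Matrix ι ι F} {s t : ℕ} :
    mapSub Y (lowerSpan F κ s) ≤ lowerSpan F κ t ↔ ∀ a b, t ≤ κ a → κ b < s → Y a b = 0 := by
  rw [mapSub, Submodule.map_le_iff_le_comap]
  constructor
  · intro h a b ha hb
    have := h (single_mem_lowerSpan.2 hb) a ha
    simpa using this
  · intro h v hv a ha
    change (Y *ᵥ v) a = 0
    rw [Matrix.mulVec, dotProduct]
    refine Finset.sum_eq_zero fun b _ => ?_
    rcases lt_or_ge (κ b) s with hb | hb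
    · rw [h a b ha hb, zero_mul]
    · rw [hv b hb, mul_zero]

theorem mapSub_eq_of_le {g : GL ι F} {W : Submodule F (ι → F)}
    (h : mapSub (g : Matrix ι ι F) W ≤ W) : mapSub (g : Matrix ι ι F) W = W := by
  refine Submodule.eq_of_le_of_finrank_eq h ?_
  have hinj : Function.Injective (g : Matrix ι ι F).mulVecLin := by
    intro v w hvw
    have := congrArg (fun u => ((g⁻¹ : GL ι F) : Matrix ι ι F) *ᵥ u) hvw
    simpa [Matrix.mulVec_mulVec] using this
  exact (Submodule.equivMapOfInjective _ hinj W).finrank_eq.symm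

theorem lie_ofHeight {Y : Matrix ι ι F} : Y ∈ (ofHeight F κ).lie ↔ Y ∈ upper F κ := by
  constructor
  · intro h a b hab
    exact mapSub_lowerSpan_le.1 (h _ ⟨κ a, rfl⟩) a b le_rfl hab
  · rintro h _ ⟨s, rfl⟩
    exact mapSub_lowerSpan_le.2 fun a b ha hb => h a b (by omega)

theorem points_ofHeight {g : GL ι F} :
    g ∈ (ofHeight F κ).points ↔ (g : Matrix ι ι F) ∈ upper F κ := by
  rw [← lie_ofHeight]
  exact ⟨fun h W hW => (h W hW).le, fun h W hW => mapSub_eq_of_le (h W hW)⟩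

theorem nil_ofHeight {Y : Matrix ι ι F} : Y ∈ (ofHeight F κ).nil ↔ Y ∈ strictUpper F κ := by
  constructor
  · intro h a b hab
    have hb : (Pi.single b 1 : ι → F) ∈ lowerSpan F κ (κ b + 1) :=
      single_mem_lowerSpan.2 (Nat.lt_succ_self _)
    obtain ⟨_, ⟨s, rfl⟩, hlt, hle⟩ := h _ ⟨κ b + 1, rfl⟩ (fun h0 => by
      rw [h0, Submodule.mem_bot] at hb
      simpa using congrFun hb b)
    have hs : s < κ b + 1 := by
      by_contra hs
      exact not_le_of_gt hlt (lowerSpan_mono (not_lt.1 hs))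
    exact mapSub_lowerSpan_le.1 hle a b (by omega) (Nat.lt_succ_self _)
  · rintro h _ ⟨s, rfl⟩ hne
    obtain ⟨v, hv, hv0⟩ := Submodule.exists_mem_ne_zero_of_ne_bot hne
    obtain ⟨a₀, ha₀⟩ := Function.ne_iff.1 hv0
    have ha₀s : κ a₀ < s := by
      by_contra hs
      exact ha₀ (hv a₀ (not_lt.1 hs))
    obtain ⟨m, hm, hmax⟩ := Finset.exists_max_image (Finset.univ.filter fun a => κ a < s) κ
      ⟨a₀, by simpa using ha₀s⟩
    have hm : κ m < s := by simpa using hm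
    refine ⟨_, ⟨κ m, rfl⟩, lt_of_le_of_ne (lowerSpan_mono hm.le) fun he => ?_, ?_⟩
    · have := single_mem_lowerSpan (F := F).2 hm
      rw [← he, single_mem_lowerSpan] at this
      exact lt_irrefl _ this
    · refine mapSub_lowerSpan_le.2 fun a b ha hb => h a b ?_
      exact (hmax b (by simpa using hb)).trans ha

theorem unip_ofHeight {g : GL ι F} :
    g ∈ (ofHeight F κ).unip ↔ (g : Matrix ι ι F) - 1 ∈ strictUpper F κ := nil_ofHeight

theorem upper_of_sub_one_mem {A : Matrix ι ι F} (h : A - 1 ∈ strictUpper F κ) :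
    A ∈ upper F κ := by
  have := (upper F κ).add_mem (strictUpper_le_upper h) one_mem_upper
  simpa using this

theorem sub_one_inv_mem {g : GL ι F} (h : (g : Matrix ι ι F) - 1 ∈ strictUpper F κ) :
    ((g⁻¹ : GL ι F) : Matrix ι ι F) - 1 ∈ strictUpper F κ := by
  have h1 := upper_mul_strictUpper (upper_inv (upper_of_sub_one_mem h)) h
  rw [mul_sub, mul_one, Units.inv_mul] at h1
  simpa using (strictUpper F κ).neg_mem h1

theorem sub_one_mul_mem {A B : Matrix ι ι F} (hA : A - 1 ∈ strictUpper F κ)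
    (hB : B - 1 ∈ strictUpper F κ) : A * B - 1 ∈ strictUpper F κ := by
  have h1 := (strictUpper F κ).add_mem
    (strictUpper_mul_upper hA (upper_of_sub_one_mem hB)) hB
  convert h1 using 1
  noncomm_ring

theorem isNilpotent_of_mem_strictUpper {U : Matrix ι ι F} (hU : U ∈ strictUpper F κ) :
    IsNilpotent U := by
  have key : ∀ n a b, κ b < κ a + n → (U ^ n) a b = 0 := by
    intro n
    induction n with
    | zero =>
      intro a b h
      rw [pow_zero]
      exact one_mem_upper (κ := κ) a b (by omega)
    | succ n ih =>
      intro a b h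
      rw [pow_succ, Matrix.mul_apply]
      refine Finset.sum_eq_zero fun x _ => ?_
      rcases lt_or_ge (κ x) (κ a + n) with hx | hx
      · rw [ih a x hx, zero_mul]
      · rw [hU x b (by omega), mul_zero]
  refine ⟨Finset.univ.sup κ + 1, ?_⟩
  ext a b
  refine key _ a b ?_
  have := Finset.le_sup (f := κ) (Finset.mem_univ b)
  omega

theorem exists_unit_of_sub_one_mem {A : Matrix ι ι F} (h : A - 1 ∈ strictUpper F κ) :
    ∃ g : GL ι F, (g : Matrix ι ι F) = A := by
  have := (isNilpotent_of_mem_strictUpper h).isUnit_add_one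
  rw [sub_add_cancel] at this
  exact this

end Heights

section Levi

variable {F : Type*} [Field F] {ι β : Type*} [Fintype ι] [DecidableEq ι] [Fintype β]
  [DecidableEq β] {c : ι → β}

/-- The block diagonal part of a matrix. -/
def blockPart (c : ι → β) (A : Matrix ι ι F) : Matrix ι ι F :=
  fun a b => if c a = c b then A a b else 0

/-- The determinant of the diagonal block with label `x`. -/
def blockDet (c : ι → β) (x : β) (A : Matrix ι ι F) : F := (A.toSquareBlock c x).det

variable {q : β → ℕ}

theorem mul_apply_eq_zero_of_ne (hq : q.Injective) {A B : Matrix ι ι F}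
    (hA : A ∈ upper F (q ∘ c)) (hB : B ∈ upper F (q ∘ c)) {a b y : ι} (hab : c a = c b)
    (hy : c y ≠ c a) : A a y * B y b = 0 := by
  rcases lt_trichotomy (q (c y)) (q (c a)) with h | h | h
  · rw [hA a y h, zero_mul]
  · exact absurd (hq h) hy
  · rw [hB y b (by rw [Function.comp_apply, ← hab]; exact h), mul_zero]

theorem blockPart_mul (hq : q.Injective) {A B : Matrix ι ι F}
    (hA : A ∈ upper F (q ∘ c)) (hB : B ∈ upper F (q ∘ c)) :
    blockPart c (A * B) = blockPart c A * blockPart c B := by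
  ext a b
  rw [Matrix.mul_apply]
  simp only [blockPart]
  split_ifs with hab
  · rw [Matrix.mul_apply]
    refine Finset.sum_congr rfl fun y _ => ?_
    by_cases hy : c y = c a
    · rw [if_pos hy.symm, if_pos (hy.trans hab)]
    · rw [mul_apply_eq_zero_of_ne hq hA hB hab hy, if_neg (Ne.symm hy), zero_mul]
  · refine (Finset.sum_eq_zero fun y _ => ?_).symm
    split_ifs with h1 h2
    · exact absurd (h1.trans h2) hab
    · rw [mul_zero]
    · rw [zero_mul]
    · rw [zero_mul]

theorem blockDet_mul (hq : q.Injective) {A B : Matrix ι ι F}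
    (hA : A ∈ upper F (q ∘ c)) (hB : B ∈ upper F (q ∘ c)) (x : β) :
    blockDet c x (A * B) = blockDet c x A * blockDet c x B := by
  rw [blockDet, blockDet, blockDet, ← Matrix.det_mul]
  congr 1
  ext ⟨a, ha⟩ ⟨b, hb⟩
  change (A * B) a b = ∑ y : {y // c y = x}, A a y * B y b
  rw [Matrix.mul_apply, ← Finset.sum_subtype (Finset.univ.filter fun y => c y = x) (by simp)
    (fun y => A a y * B y b)]
  refine (Finset.sum_filter_of_ne fun y _ hy => ?_).symm
  by_contra h
  exact hy (mul_apply_eq_zero_of_ne hq hA hB (ha.trans hb.symm) (by rwa [ha]))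

theorem blockDet_congr {A B : Matrix ι ι F} {x : β}
    (h : ∀ a b, c a = x → c b = x → A a b = B a b) : blockDet c x A = blockDet c x B := by
  rw [blockDet, blockDet]
  congr 1
  ext ⟨a, ha⟩ ⟨b, hb⟩
  exact h a b ha hb

theorem blockDet_one (x : β) : blockDet c x (1 : Matrix ι ι F) = 1 := by
  rw [blockDet, ← Matrix.det_one (n := {a // c a = x})]
  congr 1
  ext ⟨a, ha⟩ ⟨b, hb⟩
  simp [Matrix.toSquareBlock_def, Matrix.one_apply]

theorem blockDet_of_sub_one_mem {A : Matrix ι ι F} (hA : A - 1 ∈ strictUpper F (q ∘ c)) (x : β) :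
    blockDet c x A = 1 := by
  rw [← blockDet_one (c := c) x]
  refine blockDet_congr fun a b ha hb => ?_
  have := hA a b (by simp [ha, hb])
  rwa [Matrix.sub_apply, sub_eq_zero] at this

theorem blockDet_ne_zero (hq : q.Injective) {g : GL ι F} (hg : (g : Matrix ι ι F) ∈ upper F (q ∘ c))
    (x : β) : blockDet c x (g : Matrix ι ι F) ≠ 0 := by
  have := blockDet_mul hq hg (upper_inv hg) x
  rw [Units.mul_inv, blockDet_one] at this
  exact left_ne_zero_of_mul (this ▸ one_ne_zero)

theorem upper_of_levi {g : GL ι F} (hg : g ∈ levi F c) : (g : Matrix ι ι F) ∈ upper F (q ∘ c) :=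
  fun a b h => hg a b fun h' => by simp [h'] at h

/-- The Levi decomposition of a parabolic subgroup. -/
theorem exists_levi_mul_unip (hq : q.Injective) {g : GL ι F}
    (hg : (g : Matrix ι ι F) ∈ upper F (q ∘ c)) :
    ∃ m ∈ levi F c, ∃ u : GL ι F, (u : Matrix ι ι F) - 1 ∈ strictUpper F (q ∘ c) ∧ g = m * u ∧
      ∀ x, blockDet c x (m : Matrix ι ι F) = blockDet c x (g : Matrix ι ι F) := by
  have h1 : blockPart c (1 : Matrix ι ι F) = 1 := by
    ext a b
    by_cases h : a = b
    · simp [blockPart, h]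
    · simp [blockPart, h]
  let m : GL ι F := ⟨blockPart c (g : Matrix ι ι F), blockPart c ((g⁻¹ : GL ι F) : Matrix ι ι F),
    by rw [← blockPart_mul hq hg (upper_inv hg), Units.mul_inv, h1],
    by rw [← blockPart_mul hq (upper_inv hg) hg, Units.inv_mul, h1]⟩
  have hm : m ∈ levi F c := fun a b h => if_neg h
  refine ⟨m, hm, m⁻¹ * g, ?_, by simp, fun x => ?_⟩
  · have h2 : (g : Matrix ι ι F) - m ∈ strictUpper F (q ∘ c) := by
      intro a b hab
      change (g : Matrix ι ι F) a b - blockPart c (g : Matrix ι ι F) a b = 0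
      rw [blockPart]
      split_ifs with h
      · exact sub_self _
      · rw [sub_zero]
        exact hg a b (lt_of_le_of_ne hab fun h' => h (hq h').symm)
    have h3 := upper_mul_strictUpper (upper_inv (upper_of_levi hm)) h2
    rwa [mul_sub, Units.inv_mul, ← Units.val_mul] at h3
  · refine blockDet_congr fun a b ha hb => ?_
    exact if_pos (ha.trans hb.symm)

theorem center_mul_levi {g : GL ι F} (hg : g ∈ levi F c) (z : β → F) :
    center c z * (g : Matrix ι ι F) = g * center c z := by
  ext a b
  rw [center, Matrix.diagonal_mul, Matrix.mul_diagonal]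
  by_cases h : c a = c b
  · rw [h, mul_comm]
  · rw [hg a b h, mul_zero, zero_mul]

theorem ofHeight_mem_parabolicsWithLevi (hq : q.Injective) :
    ofHeight F (q ∘ c) ∈ parabolicsWithLevi F c := by
  refine ⟨fun g hg => points_ofHeight.2 (upper_of_levi hg), ?_, fun p hp => ?_⟩
  · ext g
    constructor
    · rintro ⟨h1, h2⟩
      rw [Set.mem_singleton_iff]
      refine Units.ext ?_
      rw [unip_ofHeight] at h2
      ext a b
      rcases le_or_gt (q (c b)) (q (c a)) with h | h
      · have := h2 a b h
        rwa [Matrix.sub_apply, sub_eq_zero] at this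
      · have hne : c a ≠ c b := fun h' => by simp [h'] at h
        rw [h1 a b hne, Units.val_one, Matrix.one_apply_ne fun h' => hne (by rw [h'])]
    · rintro rfl
      refine ⟨fun a b h => Matrix.one_apply_ne fun h' => h (by rw [h']), unip_ofHeight.2 ?_⟩
      rw [Units.val_one, sub_self]
      exact zero_mem _
  · obtain ⟨m, hm, u, hu, h, -⟩ := exists_levi_mul_unip hq (points_ofHeight.1 hp)
    exact ⟨m, hm, u, unip_ofHeight.2 hu, h⟩

end Levi

/-! ### Classification of the parabolic subgroups with a given Levi factor -/

section Classification

variable {F : Type*} [Field F] {ι β : Type*} [Fintype ι] [DecidableEq ι] [Fintype β]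
  [DecidableEq β] {c : ι → β}

/-- The elementary matrix `1 + E_{ab}` (twice a projection plus its complement when `a = b`) is
invertible in characteristic zero. -/
theorem exists_unit_one_add_single [CharZero F] (a b : ι) :
    ∃ g : GL ι F, (g : Matrix ι ι F) = 1 + Matrix.single a b 1 := by
  by_cases h : a = b
  · subst h
    have h2 : (2⁻¹ : F) + 2⁻¹ = 1 := by norm_num
    have h3 : (1 + Matrix.single a a (1 : F)) * (1 - Matrix.single a a 2⁻¹) = 1 := by
      simp only [mul_sub, add_mul, mul_one, one_mul, Matrix.single_mul_single_same]
      rw [← Matrix.single_add, h2, add_sub_cancel_right]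
    exact ⟨⟨_, _, h3, mul_eq_one_comm.1 h3⟩, rfl⟩
  · have h3 : (1 + Matrix.single a b (1 : F)) * (1 - Matrix.single a b 1) = 1 := by
      simp only [mul_sub, add_mul, mul_one, one_mul,
        Matrix.single_mul_single_of_ne _ _ _ _ (Ne.symm h)]
      simp
    exact ⟨⟨_, _, h3, mul_eq_one_comm.1 h3⟩, rfl⟩

theorem one_add_single_mulVec (a b : ι) (v : ι → F) :
    (1 + Matrix.single a b (1 : F)) *ᵥ v = v + v b • Pi.single a 1 := by
  rw [Matrix.add_mulVec, Matrix.one_mulVec]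
  congr 1
  ext x
  simp [Matrix.mulVec, dotProduct, Matrix.single_apply, Pi.single_apply, eq_comm, ite_and]

/-- A subspace stable under the Levi subgroup contains every block that occurs in one of its
vectors. -/
theorem single_mem_of_levi_stable [CharZero F] {W : Submodule F (ι → F)}
    (hW : ∀ g ∈ levi F c, mapSub (g : Matrix ι ι F) W = W) {v : ι → F} (hv : v ∈ W) {a b : ι}
    (ha : v a ≠ 0) (hab : c b = c a) : (Pi.single b 1 : ι → F) ∈ W := by
  obtain ⟨g, hg⟩ := exists_unit_one_add_single (F := F) b a
  have hgl : g ∈ levi F c := by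
    intro x y hxy
    rw [hg, Matrix.add_apply, Matrix.one_apply_ne fun h => hxy (by rw [h]), zero_add,
      Matrix.single_apply, if_neg]
    rintro ⟨rfl, rfl⟩
    exact hxy hab
  have h1 : (g : Matrix ι ι F) *ᵥ v ∈ W := by
    rw [← hW g hgl]
    exact ⟨v, hv, rfl⟩
  rw [hg, one_add_single_mulVec] at h1
  have h2 := W.sub_mem h1 hv
  rw [add_sub_cancel_left] at h2
  exact (W.smul_mem_iff ha).1 h2

/-- Every parabolic subgroup with Levi factor `M` is attached to an ordering of the blocks. Blocks
`b`, `b'` that no member of the flag separates would give an element `1 + E_{aa'}` of the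
parabolic subgroup which has no Levi decomposition. -/
theorem exists_height [CharZero F] (hc : c.Surjective) {P : Parabolic F ι}
    (hP : P ∈ parabolicsWithLevi F c) :
    ∃ q : β → ℕ, q.Injective ∧ P = ofHeight F (q ∘ c) := by
  obtain ⟨hlevi, -, hdec⟩ := hP
  have hst : ∀ W ∈ P.flag, ∀ g ∈ levi F c, mapSub (g : Matrix ι ι F) W = W :=
    fun W hW g hg => hlevi hg W hW
  -- `W` contains the block `b` as soon as it contains one basis vector of it
  have hmem : ∀ W ∈ P.flag, ∀ v ∈ W, ∀ a b, v a ≠ 0 → c b = c a → (Pi.single b 1 : ι → F) ∈ W :=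
    fun W hW v hv a b ha hab => single_mem_of_levi_stable (hst W hW) hv ha hab
  have hblock : ∀ W ∈ P.flag, ∀ a b, c b = c a → (Pi.single a 1 : ι → F) ∈ W →
      (Pi.single b 1 : ι → F) ∈ W := fun W hW a b hab ha => hmem W hW _ ha a b (by simp) hab
  -- the smallest member of the flag that contains a given basis vector
  have hmin : ∀ a : ι, ∃ W ∈ P.flag, (Pi.single a 1 : ι → F) ∈ W ∧
      ∀ W' ∈ P.flag, (Pi.single a 1 : ι → F) ∈ W' → W ≤ W' := by
    intro a
    obtain ⟨W, ⟨hW, haW⟩, hmin⟩ := WellFounded.has_min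
      (wellFounded_lt : WellFounded ((· < ·) : Submodule F (ι → F) → _ → Prop))
      {W | W ∈ P.flag ∧ (Pi.single a 1 : ι → F) ∈ W} ⟨⊤, P.top_mem, trivial⟩
    refine ⟨W, hW, haW, fun W' hW' haW' => ?_⟩
    rcases P.isChain.total hW hW' with h | h
    · exact h
    · rcases eq_or_lt_of_le h with h | h
      · exact h.ge
      · exact absurd h (hmin W' ⟨hW', haW'⟩)
  choose S hSP hSa hSmin using hmin
  have hSc : ∀ a b, c a = c b → S a = S b := fun a b h =>
    le_antisymm (hSmin a _ (hSP b) (hblock _ (hSP b) b a h (hSa b)))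
      (hSmin b _ (hSP a) (hblock _ (hSP a) a b h.symm (hSa a)))
  have hsep : ∀ a b, S a = S b → c a = c b := by
    intro a b hab
    by_contra hne
    have hiff : ∀ W ∈ P.flag, (Pi.single a 1 : ι → F) ∈ W ↔ (Pi.single b 1 : ι → F) ∈ W :=
      fun W hW => ⟨fun h => hSmin a W hW h (hab ▸ hSa b), fun h => hSmin b W hW h (hab ▸ hSa a)⟩
    obtain ⟨g, hg⟩ := exists_unit_one_add_single (F := F) a b
    have hgP : g ∈ P.points := by
      intro W hW
      refine mapSub_eq_of_le ?_
      rintro _ ⟨v, hv, rfl⟩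
      change (g : Matrix ι ι F) *ᵥ v ∈ W
      rw [hg, one_add_single_mulVec]
      by_cases h0 : v b = 0
      · simpa [h0] using hv
      · exact W.add_mem hv (W.smul_mem _ ((hiff W hW).2 (hmem W hW v hv b b h0 rfl)))
    obtain ⟨m, hm, n, hn, rfl⟩ := hdec g hgP
    have h1 : ((m * n : GL ι F) : Matrix ι ι F) a b = 1 := by
      rw [hg, Matrix.add_apply, Matrix.one_apply_ne (fun h => hne (by rw [h])),
        Matrix.single_apply_same, zero_add]
    rw [Units.val_mul, Matrix.mul_apply, Finset.sum_eq_zero] at h1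
    · exact zero_ne_one h1
    intro x _
    by_cases hx : c x = c a
    · have hxb : x ≠ b := fun h => hne (by rw [← hx, h])
      obtain ⟨W', hW', hlt, hle⟩ := hn (S b) (hSP b) fun h0 => by
        have := hSa b
        rw [h0, Submodule.mem_bot] at this
        simpa using congrFun this b
      have h2 : ((n : Matrix ι ι F) - 1) *ᵥ Pi.single b 1 ∈ W' := hle ⟨_, hSa b, rfl⟩
      have h3 : (n : Matrix ι ι F) x b = 0 := by
        by_contra h0
        have h4 : (((n : Matrix ι ι F) - 1) *ᵥ (Pi.single b 1 : ι → F)) x ≠ 0 := by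
          simpa [Matrix.sub_apply, Matrix.one_apply_ne hxb] using h0
        have h5 := hmem W' hW' _ h2 x a h4 hx.symm
        exact not_le_of_gt hlt (hSmin b W' hW' ((hiff W' hW').1 h5))
      rw [h3, mul_zero]
    · rw [hm a x (Ne.symm hx), zero_mul]
  -- the order of the blocks is recorded by the dimension of the smallest member containing them
  let q : β → ℕ := fun b => Module.finrank F (S (hc b).choose)
  have hq : ∀ a, q (c a) = Module.finrank F (S a) := fun a => by
    have := (hc (c a)).choose_spec
    simp only [q]
    rw [hSc _ _ this]
  have hle : ∀ W ∈ P.flag, ∀ a, (Pi.single a 1 : ι → F) ∈ W ↔ q (c a) ≤ Module.finrank F W := by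
    intro W hW a
    rw [hq]
    constructor
    · exact fun h => Submodule.finrank_mono (hSmin a W hW h)
    · intro h
      rcases P.isChain.total (hSP a) hW with h' | h'
      · exact h' (hSa a)
      · rw [Submodule.eq_of_le_of_finrank_le h' h]
        exact hSa a
  have hflag : ∀ W ∈ P.flag, ∀ s, (∀ a, q (c a) ≤ Module.finrank F W ↔ q (c a) < s) →
      W = lowerSpan F (q ∘ c) s := by
    intro W hW s h
    apply le_antisymm
    · intro v hv a ha
      by_contra h0
      have := (h a).1 ((hle W hW a).1 (hmem W hW v hv a a h0 rfl))
      exact absurd ha (not_le.2 this)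
    · intro v hv
      rw [pi_eq_sum_univ' v]
      refine W.sum_mem fun a _ => ?_
      by_cases h0 : v a = 0
      · simp [h0]
      · refine W.smul_mem _ ((hle W hW a).2 ((h a).2 ?_))
        by_contra hs
        exact h0 (hv a (not_lt.1 hs))
  refine ⟨q, fun b b' h => ?_, ?_⟩
  · obtain ⟨a, rfl⟩ := hc b
    obtain ⟨a', rfl⟩ := hc b'
    rw [hq, hq] at h
    apply hsep
    rcases P.isChain.total (hSP a) (hSP a') with h' | h'
    · exact Submodule.eq_of_le_of_finrank_eq h' h
    · exact (Submodule.eq_of_le_of_finrank_eq h' h.symm).symm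
  · ext W
    constructor
    · intro hW
      exact ⟨Module.finrank F W + 1, (hflag W hW _ fun a => Nat.lt_succ_iff.symm).symm⟩
    · rintro ⟨s, rfl⟩
      by_cases hs : ∃ a, q (c a) < s
      · obtain ⟨a₀, ha₀⟩ := hs
        obtain ⟨m, hm, hmax⟩ := Finset.exists_max_image (Finset.univ.filter fun a => q (c a) < s)
          (q ∘ c) ⟨a₀, by simpa using ha₀⟩
        have hm : q (c m) < s := by simpa using hm
        rw [← hflag (S m) (hSP m) s fun a => ?_]
        · exact hSP m
        · rw [← hq]
          exact ⟨fun h => h.trans_lt hm, fun h => hmax a (by simpa using h)⟩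
      · push Not at hs
        convert P.bot_mem
        rw [eq_bot_iff]
        intro v hv
        exact funext fun a => hv a (hs a)

theorem roots_ofHeight [CharZero F] (hc : c.Surjective) {q : β → ℕ} (hq : q.Injective)
    {α : β × β} : α ∈ roots c (ofHeight F (q ∘ c)) ↔ q α.1 < q α.2 := by
  obtain ⟨b, b'⟩ := α
  constructor
  · rintro ⟨hne, Y, hY, hY0, hz⟩
    have hne : b ≠ b' := hne
    obtain ⟨x, y, hxy⟩ : ∃ x y, Y x y ≠ 0 := by
      by_contra h
      push Not at h
      exact hY0 (Matrix.ext h)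
    have key : ∀ z : β → F, z (c x) - z (c y) = z b - z b' := by
      intro z
      have := congrFun (congrFun (hz z) x) y
      rw [Matrix.sub_apply, center, Matrix.diagonal_mul, Matrix.mul_diagonal, Matrix.smul_apply,
        smul_eq_mul, mul_comm (Y x y), ← sub_mul] at this
      exact mul_right_cancel₀ hxy this
    have h1 := key (Pi.single b 1)
    have h2 := key (Pi.single b' 1)
    have hx : c x = b := by
      by_contra h
      simp only [Pi.single_apply, h, hne.symm, if_true, if_false] at h1
      split_ifs at h1 <;> norm_num at h1
    have hy : c y = b' := by
      by_contra h
      simp only [Pi.single_apply, h, hne, if_true, if_false] at h2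
      split_ifs at h2 <;> norm_num at h2
    rw [lie_ofHeight] at hY
    by_contra h
    refine hxy (hY x y (lt_of_le_of_ne ?_ ?_))
    · simpa [hx, hy] using h
    · simpa [hx, hy] using fun h' => hne (hq h').symm
  · intro h
    obtain ⟨x, rfl⟩ := hc b
    obtain ⟨y, rfl⟩ := hc b'
    refine ⟨fun h' => ?_, Matrix.single x y 1, ?_, ?_, fun z => ?_⟩
    · simp only at h'
      simp [h'] at h
    · rw [lie_ofHeight]
      intro u v huv
      rw [Matrix.single_apply, if_neg]
      rintro ⟨rfl, rfl⟩
      exact lt_asymm h huv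
    · intro h0
      have := congrFun (congrFun h0 x) y
      simp at this
    · ext u v
      rw [Matrix.sub_apply, center, Matrix.diagonal_mul, Matrix.mul_diagonal, Matrix.smul_apply,
        smul_eq_mul, Matrix.single_apply]
      split_ifs with huv
      · obtain ⟨rfl, rfl⟩ := huv
        ring
      · ring

end Classification

/-! ### The functions `H_P` -/

section IwasawaH

variable {F : Type*} [Field F] [TopologicalSpace F] (hF : LocalField F)
  {ι β : Type*} [Fintype ι] [DecidableEq ι] [Fintype β] [DecidableEq β] {c : ι → β}

theorem LocalField.abs_mul (x y : F) : hF.abs (x * y) = hF.abs x * hF.abs y := by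
  obtain ⟨N, hN⟩ := hF.exists_absHom
  rw [← hN, map_mul]

theorem LocalField.abs_one : hF.abs 1 = 1 := by
  obtain ⟨N, hN⟩ := hF.exists_absHom
  rw [← hN, map_one]

theorem LocalField.abs_zero : hF.abs 0 = 0 := by
  obtain ⟨N, hN⟩ := hF.exists_absHom
  rw [← hN, map_zero]

theorem LocalField.abs_pos {x : F} (hx : x ≠ 0) : 0 < hF.abs x := by
  refine lt_of_le_of_ne (hF.abs_nonneg x) (Ne.symm ?_)
  obtain ⟨N, hN⟩ := hF.exists_absHom
  rw [← hN]
  exact (map_ne_zero N).2 hx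

theorem LocalField.continuous_blockDet (hF : LocalField F) (x : β) :
    Continuous fun A : Matrix ι ι F => blockDet c x A := by
  have := hF.isTopologicalDivisionRing
  refine Continuous.matrix_det ?_
  exact continuous_matrix fun i j => continuous_id.matrix_elem _ _

variable {q : β → ℕ}

/-- The characters of `M` have absolute value one on the compact group `P ∩ K`, since they are
bounded on it. -/
theorem LocalField.abs_blockDet_of_mem_maxCompact (hq : q.Injective) {p : GL ι F}
    (hp : (p : Matrix ι ι F) ∈ upper F (q ∘ c)) (hpK : p ∈ hF.maxCompact) (x : β) :
    hF.abs (blockDet c x (p : Matrix ι ι F)) = 1 := by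
  have hK := hF.isStandardCompact (ι := ι)
  obtain ⟨C, hC⟩ := (hK.isCompact.image
    (hF.continuous_abs.comp (hF.continuous_blockDet (c := c) x))).bddAbove
  have hC : ∀ k ∈ hF.maxCompact, hF.abs (blockDet c x (k : Matrix ι ι F)) ≤ C := fun k hk =>
    hC ⟨_, ⟨k, hk, rfl⟩, rfl⟩
  have key : ∀ p : GL ι F, (p : Matrix ι ι F) ∈ upper F (q ∘ c) → p ∈ hF.maxCompact →
      hF.abs (blockDet c x (p : Matrix ι ι F)) ≤ 1 := by
    intro p hp hpK
    have hpow : ∀ n : ℕ, ((p ^ n : GL ι F) : Matrix ι ι F) ∈ upper F (q ∘ c) ∧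
        p ^ n ∈ hF.maxCompact ∧ hF.abs (blockDet c x ((p ^ n : GL ι F) : Matrix ι ι F)) =
          hF.abs (blockDet c x (p : Matrix ι ι F)) ^ n := by
      intro n
      induction n with
      | zero =>
        rw [pow_zero]
        refine ⟨one_mem_upper, hK.one_mem, ?_⟩
        rw [Units.val_one, blockDet_one, hF.abs_one, pow_zero]
      | succ n ih =>
        rw [pow_succ p]
        refine ⟨upper_mul ih.1 hp, hK.mul_mem ih.2.1 hpK, ?_⟩
        rw [Units.val_mul, blockDet_mul hq ih.1 hp, hF.abs_mul, ih.2.2, pow_succ]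
    by_contra h
    obtain ⟨n, hn⟩ := pow_unbounded_of_one_lt C (not_le.1 h)
    have := hC _ (hpow n).2.1
    rw [(hpow n).2.2] at this
    exact absurd hn (not_lt.2 this)
  have h1 := key p hp hpK
  have h2 := key p⁻¹ (upper_inv hp) (hK.inv_mem hpK)
  have h3 : hF.abs (blockDet c x (p : Matrix ι ι F)) *
      hF.abs (blockDet c x ((p⁻¹ : GL ι F) : Matrix ι ι F)) = 1 := by
    rw [← hF.abs_mul, ← blockDet_mul hq hp (upper_inv hp), Units.mul_inv, blockDet_one, hF.abs_one]
  have h4 := hF.abs_nonneg (blockDet c x (p : Matrix ι ι F))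
  nlinarith

/-- `H_P` may be computed from any decomposition `g = pk` with `p ∈ P(F)` and `k ∈ K`. -/
theorem iwasawaH_mul_eq_log (hq : q.Injective) {p k : GL ι F}
    (hp : (p : Matrix ι ι F) ∈ upper F (q ∘ c)) (hk : k ∈ hF.maxCompact) (x : β) :
    iwasawaH hF c (ofHeight F (q ∘ c)) (p * k) x =
      Real.log (hF.abs (blockDet c x (p : Matrix ι ι F))) := by
  have hK := hF.isStandardCompact (ι := ι)
  have hex : ∃ m, m ∈ levi F c ∧ ∃ n ∈ (ofHeight F (q ∘ c)).unip, ∃ k' ∈ hF.maxCompact,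
      p * k = m * n * k' := by
    obtain ⟨m, hm, u, hu, h, -⟩ := exists_levi_mul_unip hq hp
    exact ⟨m, hm, u, unip_ofHeight.2 hu, k, hk, by rw [h]⟩
  obtain ⟨hm, n, hn, k', hk', h⟩ := Classical.epsilon_spec hex
  set m := Classical.epsilon fun m => m ∈ levi F c ∧ ∃ n ∈ (ofHeight F (q ∘ c)).unip,
    ∃ k' ∈ hF.maxCompact, p * k = m * n * k' with hmdef
  change Real.log (hF.abs (blockDet c x (m : Matrix ι ι F))) = _
  congr 1
  rw [unip_ofHeight] at hn
  have hmu : (m : Matrix ι ι F) ∈ upper F (q ∘ c) := upper_of_levi hm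
  have hmn : ((m * n : GL ι F) : Matrix ι ι F) ∈ upper F (q ∘ c) :=
    upper_mul hmu (upper_of_sub_one_mem hn)
  have h1 : m * n = p * (k * k'⁻¹) := by
    rw [← mul_assoc, h, mul_inv_cancel_right]
  have h2 : ((k * k'⁻¹ : GL ι F) : Matrix ι ι F) ∈ upper F (q ∘ c) := by
    have : k * k'⁻¹ = p⁻¹ * (m * n) := by rw [h1, inv_mul_cancel_left]
    rw [this, Units.val_mul]
    exact upper_mul (upper_inv hp) hmn
  have h3 := blockDet_mul hq hmu (upper_of_sub_one_mem hn) x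
  rw [blockDet_of_sub_one_mem hn, mul_one, ← Units.val_mul, h1, Units.val_mul,
    blockDet_mul hq hp h2] at h3
  rw [← h3, hF.abs_mul, hF.abs_blockDet_of_mem_maxCompact hq h2
    (hK.mul_mem hk (hK.inv_mem hk')), mul_one]

theorem exists_iwasawa (κ : ι → ℕ) (g : GL ι F) :
    ∃ p k : GL ι F, (p : Matrix ι ι F) ∈ upper F κ ∧ k ∈ hF.maxCompact ∧ g = p * k := by
  obtain ⟨p, k, hp, hk, h⟩ := (hF.isStandardCompact (ι := ι)).exists_blockTriangular κ g
  exact ⟨p, k, fun a b hab => hp hab, hk, h⟩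

theorem iwasawaH_upper_mul (hq : q.Injective) {p : GL ι F}
    (hp : (p : Matrix ι ι F) ∈ upper F (q ∘ c)) (g : GL ι F) (x : β) :
    iwasawaH hF c (ofHeight F (q ∘ c)) (p * g) x =
      Real.log (hF.abs (blockDet c x (p : Matrix ι ι F))) +
        iwasawaH hF c (ofHeight F (q ∘ c)) g x := by
  obtain ⟨p', k, hp', hk, rfl⟩ := exists_iwasawa hF (q ∘ c) g
  have h1 : ((p * p' : GL ι F) : Matrix ι ι F) ∈ upper F (q ∘ c) := upper_mul hp hp'
  rw [← mul_assoc, iwasawaH_mul_eq_log hF hq h1 hk, iwasawaH_mul_eq_log hF hq hp' hk,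
    Units.val_mul, blockDet_mul hq hp hp', hF.abs_mul, Real.log_mul]
  · exact (hF.abs_pos (blockDet_ne_zero hq hp x)).ne'
  · exact (hF.abs_pos (blockDet_ne_zero hq hp' x)).ne'

theorem iwasawaH_mul_compact (hq : q.Injective) (g : GL ι F) {k : GL ι F}
    (hk : k ∈ hF.maxCompact) (x : β) :
    iwasawaH hF c (ofHeight F (q ∘ c)) (g * k) x =
      iwasawaH hF c (ofHeight F (q ∘ c)) g x := by
  obtain ⟨p', k', hp', hk', rfl⟩ := exists_iwasawa hF (q ∘ c) g
  rw [mul_assoc, iwasawaH_mul_eq_log hF hq hp' ((hF.isStandardCompact (ι := ι)).mul_mem hk' hk),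
    iwasawaH_mul_eq_log hF hq hp' hk']

/-- Continuity of `H_P`: the compact factors of Iwasawa decompositions accumulate, so a limit of
decompositions is a decomposition of the limit. -/
theorem tendsto_iwasawaH (hq : q.Injective) {X : Type*} {l : Filter X} {f : X → GL ι F}
    {g : GL ι F} (hf : Tendsto (fun t => (f t : Matrix ι ι F)) l (𝓝 (g : Matrix ι ι F))) (x : β) :
    Tendsto (fun t => iwasawaH hF c (ofHeight F (q ∘ c)) (f t) x) l
      (𝓝 (iwasawaH hF c (ofHeight F (q ∘ c)) g x)) := by
  have hK := hF.isStandardCompact (ι := ι)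
  have := hF.isTopologicalDivisionRing
  have := hF.t2Space
  choose p k hp hk hpk using fun t => exists_iwasawa hF (q ∘ c) (f t)
  rw [tendsto_iff_ultrafilter]
  intro u hu
  obtain ⟨_, ⟨k₀, hk₀, rfl⟩, hlim⟩ := hK.isCompact.ultrafilter_le_nhds
    (u.map fun t => (((k t)⁻¹ : GL ι F) : Matrix ι ι F))
    (by
      rw [le_principal_iff, Ultrafilter.mem_coe, Ultrafilter.mem_map]
      exact Filter.univ_mem' fun t => ⟨(k t)⁻¹, hK.inv_mem (hk t), rfl⟩)
  have hlim : Tendsto (fun t => (((k t)⁻¹ : GL ι F) : Matrix ι ι F)) u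
      (𝓝 (k₀ : Matrix ι ι F)) := hlim
  have hp_lim : Tendsto (fun t => (p t : Matrix ι ι F)) u
      (𝓝 ((g * k₀ : GL ι F) : Matrix ι ι F)) := by
    have := (hf.mono_left hu).mul hlim
    refine this.congr fun t => ?_
    rw [← Units.val_mul, hpk t, mul_inv_cancel_right]
  have hup : ((g * k₀ : GL ι F) : Matrix ι ι F) ∈ upper F (q ∘ c) := by
    intro a b hab
    have h1 : Tendsto (fun t => (p t : Matrix ι ι F) a b) u
        (𝓝 (((g * k₀ : GL ι F) : Matrix ι ι F) a b)) :=
      ((continuous_id.matrix_elem a b).tendsto _).comp hp_lim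
    refine tendsto_nhds_unique h1 ?_
    exact tendsto_const_nhds.congr fun t => (hp t a b hab).symm
  have hg : g = (g * k₀) * k₀⁻¹ := by rw [mul_inv_cancel_right]
  rw [hg, iwasawaH_mul_eq_log hF hq hup (hK.inv_mem hk₀)]
  simp only [hpk, iwasawaH_mul_eq_log hF hq (hp _) (hk _)]
  refine Tendsto.log ?_ (hF.abs_pos (blockDet_ne_zero hq hup x)).ne'
  exact ((hF.continuous_abs.comp (hF.continuous_blockDet (c := c) x)).tendsto _).comp hp_lim

end IwasawaH

/-! ### The elements `n(Z, Y)` -/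

section UnipSol

variable {F : Type*} [Field F] {ι β : Type*} [Fintype ι] [DecidableEq ι] [Fintype β]
  [DecidableEq β] {c : ι → β} {q : β → ℕ}

theorem diagonal_mem_upper {κ : ι → ℕ} (D : ι → F) : Matrix.diagonal D ∈ upper F κ :=
  fun a b h => Matrix.diagonal_apply_ne _ fun h' => by subst h'; omega

theorem center_mem_upper {κ : ι → ℕ} (z : β → F) : center c z ∈ upper F κ :=
  diagonal_mem_upper _

theorem conj_eq_iff (n : GL ι F) (A B : Matrix ι ι F) :
    ((n⁻¹ : GL ι F) : Matrix ι ι F) * A * n = B ↔ A * (n : Matrix ι ι F) = n * B := by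
  constructor
  · rintro rfl
    rw [mul_assoc, ← mul_assoc, Units.mul_inv, one_mul]
  · intro h
    rw [mul_assoc, h, ← mul_assoc, Units.inv_mul, one_mul]

/-- The linear endomorphism `U ↦ ZU - UZ - UY` of matrices. For `n = 1 + U`, the equation
`n⁻¹Zn = Z + Y` says that it takes `U` to `Y`. -/
def unipMap (Z Y : Matrix ι ι F) : Matrix ι ι F →ₗ[F] Matrix ι ι F :=
  LinearMap.mulLeft F Z - LinearMap.mulRight F Z - LinearMap.mulRight F Y

theorem unipMap_apply (Z Y U : Matrix ι ι F) : unipMap Z Y U = Z * U - U * Z - U * Y := rfl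

theorem unipMap_mem {κ : ι → ℕ} {Z Y U : Matrix ι ι F} (hZ : Z ∈ upper F κ) (hY : Y ∈ upper F κ)
    (hU : U ∈ strictUpper F κ) : unipMap Z Y U ∈ strictUpper F κ :=
  sub_mem (sub_mem (upper_mul_strictUpper hZ hU) (strictUpper_mul_upper hU hZ))
    (strictUpper_mul_upper hU hY)

/-- For regular `Z` the map `U ↦ ZU - UZ - UY` is injective on the nilradical: the entries of a
matrix in the kernel vanish, column by column in increasing order of height. -/
theorem eq_zero_of_unipMap_eq_zero {z : β → F} (hz : z ∈ regular F β)
    {Y U : Matrix ι ι F} (hY : Y ∈ strictUpper F (q ∘ c)) (hU : U ∈ strictUpper F (q ∘ c))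
    (h : unipMap (center c z) Y U = 0) : U = 0 := by
  have key : ∀ n a b, q (c b) = n → U a b = 0 := by
    intro n
    induction n using Nat.strong_induction_on with
    | _ n ih =>
      intro a b hb
      rcases le_or_gt (q (c b)) (q (c a)) with hab | hab
      · exact hU a b hab
      have h1 := congrFun (congrFun h a) b
      rw [unipMap_apply, Matrix.sub_apply, Matrix.sub_apply, center, Matrix.diagonal_mul,
        Matrix.mul_diagonal, Matrix.mul_apply, Finset.sum_eq_zero, sub_zero, Matrix.zero_apply,
        mul_comm (U a b), ← sub_mul] at h1
      · exact (mul_eq_zero.1 h1).resolve_left (hz _ _ fun h' => by simp [h'] at hab)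
      · intro x _
        rcases lt_or_ge (q (c x)) n with hx | hx
        · rw [ih _ hx a x rfl, zero_mul]
        · rw [hY x b (by simpa [hb] using hx), mul_zero]
  ext a b
  exact key _ a b rfl

theorem existsUnique_unipSol {z : β → F} (hz : z ∈ regular F β)
    {Y : Matrix ι ι F} (hY : Y ∈ strictUpper F (q ∘ c)) :
    ∃! n : GL ι F, n ∈ (ofHeight F (q ∘ c)).unip ∧
      ((n⁻¹ : GL ι F) : Matrix ι ι F) * center c z * n = center c z + Y := by
  have hZ : center c z ∈ upper F (q ∘ c) := center_mem_upper z
  have hiff : ∀ n : GL ι F, ((n⁻¹ : GL ι F) : Matrix ι ι F) * center c z * n = center c z + Y ↔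
      unipMap (center c z) Y ((n : Matrix ι ι F) - 1) = Y := by
    intro n
    rw [conj_eq_iff, unipMap_apply, ← sub_eq_zero, ← sub_eq_zero (b := Y)]
    refine Eq.congr ?_ rfl
    noncomm_ring
  let L : strictUpper F (q ∘ c) →ₗ[F] strictUpper F (q ∘ c) :=
    (unipMap (center c z) Y).restrict fun U hU => unipMap_mem hZ (strictUpper_le_upper hY) hU
  have hL : Function.Injective L := by
    rw [injective_iff_map_eq_zero]
    intro U hU
    exact Subtype.ext (eq_zero_of_unipMap_eq_zero hz hY U.2 (congrArg Subtype.val hU))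
  obtain ⟨U, hU⟩ := LinearMap.injective_iff_surjective.1 hL ⟨Y, hY⟩
  have hU' : unipMap (center c z) Y U = Y := congrArg Subtype.val hU
  obtain ⟨n, hn⟩ := exists_unit_of_sub_one_mem (κ := q ∘ c) (A := 1 + (U : Matrix ι ι F))
    (by rw [add_sub_cancel_left]; exact U.2)
  refine ⟨n, ⟨?_, ?_⟩, ?_⟩
  · rw [unip_ofHeight, hn, add_sub_cancel_left]
    exact U.2
  · rw [hiff, hn, add_sub_cancel_left, hU']
  · rintro n' ⟨h1, h2⟩
    rw [unip_ofHeight] at h1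
    rw [hiff] at h2
    refine Units.ext ?_
    have := eq_zero_of_unipMap_eq_zero hz hY (sub_mem h1 U.2)
      (by rw [map_sub, h2, hU', sub_self])
    rw [hn, ← sub_eq_zero, ← this]
    abel

theorem unipSol_eq {z : β → F} (hz : z ∈ regular F β)
    {Y : Matrix ι ι F} (hY : Y ∈ strictUpper F (q ∘ c)) {n : GL ι F}
    (hn : (n : Matrix ι ι F) - 1 ∈ strictUpper F (q ∘ c))
    (h : center c z * (n : Matrix ι ι F) = n * (center c z + Y)) :
    unipSol c (ofHeight F (q ∘ c)) z Y = n := by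
  have hu := existsUnique_unipSol hz hY
  exact hu.unique (Classical.epsilon_spec hu.exists) ⟨unip_ofHeight.2 hn, (conj_eq_iff _ _ _).2 h⟩

end UnipSol

/-! ### Jordan chains and the centraliser of the standard nilpotent -/

section Chains

variable {r : ℕ} {d : ℕ → ℕ}

theorem StdIndex.ext' {a b : StdIndex r d} (h1 : a.1 = b.1) (h2 : (a.2.1 : ℕ) = b.2.1)
    (h3 : (a.2.2 : ℕ) = b.2.2) : a = b := by
  obtain ⟨j, i, k⟩ := a
  obtain ⟨j', i', k'⟩ := b
  obtain rfl : j = j' := h1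
  obtain rfl : i = i' := Fin.ext h2
  obtain rfl : k = k' := Fin.ext h3
  rfl

/-- `b` follows `a` in a Jordan chain, that is, `X e_b = e_a`. -/
def IsSucc (a b : StdIndex r d) : Prop :=
  a.1 = b.1 ∧ (a.2.1 : ℕ) + 1 = b.2.1 ∧ (a.2.2 : ℕ) = b.2.2

instance (a b : StdIndex r d) : Decidable (IsSucc a b) := inferInstanceAs (Decidable (_ ∧ _ ∧ _))

theorem IsSucc.right_unique {a b b' : StdIndex r d} (h : IsSucc a b) (h' : IsSucc a b') :
    b = b' :=
  StdIndex.ext' (h.1.symm.trans h'.1) (h.2.1.symm.trans h'.2.1) (h.2.2.symm.trans h'.2.2)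

theorem IsSucc.left_unique {a a' b : StdIndex r d} (h : IsSucc a b) (h' : IsSucc a' b) :
    a = a' :=
  StdIndex.ext' (h.1.trans h'.1.symm) (Nat.succ_injective (h.2.1.trans h'.2.1.symm))
    (h.2.2.trans h'.2.2.symm)

theorem exists_succ {a : StdIndex r d} (h : (a.2.1 : ℕ) < a.1) : ∃ b, IsSucc a b :=
  ⟨⟨a.1, ⟨a.2.1 + 1, by omega⟩, a.2.2⟩, rfl, rfl, rfl⟩

theorem exists_pred {b : StdIndex r d} (h : 0 < (b.2.1 : ℕ)) : ∃ a, IsSucc a b :=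
  ⟨⟨b.1, ⟨b.2.1 - 1, by omega⟩, b.2.2⟩, rfl, by simp; omega, rfl⟩

variable {F : Type*} [Field F]

theorem stdNilpotent_apply (a b : StdIndex r d) :
    stdNilpotent F r d a b = if IsSucc a b then 1 else 0 := rfl

theorem stdNilpotent_mul_apply {a a' : StdIndex r d} (h : IsSucc a a')
    (M : Matrix (StdIndex r d) (StdIndex r d) F) (b : StdIndex r d) :
    (stdNilpotent F r d * M) a b = M a' b := by
  rw [Matrix.mul_apply, Finset.sum_eq_single a']
  · rw [stdNilpotent_apply, if_pos h, one_mul]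
  · intro x _ hx
    rw [stdNilpotent_apply, if_neg fun h' => hx (h'.right_unique h), zero_mul]
  · simp

theorem stdNilpotent_mul_apply_eq_zero {a : StdIndex r d} (h : ∀ a', ¬ IsSucc a a')
    (M : Matrix (StdIndex r d) (StdIndex r d) F) (b : StdIndex r d) :
    (stdNilpotent F r d * M) a b = 0 := by
  rw [Matrix.mul_apply]
  exact Finset.sum_eq_zero fun x _ => by rw [stdNilpotent_apply, if_neg (h x), zero_mul]

theorem mul_stdNilpotent_apply {b b' : StdIndex r d} (h : IsSucc b b')
    (M : Matrix (StdIndex r d) (StdIndex r d) F) (a : StdIndex r d) :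
    (M * stdNilpotent F r d) a b' = M a b := by
  rw [Matrix.mul_apply, Finset.sum_eq_single b]
  · rw [stdNilpotent_apply, if_pos h, mul_one]
  · intro x _ hx
    rw [stdNilpotent_apply, if_neg fun h' => hx (h'.left_unique h), mul_zero]
  · simp

theorem mul_stdNilpotent_apply_eq_zero {b' : StdIndex r d} (h : ∀ b, ¬ IsSucc b b')
    (M : Matrix (StdIndex r d) (StdIndex r d) F) (a : StdIndex r d) :
    (M * stdNilpotent F r d) a b' = 0 := by
  rw [Matrix.mul_apply]
  exact Finset.sum_eq_zero fun x _ => by rw [stdNilpotent_apply, if_neg (h x), mul_zero]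

/-- The height functions on the standard basis for which the standard nilpotent is a Richardson
element: heights increase strictly along the Jordan chains, and the set of heights in a chain only
depends on its length and grows with it. -/
structure IsChainHeight (h : StdIndex r d → ℕ) : Prop where
  lt_of_isSucc : ∀ {a b}, IsSucc a b → h a < h b
  exists_eq : ∀ a b : StdIndex r d, (a.1 : ℕ) ≤ b.1 → ∃ i, h ⟨b.1, i, b.2.2⟩ = h a

namespace IsChainHeight

variable {h : StdIndex r d → ℕ}

theorem lt_of_lt (hh : IsChainHeight h) {j : Fin r} {i i' : Fin ((j : ℕ) + 1)}
    (k : Fin (d ((j : ℕ) + 1)))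
    (hi : i < i') : h ⟨j, i, k⟩ < h ⟨j, i', k⟩ := by
  have key : ∀ n (hn : (i : ℕ) + n + 1 < j + 1), h ⟨j, i, k⟩ < h ⟨j, ⟨i + n + 1, hn⟩, k⟩ := by
    intro n
    induction n with
    | zero => exact fun hn => hh.lt_of_isSucc ⟨rfl, rfl, rfl⟩
    | succ n ih => exact fun hn => (ih (by omega)).trans (hh.lt_of_isSucc ⟨rfl, rfl, rfl⟩)
  have := key (i' - i - 1) (by omega)
  convert this using 4
  ext
  simp
  omega

theorem lt_iff_lt (hh : IsChainHeight h) {j : Fin r} {i i' : Fin ((j : ℕ) + 1)}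
    (k : Fin (d ((j : ℕ) + 1))) :
    h ⟨j, i, k⟩ < h ⟨j, i', k⟩ ↔ i < i' := by
  refine ⟨fun hlt => ?_, hh.lt_of_lt k⟩
  by_contra hle
  rcases eq_or_lt_of_le (not_lt.1 hle) with h' | h'
  · rw [h'] at hlt
    exact lt_irrefl _ hlt
  · exact lt_asymm hlt (hh.lt_of_lt k h')

/-- If a longer chain contains `a`, then it contains every height of a shorter one; hence `a` has
a predecessor of height at least `h b` as soon as `h b < h a`. -/
theorem exists_pred_le (hh : IsChainHeight h) {a b : StdIndex r d} (hba : (b.1 : ℕ) ≤ a.1)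
    (hlt : h b < h a) :
    ∃ a₀, IsSucc a₀ a ∧ h b ≤ h a₀ := by
  obtain ⟨i, hi⟩ := hh.exists_eq b a hba
  have h1 : i < a.2.1 := (hh.lt_iff_lt a.2.2).1 (hi ▸ hlt)
  obtain ⟨a₀, ha₀⟩ := exists_pred (b := a) (Nat.zero_lt_of_lt h1)
  refine ⟨a₀, ha₀, ?_⟩
  obtain ⟨j, i', k⟩ := a
  obtain ⟨j₀, i₀, k₀⟩ := a₀
  obtain ⟨h2, h3, h4⟩ := ha₀
  obtain rfl : j₀ = j := h2
  obtain rfl : k₀ = k := Fin.ext h4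
  simp only at h3 h1 hi
  rw [← hi, ← not_lt, hh.lt_iff_lt]
  omega

theorem exists_succ_le (hh : IsChainHeight h) {a b : StdIndex r d} (hba : (b.1 : ℕ) ≤ a.1)
    (hlt : h a < h b) :
    ∃ a₁, IsSucc a a₁ ∧ h a₁ ≤ h b := by
  obtain ⟨i, hi⟩ := hh.exists_eq b a hba
  have h1 : a.2.1 < i := (hh.lt_iff_lt a.2.2).1 (hi ▸ hlt)
  obtain ⟨a₁, ha₁⟩ := exists_succ (a := a) (by omega)
  refine ⟨a₁, ha₁, ?_⟩
  obtain ⟨j, i', k⟩ := a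
  obtain ⟨j₁, i₁, k₁⟩ := a₁
  obtain ⟨h2, h3, h4⟩ := ha₁
  obtain rfl : j = j₁ := h2
  obtain rfl : k = k₁ := Fin.ext h4
  simp only at h3 h1 hi
  rw [← hi, ← not_lt, hh.lt_iff_lt]
  omega

theorem stdNilpotent_mem (hh : IsChainHeight h) : stdNilpotent F r d ∈ strictUpper F h := by
  intro a b hab
  rw [stdNilpotent_apply, if_neg]
  intro h'
  exact absurd (hh.lt_of_isSucc h') (not_lt.2 hab)

/-- The centraliser of the standard nilpotent lies in its Richardson parabolic subalgebras. -/
theorem mem_upper_of_commute (hh : IsChainHeight h) {M : Matrix (StdIndex r d) (StdIndex r d) F}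
    (hM : stdNilpotent F r d * M = M * stdNilpotent F r d) : M ∈ upper F h := by
  have key1 : ∀ n (a b : StdIndex r d), (b.2.1 : ℕ) = n → (b.1 : ℕ) ≤ a.1 → h b < h a →
      M a b = 0 := by
    intro n
    induction n using Nat.strong_induction_on with
    | _ n ih =>
      intro a b hb hba hlt
      obtain ⟨a₀, ha₀, hle⟩ := hh.exists_pred_le hba hlt
      rw [← stdNilpotent_mul_apply ha₀ M b, hM]
      by_cases hp : ∃ b₀, IsSucc b₀ b
      · obtain ⟨b₀, hb₀⟩ := hp
        rw [mul_stdNilpotent_apply hb₀]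
        refine ih b₀.2.1 (by have := hb₀.2.1; omega) a₀ b₀ rfl ?_
          ((hh.lt_of_isSucc hb₀).trans_le hle)
        rw [hb₀.1, ha₀.1]
        exact hba
      · exact mul_stdNilpotent_apply_eq_zero (fun b₀ hb₀ => hp ⟨b₀, hb₀⟩) _ _
  have key2 : ∀ n (a b : StdIndex r d), (a.1 : ℕ) - a.2.1 = n → (a.1 : ℕ) ≤ b.1 → h b < h a →
      M a b = 0 := by
    intro n
    induction n using Nat.strong_induction_on with
    | _ n ih =>
      intro a b ha hab hlt
      obtain ⟨b₁, hb₁, hle⟩ := hh.exists_succ_le hab hlt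
      rw [← mul_stdNilpotent_apply hb₁ M a, ← hM]
      by_cases hp : ∃ a₁, IsSucc a a₁
      · obtain ⟨a₁, ha₁⟩ := hp
        rw [stdNilpotent_mul_apply ha₁]
        refine ih (a₁.1 - a₁.2.1) ?_ a₁ b₁ rfl ?_ (hle.trans_lt (hh.lt_of_isSucc ha₁))
        · have h1 : (a.1 : ℕ) = a₁.1 := congrArg _ ha₁.1
          have h2 := ha₁.2.1
          have h3 := a₁.2.1.isLt
          omega
        · rw [← ha₁.1, ← hb₁.1]
          exact hab
      · exact stdNilpotent_mul_apply_eq_zero (fun b₀ hb₀ => hp ⟨b₀, hb₀⟩) _ _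
  intro a b hab
  rcases le_total (b.1 : ℕ) a.1 with h' | h'
  · exact key1 _ a b rfl h' hab
  · exact key2 _ a b rfl h' hab

theorem single_mem_upper {a b : StdIndex r d} (hab : h a ≤ h b) :
    Matrix.single a b (1 : F) ∈ upper F h := by
  intro x y hxy
  rw [Matrix.single_apply, if_neg]
  rintro ⟨rfl, rfl⟩
  omega

end IsChainHeight

/-- The linear map `p ↦ pX - Xp`. -/
noncomputable def adStd (F : Type*) [Field F] (r : ℕ) (d : ℕ → ℕ) :
    Matrix (StdIndex r d) (StdIndex r d) F →ₗ[F] Matrix (StdIndex r d) (StdIndex r d) F :=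
  LinearMap.mulRight F (stdNilpotent F r d) - LinearMap.mulLeft F (stdNilpotent F r d)

theorem adStd_apply (p : Matrix (StdIndex r d) (StdIndex r d) F) :
    adStd F r d p = p * stdNilpotent F r d - stdNilpotent F r d * p := rfl

theorem stdNilpotent_mul_single {a a' : StdIndex r d} (h : IsSucc a a') (b : StdIndex r d) :
    stdNilpotent F r d * Matrix.single a' b 1 = Matrix.single a b 1 := by
  ext x y
  by_cases hx : ∃ x', IsSucc x x'
  · obtain ⟨x', hx'⟩ := hx
    rw [stdNilpotent_mul_apply hx', Matrix.single_apply, Matrix.single_apply]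
    refine if_congr (and_congr_left' ⟨?_, ?_⟩) rfl rfl
    · rintro rfl
      exact h.left_unique hx'
    · rintro rfl
      exact h.right_unique hx'
  · rw [stdNilpotent_mul_apply_eq_zero (fun x' hx' => hx ⟨x', hx'⟩), Matrix.single_apply, if_neg]
    rintro ⟨rfl, -⟩
    exact hx ⟨_, h⟩

theorem stdNilpotent_mul_single_eq_zero {a' : StdIndex r d} (h : ∀ a, ¬ IsSucc a a')
    (b : StdIndex r d) : stdNilpotent F r d * Matrix.single a' b 1 = 0 := by
  ext x y
  by_cases hx : ∃ x', IsSucc x x'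
  · obtain ⟨x', hx'⟩ := hx
    rw [stdNilpotent_mul_apply hx', Matrix.single_apply, if_neg, Matrix.zero_apply]
    rintro ⟨rfl, -⟩
    exact h _ hx'
  · rw [stdNilpotent_mul_apply_eq_zero (fun x' hx' => hx ⟨x', hx'⟩), Matrix.zero_apply]

theorem single_mul_stdNilpotent {b b' : StdIndex r d} (h : IsSucc b b') (a : StdIndex r d) :
    Matrix.single a b 1 * stdNilpotent F r d = Matrix.single a b' 1 := by
  ext x y
  by_cases hy : ∃ y', IsSucc y' y
  · obtain ⟨y', hy'⟩ := hy
    rw [mul_stdNilpotent_apply hy', Matrix.single_apply, Matrix.single_apply]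
    refine if_congr (and_congr_right' ⟨?_, ?_⟩) rfl rfl
    · rintro rfl
      exact h.right_unique hy'
    · rintro rfl
      exact h.left_unique hy'
  · rw [mul_stdNilpotent_apply_eq_zero (fun y' hy' => hy ⟨y', hy'⟩), Matrix.single_apply, if_neg]
    rintro ⟨-, rfl⟩
    exact hy ⟨_, h⟩

theorem single_mul_stdNilpotent_eq_zero {b : StdIndex r d} (h : ∀ b', ¬ IsSucc b b')
    (a : StdIndex r d) : Matrix.single a b 1 * stdNilpotent F r d = 0 := by
  ext x y
  by_cases hy : ∃ y', IsSucc y' y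
  · obtain ⟨y', hy'⟩ := hy
    rw [mul_stdNilpotent_apply hy', Matrix.single_apply, if_neg, Matrix.zero_apply]
    rintro ⟨-, rfl⟩
    exact h _ hy'
  · rw [mul_stdNilpotent_apply_eq_zero (fun y' hy' => hy ⟨y', hy'⟩), Matrix.zero_apply]

theorem finrank_map_add_finrank_inf_ker {F V W : Type*} [Field F] [AddCommGroup V] [Module F V]
    [AddCommGroup W] [Module F W] [FiniteDimensional F V] (T : V →ₗ[F] W) (P : Submodule F V) :
    Module.finrank F (P.map T) + Module.finrank F (P ⊓ LinearMap.ker T : Submodule F V) =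
      Module.finrank F P := by
  have h := LinearMap.finrank_range_add_finrank_ker (T.domRestrict P)
  have h1 : LinearMap.ker (T.domRestrict P) = (LinearMap.ker T).comap P.subtype := rfl
  have h2 : LinearMap.range (T.domRestrict P) = P.map T := by
    ext w
    simp [Submodule.mem_map]
  rw [h1, h2, ← Submodule.finrank_map_subtype_eq, Submodule.map_comap_subtype] at h
  exact h

namespace IsChainHeight

variable {h : StdIndex r d → ℕ}

/-- The orbit of the standard nilpotent under the parabolic subgroup is open in the nilradical:
modulo `[𝔭, X]`, an elementary matrix `E_{ab}` may be moved along the chains of `a` and `b`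
simultaneously, towards an end of the shorter chain. -/
theorem single_mem_map_adStd (hh : IsChainHeight h) {a b : StdIndex r d} (hab : h a < h b) :
    Matrix.single a b (1 : F) ∈ (upper F h).map (adStd F r d) := by
  have key1 : ∀ n (a b : StdIndex r d), (b.1 : ℕ) - b.2.1 = n → (b.1 : ℕ) ≤ a.1 → h a < h b →
      Matrix.single a b (1 : F) ∈ (upper F h).map (adStd F r d) := by
    intro n
    induction n using Nat.strong_induction_on with
    | _ n ih =>
      intro a b hb hba hlt
      obtain ⟨a₁, ha₁, hle⟩ := hh.exists_succ_le hba hlt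
      have hmem : adStd F r d (Matrix.single a₁ b 1) ∈ (upper F h).map (adStd F r d) :=
        ⟨_, single_mem_upper hle, rfl⟩
      rw [adStd_apply, stdNilpotent_mul_single ha₁] at hmem
      by_cases hp : ∃ b₁, IsSucc b b₁
      · obtain ⟨b₁, hb₁⟩ := hp
        rw [single_mul_stdNilpotent hb₁] at hmem
        have := ih (b₁.1 - b₁.2.1) (by
            have h1 : (b.1 : ℕ) = b₁.1 := congrArg _ hb₁.1
            have h2 := hb₁.2.1
            have h3 := b₁.2.1.isLt
            omega) a₁ b₁ rfl (by rw [← ha₁.1, ← hb₁.1]; exact hba)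
          (hle.trans_lt (hh.lt_of_isSucc hb₁))
        simpa using Submodule.sub_mem _ this hmem
      · rw [single_mul_stdNilpotent_eq_zero (fun b₁ hb₁ => hp ⟨b₁, hb₁⟩), zero_sub] at hmem
        simpa using Submodule.neg_mem _ hmem
  have key2 : ∀ n (a b : StdIndex r d), (a.2.1 : ℕ) = n → (a.1 : ℕ) ≤ b.1 → h a < h b →
      Matrix.single a b (1 : F) ∈ (upper F h).map (adStd F r d) := by
    intro n
    induction n using Nat.strong_induction_on with
    | _ n ih =>
      intro a b ha hab hlt
      obtain ⟨b₀, hb₀, hle⟩ := hh.exists_pred_le hab hlt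
      have hmem : adStd F r d (Matrix.single a b₀ 1) ∈ (upper F h).map (adStd F r d) :=
        ⟨_, single_mem_upper hle, rfl⟩
      rw [adStd_apply, single_mul_stdNilpotent hb₀] at hmem
      by_cases hp : ∃ a₀, IsSucc a₀ a
      · obtain ⟨a₀, ha₀⟩ := hp
        rw [stdNilpotent_mul_single ha₀] at hmem
        have := ih a₀.2.1 (by have := ha₀.2.1; omega) a₀ b₀ rfl
          (by rw [ha₀.1, hb₀.1]; exact hab) ((hh.lt_of_isSucc ha₀).trans_le hle)
        simpa using Submodule.add_mem _ hmem this
      · rw [stdNilpotent_mul_single_eq_zero (fun a₀ ha₀ => hp ⟨a₀, ha₀⟩), sub_zero] at hmem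
        exact hmem
  rcases le_total (b.1 : ℕ) a.1 with h' | h'
  · exact key1 _ a b rfl h' hab
  · exact key2 _ a b rfl h' hab

theorem exists_adStd_eq (hh : IsChainHeight h) {Y : Matrix (StdIndex r d) (StdIndex r d) F}
    (hY : Y ∈ strictUpper F h) : ∃ p ∈ upper F h, adStd F r d p = Y := by
  change Y ∈ (upper F h).map (adStd F r d)
  rw [Matrix.matrix_eq_sum_single Y]
  refine Submodule.sum_mem _ fun a _ => Submodule.sum_mem _ fun b _ => ?_
  rcases le_or_gt (h b) (h a) with hab | hab
  · rw [hY a b hab, Matrix.single_zero]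
    exact zero_mem _
  · have := Submodule.smul_mem _ (Y a b) (hh.single_mem_map_adStd (F := F) hab)
    rwa [Matrix.smul_single, smul_eq_mul, mul_one] at this

/-- A conjugate of the standard nilpotent lies in the nilradical of a Richardson parabolic
subgroup only if the conjugating element lies in the parabolic subgroup. Indeed the space of
`p ∈ 𝔭` with `Xp = pY`, `Y = g⁻¹Xg`, has dimension at least `dim 𝔭 - dim 𝔫`, which is the dimension
of the centraliser of `X`, so that `p ↦ pg⁻¹` maps it onto that centraliser. -/
theorem mem_upper_of_conj_mem (hh : IsChainHeight h) {g : GL (StdIndex r d) F}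
    (hg : ((g⁻¹ : GL (StdIndex r d) F) : Matrix (StdIndex r d) (StdIndex r d) F) *
      stdNilpotent F r d * g ∈ strictUpper F h) :
    (g : Matrix (StdIndex r d) (StdIndex r d) F) ∈ upper F h := by
  generalize hY : ((g⁻¹ : GL (StdIndex r d) F) : Matrix (StdIndex r d) (StdIndex r d) F) *
      stdNilpotent F r d * g = Y at hg
  have hgY : (g : Matrix (StdIndex r d) (StdIndex r d) F) * Y = stdNilpotent F r d * g :=
    ((conj_eq_iff _ _ _).1 hY).symm
  let T : Matrix (StdIndex r d) (StdIndex r d) F →ₗ[F] Matrix (StdIndex r d) (StdIndex r d) F :=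
    LinearMap.mulRight F Y - LinearMap.mulLeft F (stdNilpotent F r d)
  let φ : Matrix (StdIndex r d) (StdIndex r d) F →ₗ[F] Matrix (StdIndex r d) (StdIndex r d) F :=
    LinearMap.mulRight F ((g⁻¹ : GL (StdIndex r d) F) : Matrix (StdIndex r d) (StdIndex r d) F)
  have hφ : ∀ p, φ p = p * ((g⁻¹ : GL (StdIndex r d) F) : Matrix _ _ F) := fun p => rfl
  have hφg : ∀ p, φ p * (g : Matrix (StdIndex r d) (StdIndex r d) F) = p := fun p => by
    rw [hφ, mul_assoc, Units.inv_mul, mul_one]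
  have hinj : Function.Injective φ := fun p p' hpp => by rw [← hφg p, hpp, hφg]
  have hle : (upper F h ⊓ LinearMap.ker T).map φ ≤ upper F h ⊓ LinearMap.ker (adStd F r d) := by
    rintro _ ⟨p, ⟨-, hp⟩, rfl⟩
    have hp : p * Y - stdNilpotent F r d * p = 0 := hp
    have h1 : φ p * stdNilpotent F r d = stdNilpotent F r d * φ p := by
      have h2 : φ p * stdNilpotent F r d * (g : Matrix (StdIndex r d) (StdIndex r d) F) =
          stdNilpotent F r d * φ p * (g : Matrix (StdIndex r d) (StdIndex r d) F) := by
        rw [mul_assoc, ← hgY, ← mul_assoc, hφg, mul_assoc, hφg]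
        exact sub_eq_zero.1 hp
      exact g.isUnit.mul_right_cancel h2
    exact ⟨hh.mem_upper_of_commute h1.symm, sub_eq_zero.2 h1⟩
  have hTN : (upper F h).map T ≤ strictUpper F h := by
    rintro _ ⟨p, hp, rfl⟩
    exact sub_mem (upper_mul_strictUpper hp hg) (strictUpper_mul_upper hh.stdNilpotent_mem hp)
  have hSN : strictUpper F h ≤ (upper F h).map (adStd F r d) := fun y hy => hh.exists_adStd_eq hy
  have hdim : Module.finrank F (upper F h ⊓ LinearMap.ker (adStd F r d) : Submodule F _) ≤
      Module.finrank F ((upper F h ⊓ LinearMap.ker T).map φ) := by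
    rw [(Submodule.equivMapOfInjective φ hinj _).symm.finrank_eq]
    have h1 := finrank_map_add_finrank_inf_ker T (upper F h)
    have h2 := finrank_map_add_finrank_inf_ker (adStd F r d) (upper F h)
    have h3 := Submodule.finrank_mono hTN
    have h4 := Submodule.finrank_mono hSN
    omega
  have hone : (1 : Matrix (StdIndex r d) (StdIndex r d) F) ∈
      upper F h ⊓ LinearMap.ker (adStd F r d) := by
    refine ⟨one_mem_upper, ?_⟩
    change (1 : Matrix _ _ F) * stdNilpotent F r d - stdNilpotent F r d * 1 = 0
    rw [one_mul, mul_one, sub_self]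
  rw [← Submodule.eq_of_le_of_finrank_le hle hdim] at hone
  obtain ⟨p, ⟨hp, -⟩, h1⟩ := hone
  rw [← one_mul (g : Matrix (StdIndex r d) (StdIndex r d) F), ← h1, hφg]
  exact hp

end IsChainHeight

end Chains

/-! ### A polynomial family of intertwiners -/

section Functions

variable {F X n : Type*} [Field F] [Fintype n] [DecidableEq n]

theorem det_mem_of_forall_mem (S : Subalgebra F (X → F)) {M : X → Matrix n n F}
    (h : ∀ i j, (fun x => M x i j) ∈ S) : (fun x => (M x).det) ∈ S := by
  have : (fun x => (M x).det) =
      ∑ σ : Equiv.Perm n, (Equiv.Perm.sign σ : ℤ) • ∏ i, fun x => M x (σ i) i := by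
    funext x
    simp [Matrix.det_apply, Finset.sum_apply, Finset.prod_apply, Units.smul_def]
  rw [this]
  exact sum_mem fun σ _ => zsmul_mem (prod_mem fun i _ => h _ _) _

theorem adjugate_mem_of_forall_mem (S : Subalgebra F (X → F)) {M : X → Matrix n n F}
    (h : ∀ i j, (fun x => M x i j) ∈ S) (i j : n) : (fun x => (M x).adjugate i j) ∈ S := by
  simp only [Matrix.adjugate_apply]
  refine det_mem_of_forall_mem S fun a b => ?_
  by_cases hab : a = j
  · simp only [hab, Matrix.updateRow_self]
    exact S.algebraMap_mem ((Pi.single i (1 : F) : n → F) b)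
  · simp only [ne_eq, hab, not_false_eq_true, Matrix.updateRow_ne]
    exact h a b

theorem mul_mem_of_forall_mem (S : Subalgebra F (X → F)) {A B : X → Matrix n n F}
    (hA : ∀ i j, (fun x => A x i j) ∈ S) (hB : ∀ i j, (fun x => B x i j) ∈ S) (i j : n) :
    (fun x => (A x * B x) i j) ∈ S := by
  have : (fun x => (A x * B x) i j) = ∑ y, (fun x => A x i y) * fun x => B x y j := by
    funext x
    simp [Matrix.mul_apply, Finset.sum_apply]
  rw [this]
  exact sum_mem fun y _ => mul_mem (hA _ _) (hB _ _)

theorem const_mem_subalgebra (S : Subalgebra F (X → F)) (t : F) : (fun _ => t) ∈ S :=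
  S.algebraMap_mem t

end Functions

section Intertwiner

variable {F : Type*} [Field F] {r : ℕ} {d : ℕ → ℕ}

local notation "Mat" => Matrix (StdIndex r d) (StdIndex r d) F

/-- A polynomial family of intertwiners: for `D` diagonal and `Y` in the nilradical, `Ψ(D, Y)` is
an element of `𝔭` with `Ψ(D, Y)(D + X) = (D + Y)Ψ(D, Y)`, and `Ψ(0, X) = 1`. It comes from
Cramer's rule: the linear map `p ↦ p(D + X) - (D + Y)p` from `𝔭` to `𝔫` is surjective at
`(D, Y) = (0, X)`, where it has a right inverse `R`. Here polynomiality is expressed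
by membership in every algebra of functions that contains the coordinates. -/
theorem IsChainHeight.exists_intertwiner {h : StdIndex r d → ℕ} (hh : IsChainHeight h) :
    ∃ Ψ : (StdIndex r d → F) × Mat → Mat,
      (∀ S : Subalgebra F ((StdIndex r d → F) × Mat → F),
        (∀ a, (fun x => x.1 a) ∈ S) → (∀ a b, (fun x => x.2 a b) ∈ S) →
          ∀ a b, (fun x => Ψ x a b) ∈ S) ∧
      (∀ D Y, (∀ a b, h a = h b → D a = D b) → Y ∈ strictUpper F h →
        Ψ (D, Y) ∈ upper F h ∧
          Ψ (D, Y) * (Matrix.diagonal D + stdNilpotent F r d) =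
            (Matrix.diagonal D + Y) * Ψ (D, Y)) ∧
      Ψ (0, stdNilpotent F r d) = 1 := by
  let I := {x : StdIndex r d × StdIndex r d // h x.1 < h x.2}
  have hR : ∀ i : I, ∃ p ∈ upper F h, adStd F r d p = Matrix.single i.1.1 i.1.2 1 :=
    fun i => hh.single_mem_map_adStd i.2
  choose R hRu hR using hR
  let A : (StdIndex r d → F) × Mat → Mat → Mat := fun x p =>
    p * (Matrix.diagonal x.1 + stdNilpotent F r d) - (Matrix.diagonal x.1 + x.2) * p
  let N : (StdIndex r d → F) × Mat → Matrix I I F := fun x i i' => A x (R i') i.1.1 i.1.2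
  let v : (StdIndex r d → F) × Mat → I → F := fun x i => A x 1 i.1.1 i.1.2
  let Ψ : (StdIndex r d → F) × Mat → Mat := fun x =>
    (N x).det • (1 : Mat) - ∑ i, ((N x).adjugate *ᵥ v x) i • R i
  have hAsub : ∀ x p p', A x (p - p') = A x p - A x p' := fun x p p' => by
    simp only [A, sub_mul, mul_sub]; abel
  have hAsmul : ∀ x (t : F) p, A x (t • p) = t • A x p := fun x t p => by
    simp only [A, smul_mul_assoc, mul_smul_comm, smul_sub]
  have hAsum : ∀ x (s : I → Mat), A x (∑ i, s i) = ∑ i, A x (s i) := fun x s => by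
    simp only [A, Finset.sum_mul, Finset.mul_sum, Finset.sum_sub_distrib]
  have hAmem : ∀ x : (StdIndex r d → F) × Mat, (∀ a b, h a = h b → x.1 a = x.1 b) →
      x.2 ∈ strictUpper F h → ∀ p ∈ upper F h, A x p ∈ strictUpper F h := by
    intro x hx hY p hp
    have h1 : p * Matrix.diagonal x.1 - Matrix.diagonal x.1 * p ∈ strictUpper F h := by
      intro a b hab
      rw [Matrix.sub_apply, Matrix.diagonal_mul, Matrix.mul_diagonal]
      rcases eq_or_lt_of_le hab with he | hlt
      · rw [hx b a he, mul_comm, sub_self]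
      · rw [hp a b hlt, zero_mul, mul_zero, sub_self]
    have h2 := sub_mem (add_mem h1 (upper_mul_strictUpper hp hh.stdNilpotent_mem))
      (strictUpper_mul_upper hY hp)
    convert h2 using 1
    simp only [A]
    noncomm_ring
  have hA0 : ∀ p, A (0, stdNilpotent F r d) p = adStd F r d p := by
    intro p
    simp [A, adStd_apply]
  refine ⟨Ψ, ?_, ?_, ?_⟩
  · intro S hD hY
    have hAS : ∀ p : Mat, ∀ a b, (fun x => A x p a b) ∈ S := by
      intro p a b
      have hdiag : ∀ i j, (fun x : (StdIndex r d → F) × Mat => Matrix.diagonal x.1 i j) ∈ S := by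
        intro i j
        by_cases hij : i = j
        · simp only [hij, Matrix.diagonal_apply_eq]
          exact hD j
        · simp only [Matrix.diagonal_apply_ne _ hij]
          exact const_mem_subalgebra S 0
      refine S.sub_mem
        (mul_mem_of_forall_mem S (A := fun _ => p)
          (B := fun x => Matrix.diagonal x.1 + stdNilpotent F r d)
          (fun i j => const_mem_subalgebra S _)
          (fun i j => S.add_mem (hdiag i j) (const_mem_subalgebra S _)) a b)
        (mul_mem_of_forall_mem S (A := fun x => Matrix.diagonal x.1 + x.2) (B := fun _ => p)
          (fun i j => S.add_mem (hdiag i j) (hY i j)) (fun i j => const_mem_subalgebra S _) a b)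
    have hN : ∀ i j, (fun x => N x i j) ∈ S := fun i j => hAS _ _ _
    intro a b
    have hΨ : (fun x => Ψ x a b) = (fun x => (N x).det) * (fun _ => (1 : Mat) a b) -
        ∑ i : I, (∑ j : I, (fun x => (N x).adjugate i j) * (fun x => v x j)) *
          (fun _ => R i a b) := by
      funext x
      simp [Ψ, Matrix.sub_apply, Matrix.sum_apply, Matrix.smul_apply, Finset.sum_apply,
        Matrix.mulVec, dotProduct]
    rw [hΨ]
    refine sub_mem (mul_mem (det_mem_of_forall_mem S hN) (const_mem_subalgebra S _))
      (sum_mem fun i _ => mul_mem (sum_mem fun j _ => mul_mem ?_ ?_) (const_mem_subalgebra S _))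
    · exact adjugate_mem_of_forall_mem S hN i j
    · exact hAS 1 _ _
  · intro D Y hD hY
    have hu : Ψ (D, Y) ∈ upper F h :=
      sub_mem (Submodule.smul_mem _ _ one_mem_upper)
        (sum_mem fun i _ => Submodule.smul_mem _ _ (hRu i))
    refine ⟨hu, sub_eq_zero.1 ?_⟩
    change A (D, Y) (Ψ (D, Y)) = 0
    ext a b
    rcases le_or_gt (h b) (h a) with hab | hab
    · exact hAmem (D, Y) hD hY _ hu a b hab
    · have h1 : ∑ i, ((N (D, Y)).adjugate *ᵥ v (D, Y)) i * A (D, Y) (R i) a b =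
          (N (D, Y) *ᵥ ((N (D, Y)).adjugate *ᵥ v (D, Y))) ⟨(a, b), hab⟩ := by
        rw [Matrix.mulVec, dotProduct]
        exact Finset.sum_congr rfl fun i _ => mul_comm _ _
      rw [Matrix.mulVec_mulVec, Matrix.mul_adjugate, Matrix.smul_mulVec, Matrix.one_mulVec] at h1
      simp only [Ψ]
      rw [hAsub, hAsmul, hAsum, Matrix.sub_apply, Matrix.sum_apply, Matrix.smul_apply]
      simp only [hAsmul, Matrix.smul_apply, smul_eq_mul]
      rw [h1]
      simp [v]
  · have hN1 : N (0, stdNilpotent F r d) = 1 := by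
      ext i i'
      simp only [N, hA0, hR, Matrix.single_apply, Matrix.one_apply]
      refine if_congr ?_ rfl rfl
      rw [Subtype.ext_iff, Prod.ext_iff]
      exact ⟨fun h => ⟨h.1.symm, h.2.symm⟩, fun h => ⟨h.1.symm, h.2.symm⟩⟩
    have hv0 : v (0, stdNilpotent F r d) = 0 := by
      funext i
      simp [v, hA0, adStd_apply]
    simp [Ψ, hN1, hv0]

end Intertwiner

/-! ### Richardson orbits and permutation matrices -/

section Zariski

variable {F : Type*} [Field F] {ι : Type*} [Fintype ι] [DecidableEq ι]

variable (F ι) in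
/-- The algebra of polynomial functions of the entries of a matrix. -/
noncomputable def polynomialFunctions : Subalgebra F (Matrix ι ι F → F) :=
  (MvPolynomial.aeval fun (q : ι × ι) (Y : Matrix ι ι F) => Y q.1 q.2).range

theorem exists_polynomial_of_mem {φ : Matrix ι ι F → F} (h : φ ∈ polynomialFunctions F ι) :
    ∃ f : MvPolynomial (ι × ι) F, ∀ Y : Matrix ι ι F,
      MvPolynomial.eval (fun q => Y q.1 q.2) f = φ Y := by
  obtain ⟨f, rfl⟩ := h
  refine ⟨f, fun Y => ?_⟩
  induction f using MvPolynomial.induction_on with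
  | C a => simp
  | add p q hp hq => simp_all
  | mul_X p i hp => simp_all

theorem entry_mem_polynomialFunctions (a b : ι) :
    (fun Y : Matrix ι ι F => Y a b) ∈ polynomialFunctions F ι :=
  ⟨MvPolynomial.X (a, b), by simp⟩

/-- A polynomial that vanishes on a nonempty principal open subset of a linear space of matrices
vanishes on the whole space: restrict to lines. -/
theorem eval_eq_zero_of_forall_ne_zero [Infinite F] {V : Submodule F (Matrix ι ι F)}
    {s f : MvPolynomial (ι × ι) F} {Y₀ : Matrix ι ι F} (hY₀ : Y₀ ∈ V)
    (hs : MvPolynomial.eval (fun q => Y₀ q.1 q.2) s ≠ 0)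
    (h : ∀ Y ∈ V, MvPolynomial.eval (fun q => Y q.1 q.2) s ≠ 0 →
      MvPolynomial.eval (fun q => Y q.1 q.2) f = 0)
    {Y : Matrix ι ι F} (hY : Y ∈ V) : MvPolynomial.eval (fun q => Y q.1 q.2) f = 0 := by
  let line : MvPolynomial (ι × ι) F →ₐ[F] Polynomial F := MvPolynomial.aeval fun q =>
    Polynomial.C (Y₀ q.1 q.2) + Polynomial.X * Polynomial.C (Y q.1 q.2 - Y₀ q.1 q.2)
  have hline : ∀ (p : MvPolynomial (ι × ι) F) (t : F), (line p).eval t =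
      MvPolynomial.eval (fun q => (Y₀ + t • (Y - Y₀)) q.1 q.2) p := by
    intro p t
    induction p using MvPolynomial.induction_on with
    | C a => simp [line]
    | add p q hp hq => simp_all
    | mul_X p i hp => simp_all [line]
  have h0 : line f * line s = 0 := by
    refine Polynomial.funext fun t => ?_
    rw [Polynomial.eval_mul, hline, hline, Polynomial.eval_zero]
    by_cases hst : MvPolynomial.eval (fun q => (Y₀ + t • (Y - Y₀)) q.1 q.2) s = 0
    · rw [hst, mul_zero]
    · rw [h _ (V.add_mem hY₀ (V.smul_mem t (V.sub_mem hY hY₀))) hst, zero_mul]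
  have hs0 : line s ≠ 0 := by
    intro h1
    have := hline s 0
    rw [h1, Polynomial.eval_zero, zero_smul, add_zero] at this
    exact hs this.symm
  have hf0 := (mul_eq_zero.1 h0).resolve_right hs0
  have := hline f 1
  rw [hf0, Polynomial.eval_zero, one_smul, add_sub_cancel] at this
  exact this.symm

theorem mem_orbit_self (Y : Matrix ι ι F) : Y ∈ orbit Y := ⟨1, by simp⟩

theorem orbit_conj (g : GL ι F) (Y : Matrix ι ι F) :
    orbit ((g : Matrix ι ι F) * Y * ((g⁻¹ : GL ι F) : Matrix ι ι F)) = orbit Y := by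
  ext Y'
  constructor
  · rintro ⟨g', rfl⟩
    refine ⟨g' * g, ?_⟩
    rw [_root_.mul_inv_rev]
    simp only [Units.val_mul, mul_assoc]
  · rintro ⟨g', rfl⟩
    refine ⟨g' * g⁻¹, ?_⟩
    rw [_root_.mul_inv_rev, inv_inv, Units.val_mul, Units.val_mul]
    simp only [mul_assoc, Units.inv_mul_cancel_left]

theorem orbit_eq_of_mem {Y Y' : Matrix ι ι F} (h : Y' ∈ orbit Y) : orbit Y' = orbit Y := by
  obtain ⟨g, rfl⟩ := h
  exact orbit_conj g Y

variable (F) in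
/-- The matrix of a permutation as an element of `GL`. -/
def permGL (σ : Equiv.Perm ι) : GL ι F :=
  ⟨σ.permMatrix F, (σ⁻¹).permMatrix F,
    by rw [← Matrix.permMatrix_mul, inv_mul_cancel, Matrix.permMatrix_one],
    by rw [← Matrix.permMatrix_mul, mul_inv_cancel, Matrix.permMatrix_one]⟩

theorem permGL_mul_apply (σ : Equiv.Perm ι) (A : Matrix ι ι F) (a b : ι) :
    ((permGL F σ : Matrix ι ι F) * A) a b = A (σ a) b := by
  change ((σ.toPEquiv.toMatrix : Matrix ι ι F) * A) a b = _
  rw [PEquiv.toMatrix_toPEquiv_mul]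
  rfl

theorem mul_permGL_inv_apply (σ : Equiv.Perm ι) (A : Matrix ι ι F) (a b : ι) :
    (A * (((permGL F σ)⁻¹ : GL ι F) : Matrix ι ι F)) a b = A a (σ b) := by
  change (A * ((σ⁻¹).toPEquiv.toMatrix : Matrix ι ι F)) a b = _
  rw [PEquiv.mul_toMatrix_toPEquiv]
  rfl

theorem permGL_conj (σ : Equiv.Perm ι) (A : Matrix ι ι F) :
    (permGL F σ : Matrix ι ι F) * A * (((permGL F σ)⁻¹ : GL ι F) : Matrix ι ι F) =
      A.submatrix σ σ := by
  ext a b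
  rw [mul_permGL_inv_apply, permGL_mul_apply, Matrix.submatrix_apply]

theorem permGL_mem_weyl (σ : Equiv.Perm ι) : permGL F σ ∈ weyl F ι := ⟨σ, rfl⟩

theorem exists_permGL_of_mem_weyl {w : GL ι F} (hw : w ∈ weyl F ι) : ∃ σ, w = permGL F σ := by
  obtain ⟨σ, h⟩ := hw
  exact ⟨σ, Units.ext h⟩

theorem submatrix_mem_upper {κ : ι → ℕ} (σ : Equiv.Perm ι) {A : Matrix ι ι F} :
    A.submatrix σ σ ∈ upper F κ ↔ A ∈ upper F (κ ∘ σ.symm) := by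
  constructor
  · intro h a b hab
    simpa using h (σ.symm a) (σ.symm b) hab
  · intro h a b hab
    exact h (σ a) (σ b) (by simpa using hab)

theorem submatrix_mem_strictUpper {κ : ι → ℕ} (σ : Equiv.Perm ι) {A : Matrix ι ι F} :
    A.submatrix σ σ ∈ strictUpper F κ ↔ A ∈ strictUpper F (κ ∘ σ.symm) := by
  constructor
  · intro h a b hab
    simpa using h (σ.symm a) (σ.symm b) hab
  · intro h a b hab
    exact h (σ a) (σ b) (by simpa using hab)

theorem conj_permGL_ofHeight (κ : ι → ℕ) (σ : Equiv.Perm ι) :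
    (ofHeight F κ).conj (permGL F σ)⁻¹ = ofHeight F (κ ∘ σ.symm) := by
  have hmul : ∀ (v : ι → F) a, ((((permGL F σ)⁻¹ : GL ι F) : Matrix ι ι F) *ᵥ v) a =
      v (σ.symm a) := by
    intro v a
    change ((σ⁻¹).permMatrix F *ᵥ v) a = _
    rw [Matrix.permMatrix_mulVec]
    rfl
  have key : ∀ s, mapSub (((permGL F σ)⁻¹ : GL ι F) : Matrix ι ι F) (lowerSpan F κ s) =
      lowerSpan F (κ ∘ σ.symm) s := by
    intro s
    ext v
    constructor
    · rintro ⟨v, hv, rfl⟩ a ha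
      exact (hmul v a).trans (hv _ ha)
    · intro hv
      refine ⟨v ∘ σ, fun a ha => hv (σ a) (by simpa using ha), ?_⟩
      funext a
      exact (hmul _ a).trans (by simp)
  apply Parabolic.ext
  ext W
  constructor
  · rintro ⟨_, ⟨s, rfl⟩, rfl⟩
    exact ⟨s, (key s).symm⟩
  · rintro ⟨s, rfl⟩
    exact ⟨_, ⟨s, rfl⟩, key s⟩

end Zariski

section Richardson

variable {F : Type*} [Field F] {r : ℕ} {d : ℕ → ℕ} {h : StdIndex r d → ℕ}

local notation "X₀" => stdNilpotent F r d

theorem IsChainHeight.mem_upper_of_conj_mem' (hh : IsChainHeight h) {g : GL (StdIndex r d) F}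
    (hg : (g : Matrix (StdIndex r d) (StdIndex r d) F) * X₀ *
      ((g⁻¹ : GL (StdIndex r d) F) : Matrix (StdIndex r d) (StdIndex r d) F) ∈ strictUpper F h) :
    (g : Matrix (StdIndex r d) (StdIndex r d) F) ∈ upper F h := by
  have := upper_inv (hh.mem_upper_of_conj_mem (g := g⁻¹) (by rwa [inv_inv]))
  rwa [inv_inv] at this

/-- Near each point of the nilradical in the orbit of the standard nilpotent, the orbit contains
a principal open subset of the nilradical. -/
theorem IsChainHeight.exists_polynomial (hh : IsChainHeight h)
    {Y : Matrix (StdIndex r d) (StdIndex r d) F} (hY : Y ∈ strictUpper F h) (hYX : Y ∈ orbit X₀) :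
    ∃ f : MvPolynomial (StdIndex r d × StdIndex r d) F,
      MvPolynomial.eval (fun q => Y q.1 q.2) f ≠ 0 ∧
      ∀ Y' ∈ strictUpper F h, MvPolynomial.eval (fun q => Y' q.1 q.2) f ≠ 0 → Y' ∈ orbit X₀ := by
  obtain ⟨g, rfl⟩ := hYX
  have hg := hh.mem_upper_of_conj_mem' hY
  obtain ⟨Ψ, hS, hΨ, h1⟩ := hh.exists_intertwiner (F := F)
  let τ : Matrix (StdIndex r d) (StdIndex r d) F → Matrix (StdIndex r d) (StdIndex r d) F :=
    fun Y' => ((g⁻¹ : GL (StdIndex r d) F) : Matrix (StdIndex r d) (StdIndex r d) F) * Y' * g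
  have hpoly : (fun Y' => (Ψ (0, τ Y')).det) ∈ polynomialFunctions F (StdIndex r d) := by
    refine det_mem_of_forall_mem _ fun a b => ?_
    let ψ : ((StdIndex r d → F) × Matrix (StdIndex r d) (StdIndex r d) F → F) →ₐ[F]
        (Matrix (StdIndex r d) (StdIndex r d) F → F) :=
      AlgHom.pi fun Y' => Pi.evalAlgHom F _ (0, τ Y')
    refine hS ((polynomialFunctions F (StdIndex r d)).comap ψ) (fun a => ?_) (fun a b => ?_) a b
    · exact const_mem_subalgebra (polynomialFunctions F (StdIndex r d)) (0 : F)
    · exact mul_mem_of_forall_mem (polynomialFunctions F (StdIndex r d))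
        (A := fun Y' => ((g⁻¹ : GL (StdIndex r d) F) : Matrix (StdIndex r d) (StdIndex r d) F) * Y')
        (B := fun _ => (g : Matrix (StdIndex r d) (StdIndex r d) F))
        (fun i j => mul_mem_of_forall_mem (polynomialFunctions F (StdIndex r d))
          (A := fun _ => ((g⁻¹ : GL (StdIndex r d) F) : Matrix (StdIndex r d) (StdIndex r d) F))
          (B := fun Y' => Y') (fun _ _ => const_mem_subalgebra _ _)
          (fun _ _ => entry_mem_polynomialFunctions _ _) i j)
        (fun i j => const_mem_subalgebra _ _) a b
  obtain ⟨f, hf⟩ := exists_polynomial_of_mem hpoly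
  refine ⟨f, ?_, fun Y' hY' hne => ?_⟩
  · rw [hf]
    have : τ ((g : Matrix (StdIndex r d) (StdIndex r d) F) * X₀ *
        ((g⁻¹ : GL (StdIndex r d) F) : Matrix (StdIndex r d) (StdIndex r d) F)) = X₀ := by
      simp only [τ, mul_assoc, Units.inv_mul, mul_one, Units.inv_mul_cancel_left]
    rw [this, h1, Matrix.det_one]
    exact one_ne_zero
  · rw [hf] at hne
    have hτ : τ Y' ∈ strictUpper F h :=
      strictUpper_mul_upper (upper_mul_strictUpper (upper_inv hg) hY') hg
    obtain ⟨p, hp⟩ := (Matrix.isUnit_iff_isUnit_det _).2 (isUnit_iff_ne_zero.2 hne)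
    have h2 := (hΨ 0 (τ Y') (fun _ _ _ => rfl) hτ).2
    have h0 : (Matrix.diagonal (0 : StdIndex r d → F)) = 0 := Matrix.diagonal_zero
    rw [h0, zero_add, zero_add, ← hp] at h2
    refine ⟨g * p, ?_⟩
    rw [_root_.mul_inv_rev, Units.val_mul, Units.val_mul]
    have h3 : (g : Matrix (StdIndex r d) (StdIndex r d) F) * p * X₀ = Y' * (g * p) := by
      rw [mul_assoc, h2]
      simp only [τ, mul_assoc, Units.mul_inv_cancel_left]
    rw [h3]
    simp only [mul_assoc, Units.mul_inv_cancel_left, Units.mul_inv, mul_one]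

/-- The standard nilpotent is a Richardson element of the parabolic subgroups attached to chain
heights. -/
theorem IsChainHeight.mem_richardson [Infinite F] (hh : IsChainHeight h) :
    X₀ ∈ richardson (ofHeight F h) := by
  refine ⟨Set.inter_subset_right, ⟨{f | ∀ Y' ∈ strictUpper F h,
    MvPolynomial.eval (fun q => Y' q.1 q.2) f ≠ 0 → Y' ∈ orbit X₀}, fun Y hY => ⟨?_, ?_⟩⟩, ?_⟩
  · rintro ⟨h1, -⟩
    obtain ⟨f, hf, hf'⟩ := hh.exists_polynomial (nil_ofHeight.1 hY) h1
    exact ⟨f, hf', hf⟩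
  · rintro ⟨f, hf, hne⟩
    exact ⟨hf Y (nil_ofHeight.1 hY) hne, hY⟩
  · intro f hf Y hY
    obtain ⟨s, hs, hs'⟩ := hh.exists_polynomial (F := F) hh.stdNilpotent_mem (mem_orbit_self _)
    exact eval_eq_zero_of_forall_ne_zero hh.stdNilpotent_mem hs
      (fun Y' hY' hne => hf Y' ⟨hs' Y' hY' hne, nil_ofHeight.2 hY'⟩) (nil_ofHeight.1 hY)

/-- The Richardson orbit of a conjugate of such a parabolic subgroup is the orbit of the standard
nilpotent, since two dense open subsets of the nilradical meet. -/
theorem IsChainHeight.mem_orbit_of_mem_richardson [Infinite F] (hh : IsChainHeight h)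
    {κ : StdIndex r d → ℕ} (σ : Equiv.Perm (StdIndex r d)) (hσ : h = κ ∘ σ.symm)
    {Y : Matrix (StdIndex r d) (StdIndex r d) F} (hY : Y ∈ richardson (ofHeight F κ)) :
    Y ∈ orbit X₀ := by
  obtain ⟨-, ⟨S, hS⟩, hdense⟩ := hY
  have hne : ∃ Y₁ ∈ orbit Y, Y₁ ∈ strictUpper F κ := by
    by_contra hcon
    push Not at hcon
    have := hdense 1 (fun Y₁ hY₁ => absurd (nil_ofHeight.1 hY₁.2) (hcon Y₁ hY₁.1)) 0
      (nil_ofHeight.2 (zero_mem _))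
    simp at this
  obtain ⟨Y₁, hY₁, hY₁κ⟩ := hne
  obtain ⟨f, hfS, hf⟩ := (hS Y₁ (nil_ofHeight.2 hY₁κ)).1 ⟨hY₁, nil_ofHeight.2 hY₁κ⟩
  let f' := MvPolynomial.rename (Prod.map σ σ) f
  have hf' : ∀ Y' : Matrix (StdIndex r d) (StdIndex r d) F,
      MvPolynomial.eval (fun q => Y' q.1 q.2) f' =
        MvPolynomial.eval (fun q => (Y'.submatrix σ σ) q.1 q.2) f := by
    intro Y'
    rw [MvPolynomial.eval_rename]
    rfl
  obtain ⟨Y', ⟨hY'X, hY'h⟩, hY'f⟩ : ∃ Y' ∈ orbit X₀ ∩ (ofHeight F h).nil,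
      MvPolynomial.eval (fun q => Y' q.1 q.2) f' ≠ 0 := by
    by_contra hcon
    push Not at hcon
    have h1 : (Y₁.submatrix σ.symm σ.symm).submatrix σ σ = Y₁ := by
      ext a b; simp
    have := (hh.mem_richardson (F := F)).2.2 f' hcon (Y₁.submatrix σ.symm σ.symm)
      (nil_ofHeight.2 (by rw [hσ, ← submatrix_mem_strictUpper, h1]; exact hY₁κ))
    rw [hf', h1] at this
    exact hf this
  rw [hf'] at hY'f
  have h2 : Y'.submatrix σ σ ∈ strictUpper F κ := by
    rw [submatrix_mem_strictUpper, ← hσ]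
    exact nil_ofHeight.1 hY'h
  have h3 := ((hS _ (nil_ofHeight.2 h2)).2 ⟨f, hfS, hY'f⟩).1
  have h4 : Y'.submatrix σ σ ∈ orbit X₀ := by
    rw [← permGL_conj, ← orbit_eq_of_mem hY'X]
    exact ⟨_, rfl⟩
  rw [← orbit_eq_of_mem h4, orbit_eq_of_mem h3]
  exact mem_orbit_self Y

end Richardson

/-! ### Newton polynomials and the elements `n(Z, X_q)` -/

section StdPerm

variable {r : ℕ} {d : ℕ → ℕ} {q : Fin r → ℕ}

/-- The level `i ≤ j` as an element of `Fin r`. -/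
def levelOf {r : ℕ} (j : Fin r) (i : Fin ((j : ℕ) + 1)) : Fin r := ⟨i, by omega⟩

theorem levelOf_injective (j : Fin r) : (levelOf j).Injective := fun _ _ h =>
  Fin.ext (congrArg (fun x : Fin r => (x : ℕ)) h)

theorem stdLevel_eq (a : StdIndex r d) : stdLevel r d a = levelOf a.1 a.2.1 := rfl

/-- The levels of a chain of length `j + 1` that precede the level `i` in the order given
by `q`. -/
def levelsBefore (q : Fin r → ℕ) (j : Fin r) (i : Fin ((j : ℕ) + 1)) :
    Finset (Fin ((j : ℕ) + 1)) :=
  Finset.univ.filter fun u => q (levelOf j u) < q (levelOf j i)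

theorem mem_levelsBefore {j : Fin r} {i u : Fin ((j : ℕ) + 1)} :
    u ∈ levelsBefore q j i ↔ q (levelOf j u) < q (levelOf j i) := by simp [levelsBefore]

/-- The rank of the level `i` among the levels of a chain of length `j + 1`, ordered by `q`. -/
def levelRank (q : Fin r → ℕ) (j : Fin r) (i : Fin ((j : ℕ) + 1)) : Fin ((j : ℕ) + 1) :=
  ⟨(levelsBefore q j i).card, by
    have : (levelsBefore q j i).card < (Finset.univ : Finset (Fin ((j : ℕ) + 1))).card :=
      Finset.card_lt_card ((Finset.ssubset_univ_iff).2 fun h => by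
        have := mem_levelsBefore.1 (h ▸ Finset.mem_univ i)
        exact lt_irrefl _ this)
    simpa using this⟩

theorem levelRank_lt {j : Fin r} {i u : Fin ((j : ℕ) + 1)}
    (h : q (levelOf j u) < q (levelOf j i)) : levelRank q j u < levelRank q j i := by
  rw [Fin.lt_def]
  change (levelsBefore q j u).card < (levelsBefore q j i).card
  refine Finset.card_lt_card ((Finset.ssubset_iff_of_subset fun x hx => ?_).2 ⟨u, ?_, ?_⟩)
  · exact mem_levelsBefore.2 ((mem_levelsBefore.1 hx).trans h)
  · exact mem_levelsBefore.2 h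
  · exact fun h' => lt_irrefl _ (mem_levelsBefore.1 h')

theorem levelRank_injective (hq : q.Injective) (j : Fin r) : (levelRank q j).Injective := by
  intro u i h
  rcases lt_trichotomy (q (levelOf j u)) (q (levelOf j i)) with h' | h' | h'
  · exact absurd h (levelRank_lt h').ne
  · exact levelOf_injective j (hq h')
  · exact absurd h (levelRank_lt h').ne'

theorem levelRank_lt_iff (hq : q.Injective) {j : Fin r} {i u : Fin ((j : ℕ) + 1)} :
    levelRank q j u < levelRank q j i ↔ q (levelOf j u) < q (levelOf j i) := by
  refine ⟨fun h => ?_, levelRank_lt⟩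
  rcases lt_trichotomy (q (levelOf j u)) (q (levelOf j i)) with h' | h' | h'
  · exact h'
  · rw [levelOf_injective j (hq h')] at h
    exact absurd h (lt_irrefl _)
  · exact absurd h (lt_asymm (levelRank_lt h'))

/-- The permutation of the standard basis which sorts the levels of every Jordan chain in the order
given by `q`. Conjugation by its matrix takes the standard nilpotent to a Richardson element of
the parabolic subgroup attached to `q`. -/
noncomputable def stdPerm (hq : q.Injective) : Equiv.Perm (StdIndex r d) :=
  Equiv.sigmaCongrRight fun j => Equiv.prodCongr
    (Equiv.ofBijective (levelRank q j)
      (Finite.injective_iff_bijective.1 (levelRank_injective hq j)))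
    (Equiv.refl _)

theorem stdPerm_mk (hq : q.Injective) (j : Fin r) (i : Fin ((j : ℕ) + 1))
    (k : Fin (d ((j : ℕ) + 1))) :
    stdPerm (d := d) hq ⟨j, i, k⟩ = ⟨j, levelRank q j i, k⟩ := rfl

theorem isChainHeight_stdPerm (hq : q.Injective) :
    IsChainHeight ((q ∘ stdLevel r d) ∘ (stdPerm (d := d) hq).symm) := by
  constructor
  · intro a b hab
    obtain ⟨a', rfl⟩ := (stdPerm (d := d) hq).surjective a
    obtain ⟨b', rfl⟩ := (stdPerm (d := d) hq).surjective b
    simp only [Function.comp_apply, Equiv.symm_apply_apply]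
    obtain ⟨j, i, k⟩ := a'
    obtain ⟨j', i', k'⟩ := b'
    rw [stdPerm_mk, stdPerm_mk] at hab
    obtain ⟨h1, h2, h3⟩ := hab
    obtain rfl : j = j' := h1
    have h2' : (levelRank q j i : ℕ) + 1 = levelRank q j i' := h2
    have h3' : levelRank q j i < levelRank q j i' := Fin.lt_def.2 (by omega)
    exact (levelRank_lt_iff hq).1 h3'
  · intro a b hab
    obtain ⟨⟨j, i, k⟩, rfl⟩ := (stdPerm (d := d) hq).surjective a
    obtain ⟨j', i', k'⟩ := b
    have hjj : (j : ℕ) ≤ j' := hab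
    refine ⟨levelRank q j' ⟨i, by omega⟩, ?_⟩
    simp only [Function.comp_apply, ← stdPerm_mk hq, Equiv.symm_apply_apply]
    rfl

end StdPerm

section Newton

variable {F : Type*} [Field F] {r : ℕ} {d : ℕ → ℕ} {q : Fin r → ℕ}

/-- Two basis vectors belong to the same Jordan chain. -/
def SameChain (a b : StdIndex r d) : Prop := a.1 = b.1 ∧ (a.2.2 : ℕ) = b.2.2

instance (a b : StdIndex r d) : Decidable (SameChain a b) := inferInstanceAs (Decidable (_ ∧ _))

/-- The Newton polynomial `∏ (X - z_u)` over the levels `u` of the chain of `a` that precede the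
level of `a`. -/
noncomputable def newtonPoly (q : Fin r → ℕ) (z : Fin r → F) (a : StdIndex r d) : Polynomial F :=
  ∏ u ∈ levelsBefore q a.1 a.2.1, (Polynomial.X - Polynomial.C (z (levelOf a.1 u)))

/-- The coefficients of the Newton polynomials of all chains. -/
noncomputable def newtonCoeff (q : Fin r → ℕ) (z : Fin r → F) :
    Matrix (StdIndex r d) (StdIndex r d) F :=
  fun a b => if SameChain a b then (newtonPoly q z a).coeff b.2.1 else 0

/-- The values of the Newton polynomials. -/
noncomputable def newtonValue (q : Fin r → ℕ) (z : Fin r → F) :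
    Matrix (StdIndex r d) (StdIndex r d) F :=
  fun a b => if SameChain a b then (newtonPoly q z a).eval (z (stdLevel r d b)) else 0

/-- The Vandermonde matrices of all chains. -/
def chainVandermonde (z : Fin r → F) : Matrix (StdIndex r d) (StdIndex r d) F :=
  fun a b => if SameChain a b then z (stdLevel r d b) ^ (a.2.1 : ℕ) else 0

theorem natDegree_newtonPoly (z : Fin r → F) (a : StdIndex r d) :
    (newtonPoly q z a).natDegree = levelRank q a.1 a.2.1 := by
  rw [newtonPoly, Polynomial.natDegree_prod_of_monic _ _ fun u _ => Polynomial.monic_X_sub_C _]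
  simp [levelRank]

theorem newtonCoeff_mul_chainVandermonde (z : Fin r → F) :
    newtonCoeff q z * chainVandermonde z =
      (newtonValue q z : Matrix (StdIndex r d) (StdIndex r d) F) := by
  ext a b
  rw [Matrix.mul_apply, newtonValue]
  split_ifs with hab
  · rw [Polynomial.eval_eq_sum_range' (n := (a.1 : ℕ) + 1)
      (by rw [natDegree_newtonPoly]; exact (levelRank q a.1 a.2.1).isLt),
      ← Fin.sum_univ_eq_sum_range
      (fun i => (newtonPoly q z a).coeff i * z (stdLevel r d b) ^ i)]
    symm
    refine Fintype.sum_of_injective (fun i => (⟨a.1, i, a.2.2⟩ : StdIndex r d)) ?_ _ _ ?_ ?_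
    · intro i i' h
      simpa using h
    · intro x hx
      rw [newtonCoeff, if_neg, zero_mul]
      rintro ⟨h1, h2⟩
      refine hx ⟨⟨x.2.1, by rw [h1]; exact x.2.1.isLt⟩, StdIndex.ext' h1 rfl h2⟩
    · intro i
      have hs : SameChain (⟨a.1, i, a.2.2⟩ : StdIndex r d) b := hab
      have hs' : SameChain a (⟨a.1, i, a.2.2⟩ : StdIndex r d) := ⟨rfl, rfl⟩
      rw [newtonCoeff, chainVandermonde, if_pos hs, if_pos hs']
  · refine Finset.sum_eq_zero fun x _ => ?_
    rw [newtonCoeff, chainVandermonde]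
    split_ifs with h1 h2
    · exact absurd ⟨h1.1.trans h2.1, h1.2.trans h2.2⟩ hab
    · rw [mul_zero]
    · rw [zero_mul]
    · rw [zero_mul]

theorem newtonCoeff_zero (hq : q.Injective) :
    (newtonCoeff q 0 : Matrix (StdIndex r d) (StdIndex r d) F) =
      ((permGL F (stdPerm (d := d) hq) : GL (StdIndex r d) F) : Matrix _ _ F) := by
  ext a b
  change _ = (stdPerm hq).permMatrix F a b
  rw [newtonCoeff, Equiv.Perm.permMatrix, PEquiv.toMatrix_apply]
  obtain ⟨j, i, k⟩ := a
  have h0 : newtonPoly q (0 : Fin r → F) ⟨j, i, k⟩ = Polynomial.X ^ (levelRank q j i : ℕ) := by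
    simp [newtonPoly, levelRank]
  rw [h0, Polynomial.coeff_X_pow, Equiv.toPEquiv_apply, stdPerm_mk, ← ite_and]
  refine if_congr ?_ rfl rfl
  rw [Option.mem_some_iff]
  constructor
  · rintro ⟨⟨h1, h2⟩, h3⟩
    exact StdIndex.ext' h1 h3.symm h2
  · rintro rfl
    exact ⟨⟨rfl, rfl⟩, rfl⟩

theorem continuous_coeff_prod [TopologicalSpace F] [IsTopologicalRing F] {X κ : Type*}
    [TopologicalSpace X] (s : Finset κ) (f : κ → X → F) (hf : ∀ u, Continuous (f u)) (n : ℕ) :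
    Continuous fun x => (∏ u ∈ s, (Polynomial.X - Polynomial.C (f u x))).coeff n := by
  classical
  induction s using Finset.induction_on generalizing n with
  | empty => simpa using continuous_const
  | insert u s hu ih =>
    simp only [Finset.prod_insert hu, sub_mul, Polynomial.coeff_sub, Polynomial.coeff_C_mul]
    refine Continuous.sub ?_ ((hf u).mul (ih n))
    cases n with
    | zero => simpa using continuous_const
    | succ n =>
      simp only [Polynomial.coeff_X_mul]
      exact ih n

theorem continuous_newtonCoeff [TopologicalSpace F] [IsTopologicalRing F] (q : Fin r → ℕ) :
    Continuous fun z : Fin r → F =>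
      (newtonCoeff q z : Matrix (StdIndex r d) (StdIndex r d) F) := by
  refine continuous_matrix fun a b => ?_
  by_cases h : SameChain a b
  · simp only [newtonCoeff, if_pos h, newtonPoly]
    exact continuous_coeff_prod (levelsBefore q a.1 a.2.1)
      (fun u (z : Fin r → F) => z (levelOf a.1 u)) (fun u => continuous_apply _) b.2.1
  · simp only [newtonCoeff, if_neg h]
    exact continuous_const

theorem newtonPoly_of_isSucc (hq : q.Injective) (z : Fin r → F) {a a₁ : StdIndex r d}
    (h : IsSucc (stdPerm hq a) (stdPerm hq a₁)) :
    newtonPoly q z a₁ = (Polynomial.X - Polynomial.C (z (stdLevel r d a))) * newtonPoly q z a := by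
  obtain ⟨j, i, k⟩ := a
  obtain ⟨j', i', k'⟩ := a₁
  rw [stdPerm_mk, stdPerm_mk] at h
  obtain ⟨h1, h2, -⟩ := h
  obtain rfl : j = j' := h1
  simp only at h2
  have : levelsBefore q j i' = insert i (levelsBefore q j i) := by
    ext u
    rw [Finset.mem_insert, mem_levelsBefore, mem_levelsBefore, ← levelRank_lt_iff hq,
      ← levelRank_lt_iff hq, Fin.lt_def, Fin.lt_def, ← h2, Nat.lt_succ_iff, le_iff_eq_or_lt]
    refine or_congr_left ⟨fun h => levelRank_injective hq j (Fin.ext h), fun h => by rw [h]⟩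
  rw [newtonPoly, newtonPoly, this, Finset.prod_insert]
  · rfl
  · exact fun h => lt_irrefl _ (mem_levelsBefore.1 h)

theorem eval_newtonPoly_eq_zero (z : Fin r → F) {a b : StdIndex r d} (h : SameChain a b)
    (hlt : q (stdLevel r d b) < q (stdLevel r d a)) :
    (newtonPoly q z a).eval (z (stdLevel r d b)) = 0 := by
  obtain ⟨j, i, k⟩ := a
  obtain ⟨j', i', k'⟩ := b
  obtain rfl : j = j' := h.1
  rw [newtonPoly, Polynomial.eval_prod]
  refine Finset.prod_eq_zero (i := i') (mem_levelsBefore.2 hlt) ?_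
  simp [stdLevel_eq]

/-- The columns of the matrix of values of Newton polynomials are eigenvectors of `Z` plus the
Richardson element attached to `q`; this is the recursion for Newton polynomials. -/
theorem center_add_mul_newtonValue (hq : q.Injective) (z : Fin r → F) :
    (center (stdLevel r d) z + (stdNilpotent F r d).submatrix (stdPerm hq) (stdPerm hq)) *
      newtonValue q z = newtonValue q z * center (stdLevel r d) z := by
  ext a b
  rw [add_mul, Matrix.add_apply, center, Matrix.diagonal_mul, Matrix.mul_diagonal, Matrix.mul_apply]
  by_cases hs : ∃ a₁, IsSucc (stdPerm hq a) (stdPerm hq a₁)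
  · obtain ⟨a₁, ha₁⟩ := hs
    rw [Finset.sum_eq_single a₁]
    · rw [Matrix.submatrix_apply, stdNilpotent_apply, if_pos ha₁, one_mul, newtonValue, newtonValue,
        newtonPoly_of_isSucc hq z ha₁]
      have hiff : SameChain a₁ b ↔ SameChain a b := by
        have h1 : a.1 = a₁.1 := ha₁.1
        have h2 : (a.2.2 : ℕ) = a₁.2.2 := ha₁.2.2
        exact ⟨fun h => ⟨h1.trans h.1, h2.trans h.2⟩,
          fun h => ⟨h1.symm.trans h.1, h2.symm.trans h.2⟩⟩
      by_cases hab : SameChain a b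
      · rw [if_pos hab, if_pos (hiff.2 hab)]
        simp
        ring
      · rw [if_neg hab, if_neg (fun h => hab (hiff.1 h))]
        ring
    · intro x _ hx
      rw [Matrix.submatrix_apply, stdNilpotent_apply, if_neg, zero_mul]
      exact fun h => hx ((stdPerm hq).injective (h.right_unique ha₁))
    · simp
  · rw [Finset.sum_eq_zero, add_zero]
    · rw [newtonValue]
      split_ifs with hab
      · rcases lt_trichotomy (q (stdLevel r d b)) (q (stdLevel r d a)) with h | h | h
        · rw [eval_newtonPoly_eq_zero z hab h, mul_zero, zero_mul]
        · rw [hq h, mul_comm]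
        · -- the level of `a` is the last one of its chain
          exfalso
          obtain ⟨j, i, k⟩ := a
          obtain ⟨j', i', k'⟩ := b
          obtain rfl : j = j' := hab.1
          have h1 : (levelRank q j i : ℕ) < levelRank q j i' :=
            Fin.lt_def.1 (levelRank_lt (q := q) (j := j) h)
          obtain ⟨c, hc⟩ := exists_succ (a := stdPerm hq ⟨j, i, k⟩) (by
            rw [stdPerm_mk]
            have h2 := (levelRank q j i').isLt
            change (levelRank q j i : ℕ) < j
            omega)
          refine hs ⟨(stdPerm hq).symm c, ?_⟩
          rwa [Equiv.apply_symm_apply]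
      · rw [mul_zero, zero_mul]
    · intro x _
      rw [Matrix.submatrix_apply, stdNilpotent_apply, if_neg, zero_mul]
      exact fun h => hs ⟨x, h⟩

/-- The diagonal entries of the matrix of values of Newton polynomials. -/
noncomputable def newtonDiag (q : Fin r → ℕ) (z : Fin r → F) (a : StdIndex r d) : F :=
  (newtonPoly q z a).eval (z (stdLevel r d a))

theorem newtonDiag_eq (z : Fin r → F) (a : StdIndex r d) :
    newtonDiag q z a = ∏ u ∈ levelsBefore q a.1 a.2.1,
      (z (stdLevel r d a) - z (levelOf a.1 u)) := by
  simp [newtonDiag, newtonPoly, Polynomial.eval_prod]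

theorem newtonDiag_ne_zero {z : Fin r → F} (hz : z ∈ regular F (Fin r)) (a : StdIndex r d) :
    newtonDiag q z a ≠ 0 := by
  rw [newtonDiag_eq]
  refine Finset.prod_ne_zero_iff.2 fun u hu => hz _ _ fun h => ?_
  have := mem_levelsBefore.1 hu
  rw [← h] at this
  exact lt_irrefl _ this

/-- The solution of `n⁻¹Zn = Z + X_q`, where `X_q` is the Richardson element attached
to `q`, is the inverse of the matrix of values of Newton polynomials, normalised. Up to the diagonal
matrix, it depends on `q` only through the polynomial matrix of Newton coefficients, as the
Vandermonde matrix does not depend on `q`. -/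
theorem exists_unip_newton (hq : q.Injective) {z : Fin r → F} (hz : z ∈ regular F (Fin r)) :
    ∃ n : GL (StdIndex r d) F,
      (n : Matrix (StdIndex r d) (StdIndex r d) F) - 1 ∈ strictUpper F (q ∘ stdLevel r d) ∧
      center (stdLevel r d) z * (n : Matrix (StdIndex r d) (StdIndex r d) F) =
        n * (center (stdLevel r d) z +
          (stdNilpotent F r d).submatrix (stdPerm hq) (stdPerm hq)) ∧
      (n : Matrix (StdIndex r d) (StdIndex r d) F) * (newtonCoeff q z * chainVandermonde z) =
        Matrix.diagonal (newtonDiag q z) := by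
  set D : Matrix (StdIndex r d) (StdIndex r d) F := Matrix.diagonal (newtonDiag q z) with hD
  set D' : Matrix (StdIndex r d) (StdIndex r d) F := Matrix.diagonal fun a => (newtonDiag q z a)⁻¹
    with hD'
  have hDD : D' * D = 1 := by
    rw [hD, hD', Matrix.diagonal_mul_diagonal, ← Matrix.diagonal_one]
    congr 1
    funext a
    exact inv_mul_cancel₀ (newtonDiag_ne_zero hz a)
  have hmem : newtonValue q z * D' - 1 ∈ strictUpper F (q ∘ stdLevel r d) := by
    intro a b hab
    rw [Matrix.sub_apply, hD', Matrix.mul_diagonal, newtonValue]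
    by_cases hs : SameChain a b
    · rw [if_pos hs]
      rcases eq_or_lt_of_le hab with h | h
      · have h1 : stdLevel r d b = stdLevel r d a := hq h
        have h2 : a = b := StdIndex.ext' hs.1
          (congrArg (fun x : Fin r => (x : ℕ)) h1).symm hs.2
        subst h2
        rw [Matrix.one_apply_eq, sub_eq_zero]
        exact mul_inv_cancel₀ (newtonDiag_ne_zero hz a)
      · rw [eval_newtonPoly_eq_zero z hs h, zero_mul, Matrix.one_apply_ne, sub_zero]
        rintro rfl
        exact lt_irrefl _ h
    · rw [if_neg hs, zero_mul, Matrix.one_apply_ne, sub_zero]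
      rintro rfl
      exact hs ⟨rfl, rfl⟩
  obtain ⟨u, hu⟩ := exists_unit_of_sub_one_mem hmem
  have huD : (u : Matrix (StdIndex r d) (StdIndex r d) F) * D = newtonValue q z := by
    rw [hu, mul_assoc, hDD, mul_one]
  refine ⟨u⁻¹, sub_one_inv_mem (by rw [hu]; exact hmem), ?_, ?_⟩
  · have h1 := center_add_mul_newtonValue (d := d) hq z
    have hcomm : D' * center (stdLevel r d) z = center (stdLevel r d) z * D' := by
      rw [hD', center, Matrix.diagonal_mul_diagonal, Matrix.diagonal_mul_diagonal]
      congr 1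
      funext a
      exact mul_comm _ _
    have h2 : (center (stdLevel r d) z + (stdNilpotent F r d).submatrix (stdPerm hq) (stdPerm hq)) *
        (u : Matrix (StdIndex r d) (StdIndex r d) F) = u * center (stdLevel r d) z := by
      rw [hu, ← mul_assoc, h1, mul_assoc, mul_assoc, hcomm]
    have h3 := congrArg (fun A => ((u⁻¹ : GL (StdIndex r d) F) : Matrix _ _ F) * A *
      ((u⁻¹ : GL (StdIndex r d) F) : Matrix _ _ F)) h2
    simp only [← mul_assoc, Units.inv_mul, one_mul] at h3
    rw [← h3]
    simp only [mul_assoc, Units.mul_inv, mul_one]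
  · rw [newtonCoeff_mul_chainVandermonde, ← huD, ← mul_assoc, Units.inv_mul, one_mul]

end Newton

/-! ### Absolute values of the Newton matrices -/

section NewtonWeights

variable {F : Type*} [Field F] [TopologicalSpace F] (hF : LocalField F)

theorem LocalField.log_abs_mul {x y : F} (hx : x ≠ 0) (hy : y ≠ 0) :
    Real.log (hF.abs (x * y)) = Real.log (hF.abs x) + Real.log (hF.abs y) := by
  rw [hF.abs_mul, Real.log_mul (hF.abs_pos hx).ne' (hF.abs_pos hy).ne']

theorem LocalField.log_abs_prod {κ : Type*} (s : Finset κ) (f : κ → F) (hf : ∀ a ∈ s, f a ≠ 0) :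
    Real.log (hF.abs (∏ a ∈ s, f a)) = ∑ a ∈ s, Real.log (hF.abs (f a)) := by
  obtain ⟨N, hN⟩ := hF.exists_absHom
  simp only [← hN]
  rw [map_prod, Real.log_prod fun a ha => ?_]
  exact (map_ne_zero N).2 (hf a ha)

theorem LocalField.abs_neg (x : F) : hF.abs (-x) = hF.abs x := by
  have h1 : hF.abs (-1) * hF.abs (-1) = 1 := by rw [← hF.abs_mul]; simp [hF.abs_one]
  have h2 : hF.abs (-1) = 1 := by nlinarith [hF.abs_nonneg (-1)]
  rw [← neg_one_mul, hF.abs_mul, h2, one_mul]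

theorem LocalField.abs_sub_comm (x y : F) : hF.abs (x - y) = hF.abs (y - x) := by
  rw [← hF.abs_neg, neg_sub]

theorem blockDet_diagonal {ι β : Type*} [Fintype ι] [DecidableEq ι] [Fintype β] [DecidableEq β]
    (c : ι → β) (x : β) (v : ι → F) :
    blockDet c x (Matrix.diagonal v) = ∏ a with c a = x, v a := by
  have : (Matrix.diagonal v).toSquareBlock c x =
      Matrix.diagonal fun a : {a // c a = x} => v a := by
    ext ⟨a, ha⟩ ⟨b, hb⟩
    simp [Matrix.toSquareBlock_def, Matrix.diagonal_apply]
  rw [blockDet, this, Matrix.det_diagonal]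
  exact (Finset.prod_subtype _ (fun a => by simp) v).symm

variable {r : ℕ} {d : ℕ → ℕ} {q : Fin r → ℕ}

/-- The number of Jordan chains which contain both of the levels `x` and `u`, namely the number of
basis vectors of level `x` whose chain reaches the level `u`. It turns out to be the exponent
`ρ(x, u)`. -/
def stdExponent (d : ℕ → ℕ) (x u : Fin r) : ℕ :=
  (Finset.univ.filter fun a : StdIndex r d => stdLevel r d a = x ∧ (u : ℕ) ≤ a.1).card

theorem stdExponent_le (x u : Fin r) : stdExponent d x u ≤ stdExponent d u x := by
  refine Finset.card_le_card_of_injOn (fun a : StdIndex r d =>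
    if h : (u : ℕ) ≤ a.1 then ⟨a.1, ⟨u, by omega⟩, a.2.2⟩ else a) ?_ ?_
  · intro a ha
    have ha' : stdLevel r d a = x ∧ (u : ℕ) ≤ a.1 := by simpa using ha
    simp only [dif_pos ha'.2, Finset.coe_filter, Finset.mem_univ, true_and, Set.mem_ofPred_eq]
    refine ⟨rfl, ?_⟩
    rw [← ha'.1]
    exact Nat.lt_succ_iff.1 a.2.1.isLt
  · intro a ha b hb hab
    have ha' : stdLevel r d a = x ∧ (u : ℕ) ≤ a.1 := by simpa using ha
    have hb' : stdLevel r d b = x ∧ (u : ℕ) ≤ b.1 := by simpa using hb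
    simp only [dif_pos ha'.2, dif_pos hb'.2] at hab
    have h1 := congrArg (fun t : StdIndex r d => t.1) hab
    change a.1 = b.1 at h1
    have h2 : stdLevel r d a = stdLevel r d b := ha'.1.trans hb'.1.symm
    obtain ⟨j, i, k⟩ := a
    obtain ⟨j', i', k'⟩ := b
    obtain rfl : j = j' := h1
    obtain rfl : i = i' := levelOf_injective j h2
    simp only [Sigma.mk.injEq, heq_eq_eq, Prod.mk.injEq, true_and] at hab
    rw [hab]

theorem stdExponent_comm (x u : Fin r) : stdExponent d x u = stdExponent d u x :=
  (stdExponent_le x u).antisymm (stdExponent_le u x)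

theorem sum_levelsBefore (q : Fin r → ℕ) (a : StdIndex r d) (f : Fin r → ℝ) :
    ∑ u ∈ levelsBefore q a.1 a.2.1, f (levelOf a.1 u) =
      ∑ v, if q v < q (stdLevel r d a) ∧ (v : ℕ) ≤ a.1 then f v else 0 := by
  rw [← Finset.sum_filter]
  refine Finset.sum_nbij (levelOf a.1) ?_ (fun _ _ _ _ h => levelOf_injective _ h) ?_
    fun _ _ => rfl
  · intro u hu
    rw [Finset.mem_filter]
    exact ⟨Finset.mem_univ _, mem_levelsBefore.1 hu, Nat.lt_succ_iff.1 u.isLt⟩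
  · intro v hv
    have hv' : q v < q (stdLevel r d a) ∧ (v : ℕ) ≤ a.1 := by simpa using hv
    exact ⟨⟨v, by omega⟩, mem_levelsBefore.2 hv'.1, rfl⟩

theorem log_abs_blockDet_newtonDiag (q : Fin r → ℕ) {z : Fin r → F}
    (hz : z ∈ regular F (Fin r)) (x : Fin r) :
    Real.log (hF.abs (blockDet (stdLevel r d) x (Matrix.diagonal (newtonDiag q z)))) =
      ∑ u, if q u < q x then (stdExponent d x u : ℝ) * Real.log (hF.abs (z x - z u)) else 0 := by
  rw [blockDet_diagonal, hF.log_abs_prod _ _ fun a _ => newtonDiag_ne_zero hz a]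
  have h1 : ∀ a ∈ Finset.univ.filter (fun a : StdIndex r d => stdLevel r d a = x),
      Real.log (hF.abs (newtonDiag q z a)) =
        ∑ v, if q v < q x ∧ (v : ℕ) ≤ a.1 then Real.log (hF.abs (z x - z v)) else 0 := by
    intro a ha
    have hax : stdLevel r d a = x := by simpa using ha
    rw [newtonDiag_eq, hF.log_abs_prod, hax,
      sum_levelsBefore q a fun v => Real.log (hF.abs (z x - z v)), hax]
    intro u hu
    refine hz _ _ fun h => ?_
    have := mem_levelsBefore.1 hu
    rw [← h] at this
    exact lt_irrefl _ this
  rw [Finset.sum_congr rfl h1, Finset.sum_comm]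
  refine Finset.sum_congr rfl fun v _ => ?_
  by_cases hv : q v < q x
  · simp only [hv, true_and, if_true]
    rw [← Finset.sum_filter, Finset.filter_filter, Finset.sum_const, nsmul_eq_mul]
    rfl
  · simp [hv]

theorem rootFactor_eq_exp {β : Type*} (α : β × β) (ρ : ℝ) (l : β → ℂ) {z : β → F}
    (hz : z ∈ regular F β) (hα : α.1 ≠ α.2) :
    rootFactor hF α ρ l z =
      Complex.exp ((ρ * Real.log (hF.abs (z α.1 - z α.2)) : ℝ) * coroot l α) := by
  have hpos := hF.abs_pos (hz _ _ hα)
  rw [rootFactor, Complex.cpow_def_of_ne_zero (by exact_mod_cast hpos.ne'),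
    ← Complex.ofReal_log hpos.le]
  congr 1
  push_cast
  ring

/-- The exponent of the factors `|α(Z)|^(ρ(α)⟨λ, α^∨⟩)`, taken together, equals that of the singular
part of the weight, which comes from the diagonal entries of the Newton matrices for `q₁` and `q₂`;
here `T x u` stands for `ρ(α) log |α(Z)|`, with `α` the root of the pair `(x, u)`. -/
theorem sum_roots_eq (q₁ q₂ : Fin r → ℕ) (l : Fin r → ℂ) (T : Fin r → Fin r → ℝ)
    (hT : ∀ x u, T x u = T u x) (hq₁ : q₁.Injective) (hq₂ : q₂.Injective) :
    ∑ α : Fin r × Fin r with q₂ α.1 < q₂ α.2 ∧ q₁ α.2 < q₁ α.1, (T α.1 α.2 : ℂ) * coroot l α =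
      pairing l fun x => (∑ u, if q₁ u < q₁ x then T x u else 0) -
        ∑ u, if q₂ u < q₂ x then T x u else 0 := by
  have h1 : ∑ α : Fin r × Fin r with q₂ α.1 < q₂ α.2 ∧ q₁ α.2 < q₁ α.1,
      (T α.1 α.2 : ℂ) * coroot l α =
      (∑ x, ∑ u, if q₂ x < q₂ u ∧ q₁ u < q₁ x then (T x u : ℂ) * l x else 0) -
      ∑ x, ∑ u, if q₂ u < q₂ x ∧ q₁ x < q₁ u then (T x u : ℂ) * l x else 0 := by
    rw [Finset.sum_filter, Fintype.sum_prod_type]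
    conv_rhs => rw [Finset.sum_comm (f := fun x u =>
      if q₂ u < q₂ x ∧ q₁ x < q₁ u then (T x u : ℂ) * l x else 0)]
    rw [← Finset.sum_sub_distrib]
    refine Finset.sum_congr rfl fun x _ => ?_
    rw [← Finset.sum_sub_distrib]
    refine Finset.sum_congr rfl fun u _ => ?_
    simp only [coroot]
    rw [hT u x]
    split_ifs
    · ring
    · ring
  rw [h1, pairing, ← Finset.sum_sub_distrib]
  refine Finset.sum_congr rfl fun x _ => ?_
  rw [← Finset.sum_sub_distrib, ← Finset.sum_sub_distrib, Complex.ofReal_sum, Finset.mul_sum]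
  refine Finset.sum_congr rfl fun u _ => ?_
  rcases eq_or_ne x u with rfl | hxu
  · simp
  · have n1 := hq₁.ne hxu
    have n2 := hq₂.ne hxu
    rcases lt_or_gt_of_ne n1 with h1 | h1 <;> rcases lt_or_gt_of_ne n2 with h2 | h2 <;>
      simp [h1, h2, h1.not_gt, h2.not_gt] <;> ring

end NewtonWeights

/-! ### The Levi part of `n(Z, Y)` -/

section WeightLimit

variable {F : Type*} [Field F] [TopologicalSpace F] (hF : LocalField F)

theorem tendsto_matrix_inv {ι : Type*} [Fintype ι] [DecidableEq ι] [IsTopologicalDivisionRing F]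
    {X : Type*} {L : Filter X} {f : X → Matrix ι ι F} {A : Matrix ι ι F}
    (hf : Tendsto f L (𝓝 A)) (hA : A.det ≠ 0) : Tendsto (fun t => (f t)⁻¹) L (𝓝 A⁻¹) := by
  have h1 : Tendsto (fun t => (f t).det) L (𝓝 A.det) :=
    ((continuous_id.matrix_det (n := ι) (R := F)).tendsto A).comp hf
  have h2 : Tendsto (fun t => (f t).adjugate) L (𝓝 A.adjugate) :=
    ((continuous_id.matrix_adjugate (n := ι) (R := F)).tendsto A).comp hf
  simp only [Matrix.inv_def, Ring.inverse_eq_inv']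
  exact (h1.inv₀ hA).smul h2

variable {r : ℕ} {d : ℕ → ℕ} {q q₁ q₂ : Fin r → ℕ}

/-- The Richardson element of the parabolic subgroup attached to `q`. -/
noncomputable def richardsonElt (F : Type*) [Field F] (d : ℕ → ℕ) (hq : q.Injective) :
    Matrix (StdIndex r d) (StdIndex r d) F :=
  (stdNilpotent F r d).submatrix (stdPerm hq) (stdPerm hq)

theorem richardsonElt_mem (hq : q.Injective) :
    richardsonElt F d hq ∈ strictUpper F (q ∘ stdLevel r d) :=
  (submatrix_mem_strictUpper _).2 (isChainHeight_stdPerm hq).stdNilpotent_mem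

/-- For `Y = p₀X_qp₀⁻¹`, conjugation of `Z + X_q` to `Z + Y` by a continuous family of elements of
`P` that passes through `p₀` at `Z = 0`. -/
theorem exists_continuous_intertwiner [IsTopologicalDivisionRing F] (hq : q.Injective)
    {p₀ : GL (StdIndex r d) F}
    (hp₀ : (p₀ : Matrix (StdIndex r d) (StdIndex r d) F) ∈ upper F (q ∘ stdLevel r d)) :
    ∃ p : (Fin r → F) → Matrix (StdIndex r d) (StdIndex r d) F, Continuous p ∧ p 0 = p₀.val ∧
      ∀ z, p z ∈ upper F (q ∘ stdLevel r d) ∧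
        p z * (center (stdLevel r d) z + richardsonElt F d hq) =
          (center (stdLevel r d) z + (p₀ : Matrix (StdIndex r d) (StdIndex r d) F) *
            richardsonElt F d hq * ((p₀⁻¹ : GL (StdIndex r d) F) : Matrix _ _ F)) * p z := by
  set π := stdPerm (d := d) hq with hπ
  set P₀ : Matrix (StdIndex r d) (StdIndex r d) F := p₀.val with hP₀
  set Q₀ : Matrix (StdIndex r d) (StdIndex r d) F := p₀⁻¹.val with hQ₀
  have hPQ : P₀ * Q₀ = 1 := Units.mul_inv p₀
  have hQP : Q₀ * P₀ = 1 := Units.inv_mul p₀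
  have hQ₀u : Q₀ ∈ upper F (q ∘ stdLevel r d) := upper_inv hp₀
  obtain ⟨Ψ, hΨS, hΨ, hΨ1⟩ := (isChainHeight_stdPerm (d := d) hq).exists_intertwiner (F := F)
  have hΨc : Continuous Ψ := continuous_matrix fun a b =>
    hΨS (continuousSubalgebra (R := F)) (fun a => (continuous_apply a).comp continuous_fst)
      (fun a b => continuous_snd.matrix_elem a b) a b
  -- the difference `p₀⁻¹ (Z + Y) p₀ - Z`
  let E : (Fin r → F) → Matrix (StdIndex r d) (StdIndex r d) F := fun z =>
    Q₀ * center (stdLevel r d) z * P₀ - center (stdLevel r d) z + richardsonElt F d hq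
  have hE : ∀ z, E z ∈ strictUpper F (q ∘ stdLevel r d) := by
    intro z
    refine add_mem ?_ (richardsonElt_mem hq)
    obtain ⟨m, hm, u, hu, hmu, -⟩ := exists_levi_mul_unip hq hp₀
    -- conjugation by a Levi element fixes `Z`
    have h1 : Q₀ * center (stdLevel r d) z * P₀ =
        ((u⁻¹ : GL (StdIndex r d) F) : Matrix _ _ F) * center (stdLevel r d) z *
          (u : Matrix (StdIndex r d) (StdIndex r d) F) := by
      rw [hQ₀, hP₀, hmu, _root_.mul_inv_rev, Units.val_mul, Units.val_mul, mul_assoc, mul_assoc,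
        ← mul_assoc (center _ _), center_mul_levi hm, mul_assoc m.val,
        ← mul_assoc _ m.val, Units.inv_mul, one_mul, mul_assoc]
    rw [h1]
    have h2 : ((u⁻¹ : GL (StdIndex r d) F) : Matrix _ _ F) * center (stdLevel r d) z *
          (u : Matrix (StdIndex r d) (StdIndex r d) F) - center (stdLevel r d) z =
        (((u⁻¹ : GL (StdIndex r d) F) : Matrix _ _ F) - 1) * (center (stdLevel r d) z *
          (u : Matrix (StdIndex r d) (StdIndex r d) F)) + center (stdLevel r d) z *
          ((u : Matrix (StdIndex r d) (StdIndex r d) F) - 1) := by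
      noncomm_ring
    rw [h2]
    exact add_mem (strictUpper_mul_upper (sub_one_inv_mem hu)
      (upper_mul (center_mem_upper z) (upper_of_sub_one_mem hu)))
      (upper_mul_strictUpper (center_mem_upper z) hu)
  let D : (Fin r → F) → StdIndex r d → F := fun z a => z (stdLevel r d (π.symm a))
  let y : (Fin r → F) → (StdIndex r d → F) × Matrix (StdIndex r d) (StdIndex r d) F :=
    fun z => (D z, (E z).submatrix π.symm π.symm)
  have hcen : Continuous fun z : Fin r → F => center (stdLevel r d) z :=
    Continuous.matrix_diagonal (continuous_pi fun a => continuous_apply _)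
  have hEc : Continuous E :=
    (((continuous_const.mul hcen).mul continuous_const).sub hcen).add continuous_const
  have hy : Continuous y := by
    refine Continuous.prodMk (continuous_pi fun a => continuous_apply _) ?_
    exact hEc.matrix_submatrix _ _
  have hy0 : y 0 = (0, stdNilpotent F r d) := by
    have h0 : center (stdLevel r d) (0 : Fin r → F) = 0 := Matrix.diagonal_zero
    refine Prod.ext rfl ?_
    simp [y, E, h0, richardsonElt, ← hπ]
  refine ⟨fun z => P₀ * (Ψ (y z)).submatrix π π, ?_, ?_, fun z => ?_⟩
  · exact continuous_const.mul ((hΨc.comp hy).matrix_submatrix _ _)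
  · simp only [hy0, hΨ1]
    simp
  · obtain ⟨hu, he⟩ := hΨ (D z) ((E z).submatrix π.symm π.symm)
      (fun a b hab => congrArg z (hq hab)) ((submatrix_mem_strictUpper π).1 (by
        simpa [Matrix.submatrix_submatrix] using hE z))
    refine ⟨upper_mul hp₀ ((submatrix_mem_upper π).2 hu), ?_⟩
    have hD : (Matrix.diagonal (D z)).submatrix π π = center (stdLevel r d) z := by
      rw [Matrix.submatrix_diagonal_equiv, center]
      congr 1
      funext a
      simp [D]
    have he' := congrArg (fun A => A.submatrix π π) he
    simp only [← Matrix.submatrix_mul_equiv _ _ π π π, Matrix.submatrix_add, Pi.add_apply, hD,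
      Matrix.submatrix_submatrix, Equiv.symm_comp_self, Matrix.submatrix_id_id] at he'
    change _ * (_ + richardsonElt F d hq) = _ at he'
    rw [mul_assoc, he', ← mul_assoc, ← mul_assoc]
    congr 1
    simp only [E]
    rw [mul_add, mul_add, mul_sub, ← mul_assoc, ← mul_assoc, hPQ, one_mul, add_mul,
      mul_assoc _ Q₀, hQP, mul_one]
    abel

/-- The Levi part of `n(Z, Y)` with respect to another parabolic subgroup, in terms of an element
`p` which conjugates `Z + X_q` to `Z + Y`. The Newton matrices `C₁` and `C₂` contain no
denominators; the singularities at `Z = 0` are those of the diagonal factors. -/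
theorem iwasawaH_unipSol (hq₁ : q₁.Injective) (hq₂ : q₂.Injective) {z : Fin r → F}
    (hz : z ∈ regular F (Fin r)) {Y : Matrix (StdIndex r d) (StdIndex r d) F}
    (hY : Y ∈ strictUpper F (q₁ ∘ stdLevel r d)) {p C₁ C₂ : GL (StdIndex r d) F}
    (hp : (p : Matrix (StdIndex r d) (StdIndex r d) F) ∈ upper F (q₁ ∘ stdLevel r d))
    (hpY : (p : Matrix (StdIndex r d) (StdIndex r d) F) *
      (center (stdLevel r d) z + richardsonElt F d hq₁) = (center (stdLevel r d) z + Y) * p)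
    (hC₁ : (C₁ : Matrix (StdIndex r d) (StdIndex r d) F) = newtonCoeff q₁ z)
    (hC₂ : (C₂ : Matrix (StdIndex r d) (StdIndex r d) F) = newtonCoeff q₂ z) (x : Fin r) :
    iwasawaH hF (stdLevel r d) (ofHeight F (q₂ ∘ stdLevel r d))
        (unipSol (stdLevel r d) (ofHeight F (q₁ ∘ stdLevel r d)) z Y) x =
      Real.log (hF.abs (blockDet (stdLevel r d) x (p : Matrix (StdIndex r d) (StdIndex r d) F))) +
        (Real.log (hF.abs (blockDet (stdLevel r d) x
          (Matrix.diagonal (newtonDiag q₁ z) : Matrix (StdIndex r d) (StdIndex r d) F))) -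
        Real.log (hF.abs (blockDet (stdLevel r d) x
          (Matrix.diagonal (newtonDiag q₂ z) : Matrix (StdIndex r d) (StdIndex r d) F)))) +
        iwasawaH hF (stdLevel r d) (ofHeight F (q₂ ∘ stdLevel r d)) (C₂ * C₁⁻¹ * p⁻¹) x := by
  obtain ⟨m, hm, u, hu, hmu, hdet⟩ := exists_levi_mul_unip hq₁ hp
  obtain ⟨n₁, hn₁, hZ₁, hD₁⟩ := exists_unip_newton (d := d) hq₁ hz
  obtain ⟨n₂, hn₂, hZ₂, hD₂⟩ := exists_unip_newton (d := d) hq₂ hz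
  have hdiag : ∀ q : Fin r → ℕ, ∃ δ : GL (StdIndex r d) F,
      (δ : Matrix (StdIndex r d) (StdIndex r d) F) = Matrix.diagonal (newtonDiag q z) := by
    intro q
    have : IsUnit (Matrix.diagonal (newtonDiag q z) :
        Matrix (StdIndex r d) (StdIndex r d) F) := by
      rw [Matrix.isUnit_iff_isUnit_det, Matrix.det_diagonal, isUnit_iff_ne_zero]
      exact Finset.prod_ne_zero_iff.2 fun a _ => newtonDiag_ne_zero hz a
    exact ⟨this.unit, rfl⟩
  obtain ⟨δ₁, hδ₁⟩ := hdiag q₁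
  obtain ⟨δ₂, hδ₂⟩ := hdiag q₂
  have hV : ∃ V : GL (StdIndex r d) F,
      (V : Matrix (StdIndex r d) (StdIndex r d) F) = chainVandermonde z := by
    have : (chainVandermonde z : Matrix (StdIndex r d) (StdIndex r d) F) =
        ((C₁⁻¹ * n₁⁻¹ * δ₁ : GL (StdIndex r d) F) : Matrix (StdIndex r d) (StdIndex r d) F) := by
      rw [Units.val_mul, hδ₁, ← hD₁, ← hC₁, Units.val_mul, mul_assoc,
        Units.inv_mul_cancel_left, Units.inv_mul_cancel_left]
    exact ⟨_, this.symm⟩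
  obtain ⟨V, hV⟩ := hV
  have e₁ : n₁ * (C₁ * V) = δ₁ := Units.ext (by
    rw [Units.val_mul, Units.val_mul, hC₁, hV, hD₁, hδ₁])
  have e₂ : n₂ * (C₂ * V) = δ₂ := Units.ext (by
    rw [Units.val_mul, Units.val_mul, hC₂, hV, hD₂, hδ₂])
  have hn : n₁ = δ₁ * δ₂⁻¹ * n₂ * (C₂ * C₁⁻¹) := by
    rw [← e₁, ← e₂]
    group
  have hsol : unipSol (stdLevel r d) (ofHeight F (q₁ ∘ stdLevel r d)) z Y = m * n₁ * p⁻¹ := by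
    refine unipSol_eq hz hY ?_ ?_
    · have hmup := upper_of_levi (q := q₁) hm
      have h1 := upper_mul_strictUpper hmup (strictUpper_mul_upper
        (sub_one_mul_mem hn₁ (sub_one_inv_mem hu)) (upper_inv hmup))
      convert h1 using 1
      rw [hmu, _root_.mul_inv_rev, Units.val_mul, Units.val_mul, Units.val_mul, sub_mul, mul_sub,
        one_mul,
        Units.mul_inv]
      simp only [mul_assoc]
    · have h1 : (center (stdLevel r d) z + richardsonElt F d hq₁) *
          ((p⁻¹ : GL (StdIndex r d) F) : Matrix _ _ F) =
          ((p⁻¹ : GL (StdIndex r d) F) : Matrix _ _ F) * (center (stdLevel r d) z + Y) := by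
        have h2 := congrArg (fun A => ((p⁻¹ : GL (StdIndex r d) F) : Matrix _ _ F) * A *
          ((p⁻¹ : GL (StdIndex r d) F) : Matrix _ _ F)) hpY
        simp only [← mul_assoc, Units.inv_mul, one_mul] at h2
        rw [h2]
        simp only [mul_assoc, Units.mul_inv, mul_one]
      change center (stdLevel r d) z * _ = n₁ * (_ + richardsonElt F d hq₁) at hZ₁
      rw [Units.val_mul, Units.val_mul, ← mul_assoc, ← mul_assoc, center_mul_levi hm,
        mul_assoc m.val, hZ₁, mul_assoc, mul_assoc, mul_assoc, h1]
      simp only [mul_assoc]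
  have hupδ : ∀ {δ : GL (StdIndex r d) F} {v : StdIndex r d → F}, δ.val =
      Matrix.diagonal v → δ.val ∈ upper F (q₂ ∘ stdLevel r d) := by
    intro δ v h
    rw [h]
    exact diagonal_mem_upper v
  have hmup := upper_of_levi (q := q₂) hm
  have u1 := hupδ hδ₁
  have u2 := hupδ hδ₂
  have u3 := upper_of_sub_one_mem hn₂
  have b1 := blockDet_ne_zero hq₂ hmup x
  have b2 := blockDet_ne_zero hq₂ u1 x
  have b3 := blockDet_ne_zero hq₂ u2 x
  have b4 := blockDet_ne_zero hq₂ (upper_inv u2) x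
  have h5 : blockDet (stdLevel r d) x ((δ₂⁻¹ : GL (StdIndex r d) F) : Matrix _ _ F) =
      (blockDet (stdLevel r d) x (δ₂ : Matrix (StdIndex r d) (StdIndex r d) F))⁻¹ := by
    refine eq_inv_of_mul_eq_one_left ?_
    rw [← blockDet_mul hq₂ (upper_inv u2) u2, Units.inv_mul, blockDet_one]
  have hlog : Real.log (hF.abs (blockDet (stdLevel r d) x
      ((δ₂⁻¹ : GL (StdIndex r d) F) : Matrix _ _ F))) =
      -Real.log (hF.abs (blockDet (stdLevel r d) x
        (δ₂ : Matrix (StdIndex r d) (StdIndex r d) F))) := by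
    have h6 := hF.log_abs_mul b4 b3
    rw [h5, inv_mul_cancel₀ b3, hF.abs_one, Real.log_one] at h6
    rw [h5]
    linarith
  rw [hsol, hn, show m * (δ₁ * δ₂⁻¹ * n₂ * (C₂ * C₁⁻¹)) * p⁻¹ =
      (m * (δ₁ * (δ₂⁻¹ * n₂))) * (C₂ * C₁⁻¹ * p⁻¹) by group,
    iwasawaH_upper_mul hF hq₂ (by
      rw [Units.val_mul, Units.val_mul, Units.val_mul]
      exact upper_mul hmup (upper_mul u1 (upper_mul (upper_inv u2) u3)))]
  congr 1
  rw [Units.val_mul, Units.val_mul, Units.val_mul,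
    blockDet_mul hq₂ hmup (upper_mul u1 (upper_mul (upper_inv u2) u3)),
    blockDet_mul hq₂ u1 (upper_mul (upper_inv u2) u3), blockDet_mul hq₂ (upper_inv u2) u3,
    blockDet_of_sub_one_mem hn₂, mul_one, hF.log_abs_mul b1 (mul_ne_zero b2 b4),
    hF.log_abs_mul b2 b4, hlog, hdet, hδ₁, hδ₂]
  ring

end WeightLimit

/-! ### Limits of the weights -/

section WeightLimit

variable {F : Type*} [Field F] [TopologicalSpace F] (hF : LocalField F)
  {r : ℕ} {d : ℕ → ℕ} {q q₁ q₂ : Fin r → ℕ}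

theorem tendsto_exp_neg_pairing {β X : Type*} [Fintype β] {L : Filter X} (l : β → ℂ)
    {f : X → β → ℝ} {a : β → ℝ} (h : ∀ x, Tendsto (fun t => f t x) L (𝓝 (a x))) :
    Tendsto (fun t => Complex.exp (-pairing l (f t))) L (𝓝 (Complex.exp (-pairing l a))) := by
  refine (Complex.continuous_exp.tendsto _).comp (Tendsto.neg ?_)
  exact tendsto_finsetSum _ fun x _ =>
    tendsto_const_nhds.mul ((Complex.continuous_ofReal.tendsto _).comp (h x))

theorem pairing_add {β : Type*} [Fintype β] (l : β → ℂ) (f g : β → ℝ) :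
    pairing l (fun x => f x + g x) = pairing l f + pairing l g := by
  simp [pairing, mul_add, Finset.sum_add_distrib]

theorem pairing_sub {β : Type*} [Fintype β] (l : β → ℂ) (f g : β → ℝ) :
    pairing l (fun x => f x - g x) = pairing l f - pairing l g := by
  simp [pairing, mul_sub, Finset.sum_sub_distrib]

/-- The limit of the weight at a Richardson element, with the explicit exponents. -/
theorem tendsto_weight_aux (hq₁ : q₁.Injective) (hq₂ : q₂.Injective) {p₀ : GL (StdIndex r d) F}
    (hp₀ : (p₀ : Matrix (StdIndex r d) (StdIndex r d) F) ∈ upper F (q₁ ∘ stdLevel r d))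
    (l : Fin r → ℂ) :
    Tendsto (fun z => (∏ α : Fin r × Fin r with q₂ α.1 < q₂ α.2 ∧ q₁ α.2 < q₁ α.1,
        rootFactor hF α (stdExponent d α.1 α.2) l z) *
      Complex.exp (-pairing l (iwasawaH hF (stdLevel r d) (ofHeight F (q₂ ∘ stdLevel r d))
        (unipSol (stdLevel r d) (ofHeight F (q₁ ∘ stdLevel r d)) z
          ((p₀ : Matrix (StdIndex r d) (StdIndex r d) F) * richardsonElt F d hq₁ *
            ((p₀⁻¹ : GL (StdIndex r d) F) : Matrix _ _ F))))))
      (𝓝[regular F (Fin r)] 0)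
      (𝓝 (Complex.exp (-pairing l fun x => Real.log (hF.abs (blockDet (stdLevel r d) x
          (p₀ : Matrix (StdIndex r d) (StdIndex r d) F))) +
        iwasawaH hF (stdLevel r d) (ofHeight F (q₂ ∘ stdLevel r d))
          (permGL F (stdPerm hq₂) * (permGL F (stdPerm hq₁))⁻¹ * p₀⁻¹) x))) := by
  have := hF.isTopologicalDivisionRing
  have := hF.t2Space
  set Y := (p₀ : Matrix (StdIndex r d) (StdIndex r d) F) * richardsonElt F d hq₁ *
            ((p₀⁻¹ : GL (StdIndex r d) F) : Matrix _ _ F) with hYdef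
  have hY : Y ∈ strictUpper F (q₁ ∘ stdLevel r d) :=
    strictUpper_mul_upper (upper_mul_strictUpper hp₀ (richardsonElt_mem hq₁)) (upper_inv hp₀)
  obtain ⟨p, hpc, hp0, hp⟩ := exists_continuous_intertwiner hq₁ hp₀
  have hcont : ∀ q : Fin r → ℕ, Continuous fun z : Fin r → F =>
      (newtonCoeff q z : Matrix (StdIndex r d) (StdIndex r d) F) := continuous_newtonCoeff
  have hdet : ∀ g : GL (StdIndex r d) F,
      (g : Matrix (StdIndex r d) (StdIndex r d) F).det ≠ 0 := fun g =>
    isUnit_iff_ne_zero.1 ((Matrix.isUnit_iff_isUnit_det _).1 g.isUnit)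
  have hev : ∀ {A : (Fin r → F) → Matrix (StdIndex r d) (StdIndex r d) F}, Continuous A →
      (A 0).det ≠ 0 → ∀ᶠ z in 𝓝[regular F (Fin r)] 0, IsUnit (A z) := by
    intro A hA h0
    have h1 : ∀ᶠ z in 𝓝 (0 : Fin r → F), (A z).det ≠ 0 :=
      (hA.matrix_det.tendsto 0).eventually_ne h0
    filter_upwards [nhdsWithin_le_nhds h1] with z hz
    exact (Matrix.isUnit_iff_isUnit_det _).2 (isUnit_iff_ne_zero.2 hz)
  have hC₁0 : (newtonCoeff q₁ 0 : Matrix (StdIndex r d) (StdIndex r d) F).det ≠ 0 := by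
    rw [newtonCoeff_zero hq₁]
    exact hdet _
  have hC₂0 : (newtonCoeff q₂ 0 : Matrix (StdIndex r d) (StdIndex r d) F).det ≠ 0 := by
    rw [newtonCoeff_zero hq₂]
    exact hdet _
  have hp0' : (p 0).det ≠ 0 := by
    rw [hp0]
    exact hdet _
  classical
  -- the regular part of the Iwasawa decomposition
  let f : (Fin r → F) → GL (StdIndex r d) F := fun z =>
    if h : IsUnit (newtonCoeff q₂ z * (newtonCoeff q₁ z)⁻¹ * (p z)⁻¹ :
      Matrix (StdIndex r d) (StdIndex r d) F) then h.unit else 1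
  have hlim : ∀ x, Tendsto (fun z => Real.log (hF.abs (blockDet (stdLevel r d) x (p z))) +
      iwasawaH hF (stdLevel r d) (ofHeight F (q₂ ∘ stdLevel r d)) (f z) x)
      (𝓝[regular F (Fin r)] 0) (𝓝 (Real.log (hF.abs (blockDet (stdLevel r d) x
          (p₀ : Matrix (StdIndex r d) (StdIndex r d) F))) +
        iwasawaH hF (stdLevel r d) (ofHeight F (q₂ ∘ stdLevel r d))
          (permGL F (stdPerm hq₂) * (permGL F (stdPerm hq₁))⁻¹ * p₀⁻¹) x)) := by
    intro x
    refine Tendsto.add ?_ (tendsto_iwasawaH hF hq₂ ?_ x)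
    · have h1 : Tendsto (fun z => hF.abs (blockDet (stdLevel r d) x (p z)))
          (𝓝[regular F (Fin r)] 0) (𝓝 (hF.abs (blockDet (stdLevel r d) x (p 0)))) :=
        ((hF.continuous_abs.comp ((hF.continuous_blockDet x).comp hpc)).tendsto 0).mono_left
          nhdsWithin_le_nhds
      rw [hp0] at h1
      exact h1.log (hF.abs_pos (blockDet_ne_zero hq₁ hp₀ x)).ne'
    · have h1 : Tendsto (fun z => (newtonCoeff q₂ z * (newtonCoeff q₁ z)⁻¹ * (p z)⁻¹ :
          Matrix (StdIndex r d) (StdIndex r d) F)) (𝓝[regular F (Fin r)] 0)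
          (𝓝 (newtonCoeff q₂ 0 * (newtonCoeff q₁ 0)⁻¹ * (p 0)⁻¹)) :=
        ((((hcont q₂).tendsto 0).mul (tendsto_matrix_inv ((hcont q₁).tendsto 0) hC₁0)).mul
          (tendsto_matrix_inv (hpc.tendsto 0) hp0')).mono_left nhdsWithin_le_nhds
      rw [newtonCoeff_zero hq₁, newtonCoeff_zero hq₂, hp0, ← Matrix.coe_units_inv,
        ← Matrix.coe_units_inv, ← Units.val_mul, ← Units.val_mul] at h1
      refine h1.congr' ?_
      filter_upwards [hev (hcont q₁) hC₁0, hev (hcont q₂) hC₂0, hev hpc hp0'] with z h1 h2 h3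
      have h4 : IsUnit (newtonCoeff q₂ z * (newtonCoeff q₁ z)⁻¹ * (p z)⁻¹ :
          Matrix (StdIndex r d) (StdIndex r d) F) :=
        (h2.mul (Matrix.isUnit_nonsing_inv_iff.2 h1)).mul (Matrix.isUnit_nonsing_inv_iff.2 h3)
      simp only [f, dif_pos h4]
      rfl
  refine (tendsto_exp_neg_pairing l hlim).congr' ?_
  filter_upwards [hev (hcont q₁) hC₁0, hev (hcont q₂) hC₂0, hev hpc hp0',
    self_mem_nhdsWithin] with z h1 h2 h3 hz
  obtain ⟨C₁, hC₁⟩ := h1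
  obtain ⟨C₂, hC₂⟩ := h2
  obtain ⟨P, hP⟩ := h3
  have hfz : f z = C₂ * C₁⁻¹ * P⁻¹ := by
    have h4 : (newtonCoeff q₂ z * (newtonCoeff q₁ z)⁻¹ * (p z)⁻¹ :
          Matrix (StdIndex r d) (StdIndex r d) F) =
        ((C₂ * C₁⁻¹ * P⁻¹ : GL (StdIndex r d) F) : Matrix (StdIndex r d) (StdIndex r d) F) := by
      rw [Units.val_mul, Units.val_mul, Matrix.coe_units_inv, Matrix.coe_units_inv, hC₁, hC₂, hP]
    refine Units.ext ?_
    simp only [f]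
    rw [dif_pos (h4 ▸ Units.isUnit _)]
    exact h4
  have hH : iwasawaH hF (stdLevel r d) (ofHeight F (q₂ ∘ stdLevel r d))
        (unipSol (stdLevel r d) (ofHeight F (q₁ ∘ stdLevel r d)) z Y) = fun x =>
      (Real.log (hF.abs (blockDet (stdLevel r d) x (p z))) +
        iwasawaH hF (stdLevel r d) (ofHeight F (q₂ ∘ stdLevel r d)) (f z) x) +
      ((∑ u, if q₁ u < q₁ x then
          (stdExponent d x u : ℝ) * Real.log (hF.abs (z x - z u)) else 0) -
        ∑ u, if q₂ u < q₂ x then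
          (stdExponent d x u : ℝ) * Real.log (hF.abs (z x - z u)) else 0) := by
    funext x
    rw [iwasawaH_unipSol hF hq₁ hq₂ hz hY (p := P) (by rw [hP]; exact (hp z).1)
      (by rw [hP]; exact (hp z).2) hC₁ hC₂ x, log_abs_blockDet_newtonDiag hF q₁ hz,
      log_abs_blockDet_newtonDiag hF q₂ hz, hP, hfz]
    ring
  have hprod : ∏ α : Fin r × Fin r with q₂ α.1 < q₂ α.2 ∧ q₁ α.2 < q₁ α.1,
        rootFactor hF α (stdExponent d α.1 α.2) l z =
      Complex.exp (pairing l fun x => (∑ u, if q₁ u < q₁ x then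
          (stdExponent d x u : ℝ) * Real.log (hF.abs (z x - z u)) else 0) -
        ∑ u, if q₂ u < q₂ x then
          (stdExponent d x u : ℝ) * Real.log (hF.abs (z x - z u)) else 0) := by
    rw [← sum_roots_eq q₁ q₂ l
      (fun x u => (stdExponent d x u : ℝ) * Real.log (hF.abs (z x - z u)))
      (fun x u => by rw [stdExponent_comm, hF.abs_sub_comm]) hq₁ hq₂, Complex.exp_sum]
    refine Finset.prod_congr rfl fun α hα => ?_
    have hα' : q₂ α.1 < q₂ α.2 ∧ q₁ α.2 < q₁ α.1 := by simpa using hα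
    exact rootFactor_eq_exp hF α _ l hz fun h => by rw [h] at hα'; exact lt_irrefl _ hα'.1
  rw [hprod, hH, ← Complex.exp_add]
  simp only [pairing_add, pairing_sub]
  congr 1
  ring

end WeightLimit

/-! ### Matrices supported in one block -/

section MatrixUnits

variable {F A : Type*} [Field F] [Ring A] [Algebra F A]

/-- The `2 × 2` matrix `(t u; v w)` acting through the matrix units `e, y', y, f`, and trivially on
the complement. -/
def unitComb (e y' y f : A) (t u v w : F) : A := 1 + (t - 1) • e + u • y' + v • y + (w - 1) • f

theorem unitComb_one (e y' y f : A) : unitComb e y' y f (1 : F) 0 0 1 = 1 := by simp [unitComb]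

theorem unitComb_mul {e y' y f : A} (h11 : e * e = e) (h12 : e * y' = y') (h13 : e * y = 0)
    (h14 : e * f = 0) (h21 : y' * e = 0) (h22 : y' * y' = 0) (h23 : y' * y = e)
    (h24 : y' * f = y') (h31 : y * e = y) (h32 : y * y' = f) (h33 : y * y = 0) (h34 : y * f = 0)
    (h41 : f * e = 0) (h42 : f * y' = 0) (h43 : f * y = y) (h44 : f * f = f)
    (t u v w t' u' v' w' : F) :
    unitComb e y' y f t u v w * unitComb e y' y f t' u' v' w' =
      unitComb e y' y f (t * t' + u * v') (t * u' + u * w') (v * t' + w * v')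
        (v * u' + w * w') := by
  simp only [unitComb, mul_add, add_mul, mul_one, one_mul, smul_mul_assoc, mul_smul_comm, h11, h12,
    h13, h14, h21, h22, h23, h24, h31, h32, h33, h34, h41, h42, h43, h44, smul_zero]
  module

end MatrixUnits

section BlockFactorization

variable {F : Type*} [Field F] {ι β : Type*} [Fintype ι] [DecidableEq ι] [Fintype β]
  [DecidableEq β]

/-- A factorization `Y = BC` through `F^s`, with `s` the rank, of a matrix which is supported in the
rows of the block `b'` and the columns of the block `b`; the left inverse `B'` of `B` and the right
inverse `C'` of `C` are part of the data. -/
structure BlockFactorization (c : ι → β) (b b' : β) (Y : Matrix ι ι F) (s : ℕ) where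
  B : Matrix ι (Fin s) F
  B' : Matrix (Fin s) ι F
  C : Matrix (Fin s) ι F
  C' : Matrix ι (Fin s) F
  eq_mul : Y = B * C
  left_inv : B' * B = 1
  right_inv : C * C' = 1
  B_eq_zero : ∀ a i, c a ≠ b' → B a i = 0
  B'_eq_zero : ∀ a i, c a ≠ b' → B' i a = 0
  C_eq_zero : ∀ a i, c a ≠ b → C i a = 0
  C'_eq_zero : ∀ a i, c a ≠ b → C' a i = 0

theorem exists_rank_factorization (Y : Matrix ι ι F) :
    ∃ (s : ℕ) (B : Matrix ι (Fin s) F) (B' : Matrix (Fin s) ι F) (C : Matrix (Fin s) ι F)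
      (C' : Matrix ι (Fin s) F), Y = B * C ∧ B' * B = 1 ∧ C * C' = 1 := by
  let f := Matrix.toLin' Y
  let e := (Module.finBasis F (LinearMap.range f)).equivFun
  let g : (Fin (Module.finrank F (LinearMap.range f)) → F) →ₗ[F] (ι → F) :=
    (LinearMap.range f).subtype ∘ₗ e.symm.toLinearMap
  let h : (ι → F) →ₗ[F] (Fin (Module.finrank F (LinearMap.range f)) → F) :=
    e.toLinearMap ∘ₗ f.rangeRestrict
  obtain ⟨g', hg'⟩ := g.exists_leftInverse_of_injective (LinearMap.ker_eq_bot.2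
    ((Submodule.subtype_injective _).comp e.symm.injective))
  obtain ⟨h', hh'⟩ := h.exists_rightInverse_of_surjective (LinearMap.range_eq_top.2
    (e.surjective.comp f.surjective_rangeRestrict))
  have hgh : g ∘ₗ h = f := by
    ext v
    simp [g, h]
  refine ⟨_, LinearMap.toMatrix' g, LinearMap.toMatrix' g', LinearMap.toMatrix' h,
    LinearMap.toMatrix' h', ?_, ?_, ?_⟩
  · rw [← LinearMap.toMatrix'_comp, hgh]
    simp [f]
  · rw [← LinearMap.toMatrix'_comp, hg', LinearMap.toMatrix'_id]
  · rw [← LinearMap.toMatrix'_comp, hh', LinearMap.toMatrix'_id]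

variable {c : ι → β} {b b' : β} {Y : Matrix ι ι F}

theorem exists_blockFactorization (hY : ∀ a a', Y a a' ≠ 0 → c a = b' ∧ c a' = b) :
    ∃ s, Nonempty (BlockFactorization c b b' Y s) := by
  obtain ⟨s, B, B', C, C', hBC, hB, hC⟩ := exists_rank_factorization Y
  have hBY : B = Y * C' := by rw [hBC, Matrix.mul_assoc, hC, Matrix.mul_one]
  have hCY : C = B' * Y := by rw [hBC, ← Matrix.mul_assoc, hB, Matrix.one_mul]
  have hB0 : ∀ a i, c a ≠ b' → B a i = 0 := by
    intro a i ha
    rw [hBY, Matrix.mul_apply]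
    refine Finset.sum_eq_zero fun x _ => ?_
    rw [not_not.1 fun h => ha (hY a x h).1, zero_mul]
  have hC0 : ∀ a i, c a ≠ b → C i a = 0 := by
    intro a i ha
    rw [hCY, Matrix.mul_apply]
    refine Finset.sum_eq_zero fun x _ => ?_
    rw [not_not.1 fun h => ha (hY x a h).2, mul_zero]
  refine ⟨s, ⟨B, Matrix.of fun i a => if c a = b' then B' i a else 0, C,
    Matrix.of fun a i => if c a = b then C' a i else 0, hBC, ?_, ?_, hB0, ?_, hC0, ?_⟩⟩
  · rw [← hB]
    ext i j
    rw [Matrix.mul_apply, Matrix.mul_apply]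
    refine Finset.sum_congr rfl fun a _ => ?_
    rw [Matrix.of_apply]
    split_ifs with h
    · rfl
    · rw [hB0 a j h, mul_zero, mul_zero]
  · rw [← hC]
    ext i j
    rw [Matrix.mul_apply, Matrix.mul_apply]
    refine Finset.sum_congr rfl fun a _ => ?_
    rw [Matrix.of_apply]
    split_ifs with h
    · rfl
    · rw [hC0 a i h, zero_mul, zero_mul]
  · exact fun a i h => if_neg h
  · exact fun a i h => if_neg h

theorem sum_block_subtype {M : Type*} [AddCommMonoid M] (x : β) (f : ι → M)
    (hf : ∀ a, c a ≠ x → f a = 0) : ∑ a : {a // c a = x}, f a = ∑ a, f a := by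
  rw [← Finset.sum_subtype (Finset.univ.filter fun a => c a = x) (by simp) f]
  refine Finset.sum_subset (Finset.filter_subset _ _) fun a _ ha => hf a fun h => ha (by simp [h])

/-- If `VU = 1` and `U` is supported in the block `x`, then `1 + (t - 1)UV` has on this block the
eigenvalue `t` with multiplicity `s`, and otherwise the eigenvalue `1`. -/
theorem blockDet_one_add {s : ℕ} {x : β} {U : Matrix ι (Fin s) F} {V : Matrix (Fin s) ι F}
    (hVU : V * U = 1) (hU : ∀ a i, c a ≠ x → U a i = 0) (t : F) :
    blockDet c x (1 + (t - 1) • (U * V)) = t ^ s := by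
  have h1 : (1 + (t - 1) • (U * V)).toSquareBlock c x =
      1 + (U.submatrix (Subtype.val : {a // c a = x} → ι) id) *
        ((t - 1) • V.submatrix id (Subtype.val : {a // c a = x} → ι)) := by
    ext ⟨a, ha⟩ ⟨a', ha'⟩
    simp only [Matrix.toSquareBlock_def, Matrix.of_apply, Matrix.add_apply, Matrix.smul_apply,
      Matrix.mul_apply, Matrix.submatrix_apply, id, Matrix.one_apply, smul_eq_mul,
      Subtype.mk.injEq, Finset.mul_sum]
    congr 1
    exact Finset.sum_congr rfl fun i _ => by ring
  have h2 : ((t - 1) • V.submatrix id (Subtype.val : {a // c a = x} → ι)) *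
      (U.submatrix (Subtype.val : {a // c a = x} → ι) id) =
        (t - 1) • (1 : Matrix (Fin s) (Fin s) F) := by
    rw [← hVU]
    ext i j
    simp only [Matrix.mul_apply, Matrix.smul_apply, Matrix.submatrix_apply, id, smul_eq_mul,
      Finset.mul_sum]
    rw [sum_block_subtype x (fun a => (t - 1) * V i a * U a j)
      fun a ha => by rw [hU a j ha, mul_zero]]
    exact Finset.sum_congr rfl fun i _ => by ring
  have h3 : (1 : Matrix (Fin s) (Fin s) F) + (t - 1) • 1 = t • 1 := by
    rw [sub_smul, one_smul]
    abel
  rw [blockDet, h1, Matrix.det_one_add_mul_comm, h2, h3, Matrix.det_smul, Matrix.det_one, mul_one,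
    Fintype.card_fin]

theorem le_card_block {s : ℕ} {x : β} {U : Matrix ι (Fin s) F} {V : Matrix (Fin s) ι F}
    (hVU : V * U = 1) (hU : ∀ a i, c a ≠ x → U a i = 0) : s ≤ Fintype.card {a // c a = x} := by
  have h2 : (V.submatrix id (Subtype.val : {a // c a = x} → ι)) *
      (U.submatrix (Subtype.val : {a // c a = x} → ι) id) = (1 : Matrix (Fin s) (Fin s) F) := by
    rw [← hVU]
    ext i j
    simp only [Matrix.mul_apply, Matrix.submatrix_apply, id]
    rw [sum_block_subtype x (fun a => V i a * U a j) fun a ha => by rw [hU a j ha, mul_zero]]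
  have h3 := Matrix.rank_mul_le_left (V.submatrix id (Subtype.val : {a // c a = x} → ι))
    (U.submatrix (Subtype.val : {a // c a = x} → ι) id)
  rw [h2, Matrix.rank_one, Fintype.card_fin] at h3
  exact h3.trans (Matrix.rank_le_card_width _)

/-- A matrix of maximal rank supported in the block `(b', b)`. -/
theorem exists_blockFactorization_of_le {s : ℕ} (hb : s ≤ Fintype.card {a // c a = b})
    (hb' : s ≤ Fintype.card {a // c a = b'}) :
    ∃ Y : Matrix ι ι F, Nonempty (BlockFactorization c b b' Y s) := by
  obtain ⟨f⟩ : Nonempty (Fin s ↪ {a // c a = b}) :=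
    Function.Embedding.nonempty_of_card_le (by simpa using hb)
  obtain ⟨g⟩ : Nonempty (Fin s ↪ {a // c a = b'}) :=
    Function.Embedding.nonempty_of_card_le (by simpa using hb')
  have key : ∀ {x : β} (h : Fin s ↪ {a // c a = x}),
      ((Matrix.of fun i a => if a = h i then 1 else 0 : Matrix (Fin s) ι F) *
        (Matrix.of fun a i => if a = h i then 1 else 0 : Matrix ι (Fin s) F)) = 1 := by
    intro x h
    ext i j
    simp [Matrix.mul_apply, Matrix.one_apply, Subtype.val_injective.eq_iff, eq_comm]
  have hne : ∀ {x : β} (h : Fin s ↪ {a // c a = x}) (a : ι) (i : Fin s), c a ≠ x →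
      (if a = h i then (1 : F) else 0) = 0 := fun h a i ha =>
    if_neg fun h' : a = h i => ha (h' ▸ (h i).2)
  exact ⟨_, ⟨⟨Matrix.of fun a i => if a = g i then 1 else 0,
    Matrix.of fun i a => if a = g i then 1 else 0, Matrix.of fun i a => if a = f i then 1 else 0,
    Matrix.of fun a i => if a = f i then 1 else 0, rfl, key g, key f,
    hne g, hne g, hne f, hne f⟩⟩⟩

namespace BlockFactorization

variable {s : ℕ} (D : BlockFactorization c b b' Y s)

theorem le_card_left (D : BlockFactorization c b b' Y s) : s ≤ Fintype.card {a // c a = b} :=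
  le_card_block D.right_inv D.C'_eq_zero

theorem le_card_right (D : BlockFactorization c b b' Y s) : s ≤ Fintype.card {a // c a = b'} :=
  le_card_block D.left_inv D.B_eq_zero

theorem support (D : BlockFactorization c b b' Y s) {a a' : ι} (h : Y a a' ≠ 0) :
    c a = b' ∧ c a' = b := by
  rw [D.eq_mul, Matrix.mul_apply] at h
  obtain ⟨i, -, hi⟩ := Finset.exists_ne_zero_of_sum_ne_zero h
  exact ⟨not_not.1 fun h' => hi (by rw [D.B_eq_zero a i h', zero_mul]),
    not_not.1 fun h' => hi (by rw [D.C_eq_zero a' i h', mul_zero])⟩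

/-- The combinations of the four matrix units of the factorization. -/
def comb (t u v w : F) : Matrix ι ι F :=
  unitComb (D.C' * D.C) (D.C' * D.B') (D.B * D.C) (D.B * D.B') t u v w

theorem comb_mul (hbb : b ≠ b') (t u v w t' u' v' w' : F) :
    D.comb t u v w * D.comb t' u' v' w' =
      D.comb (t * t' + u * v') (t * u' + u * w') (v * t' + w * v') (v * u' + w * w') := by
  have hCB : D.C * D.B = 0 := by
    ext i j
    rw [Matrix.mul_apply]
    refine Finset.sum_eq_zero fun a _ => ?_
    by_cases h : c a = b
    · rw [D.B_eq_zero a j (h ▸ hbb), mul_zero]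
    · rw [D.C_eq_zero a i h, zero_mul]
  have hBC : D.B' * D.C' = 0 := by
    ext i j
    rw [Matrix.mul_apply]
    refine Finset.sum_eq_zero fun a _ => ?_
    by_cases h : c a = b
    · rw [D.B'_eq_zero a i (h ▸ hbb), zero_mul]
    · rw [D.C'_eq_zero a j h, mul_zero]
  have key : ∀ (U U' : Matrix ι (Fin s) F) (V V' : Matrix (Fin s) ι F),
      (U * V) * (U' * V') = U * (V * U') * V' := fun U U' V V' => by simp only [Matrix.mul_assoc]
  refine unitComb_mul ?_ ?_ ?_ ?_ ?_ ?_ ?_ ?_ ?_ ?_ ?_ ?_ ?_ ?_ ?_ ?_ _ _ _ _ _ _ _ _ <;>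
    simp only [key, hCB, hBC, D.left_inv, D.right_inv, Matrix.mul_one, Matrix.mul_zero,
      Matrix.zero_mul]

theorem comb_one : D.comb 1 0 0 1 = 1 := unitComb_one _ _ _ _

/-- Matrices `comb t u v w` of determinant one, as elements of `GL`. -/
def combGL (hbb : b ≠ b') (t u v w : F) (h : t * w - u * v = 1) : GL ι F :=
  ⟨D.comb t u v w, D.comb w (-u) (-v) t,
    by rw [D.comb_mul hbb, ← D.comb_one]; congr 1 <;> first | linear_combination h | ring,
    by rw [D.comb_mul hbb, ← D.comb_one]; congr 1 <;> first | linear_combination h | ring⟩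

end BlockFactorization

end BlockFactorization

/-! ### The exponents `ρ(α)` -/

section BlockDet

variable {F : Type*} [Field F] {ι β : Type*} [Fintype ι] [DecidableEq ι] [Fintype β]
  [DecidableEq β] {c : ι → β} {b b' : β} {Y : Matrix ι ι F} {s : ℕ}

namespace BlockFactorization

theorem comb_apply (D : BlockFactorization c b b' Y s) (t u v w : F) (a a' : ι) :
    D.comb t u v w a a' = (1 : Matrix ι ι F) a a' + (t - 1) * (D.C' * D.C) a a' +
      u * (D.C' * D.B') a a' + v * (D.B * D.C) a a' + (w - 1) * (D.B * D.B') a a' := by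
  simp [comb, unitComb]

theorem mul_apply_eq_zero {x y : β} {U : Matrix ι (Fin s) F} {V : Matrix (Fin s) ι F}
    (hU : ∀ a i, c a ≠ x → U a i = 0) (hV : ∀ a i, c a ≠ y → V i a = 0) {a a' : ι}
    (h : c a ≠ x ∨ c a' ≠ y) : (U * V) a a' = 0 := by
  rw [Matrix.mul_apply]
  refine Finset.sum_eq_zero fun i _ => ?_
  rcases h with h | h
  · rw [hU a i h, zero_mul]
  · rw [hV a' i h, mul_zero]

theorem blockDet_comb (D : BlockFactorization c b b' Y s) (hbb : b ≠ b') (t u v w : F) (x : β) :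
    blockDet c x (D.comb t u v w) = if x = b then t ^ s else if x = b' then w ^ s else 1 := by
  split_ifs with h1 h2
  · subst h1
    rw [← blockDet_one_add D.right_inv D.C'_eq_zero t]
    refine blockDet_congr fun a a' ha ha' => ?_
    rw [comb_apply, mul_apply_eq_zero D.C'_eq_zero D.B'_eq_zero (Or.inr (ha' ▸ hbb)),
      mul_apply_eq_zero D.B_eq_zero D.C_eq_zero (Or.inl (ha ▸ hbb)),
      mul_apply_eq_zero D.B_eq_zero D.B'_eq_zero (Or.inl (ha ▸ hbb))]
    simp
  · subst h2
    rw [← blockDet_one_add D.left_inv D.B_eq_zero w]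
    refine blockDet_congr fun a a' ha ha' => ?_
    rw [comb_apply, mul_apply_eq_zero D.C'_eq_zero D.B'_eq_zero (Or.inl (ha ▸ h1)),
      mul_apply_eq_zero D.B_eq_zero D.C_eq_zero (Or.inr (ha' ▸ h1)),
      mul_apply_eq_zero D.C'_eq_zero D.C_eq_zero (Or.inl (ha ▸ h1))]
    simp
  · rw [← blockDet_one (F := F) (c := c) x]
    refine blockDet_congr fun a a' ha ha' => ?_
    rw [comb_apply, mul_apply_eq_zero D.C'_eq_zero D.B'_eq_zero (Or.inl (ha ▸ h1)),
      mul_apply_eq_zero D.B_eq_zero D.C_eq_zero (Or.inr (ha' ▸ h1)),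
      mul_apply_eq_zero D.C'_eq_zero D.C_eq_zero (Or.inl (ha ▸ h1)),
      mul_apply_eq_zero D.B_eq_zero D.B'_eq_zero (Or.inl (ha ▸ h2))]
    simp

theorem comb_mem_upper (D : BlockFactorization c b b' Y s) {q : β → ℕ} (hq : q b < q b')
    (t u w : F) : D.comb t u 0 w ∈ upper F (q ∘ c) := by
  intro a a' h
  have h' : q (c a') < q (c a) := h
  have key : ∀ {x y : β}, q x ≤ q y → c a ≠ x ∨ c a' ≠ y := by
    intro x y hxy
    by_contra hne
    push Not at hne
    rw [hne.1, hne.2] at h'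
    omega
  rw [comb_apply, mul_apply_eq_zero D.C'_eq_zero D.B'_eq_zero (key hq.le),
      mul_apply_eq_zero D.C'_eq_zero D.C_eq_zero (key le_rfl),
      mul_apply_eq_zero D.B_eq_zero D.B'_eq_zero (key le_rfl), Matrix.one_apply_ne]
  · ring
  · rintro rfl
    exact lt_irrefl _ h'

variable [TopologicalSpace F] (hF : LocalField F)

/-- The weight of a matrix `Y` supported in the block `(b', b)`. With `τ = z_{b'} - z_b`, the solution
`n = 1 + τ⁻¹Y` corresponds to the matrix `(1 0; τ⁻¹ 1) = (τ 1; 0 τ⁻¹) (0 -1; 1 τ)`, the product of an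
element of `P₂` and a family which extends to `τ = 0`. -/
theorem iwasawaH_unipSol (D : BlockFactorization c b b' Y s) {q₁ q₂ : β → ℕ}
    (hq₂ : q₂.Injective) (h₁ : q₁ b' < q₁ b) (h₂ : q₂ b < q₂ b') (hbb : b ≠ b') {z : β → F}
    (hz : z ∈ regular F β) (x : β) :
    iwasawaH hF c (ofHeight F (q₂ ∘ c)) (unipSol c (ofHeight F (q₁ ∘ c)) z Y) x =
      iwasawaH hF c (ofHeight F (q₂ ∘ c))
        (D.combGL hbb 0 (-1) 1 (z b' - z b) (by ring)) x +
      ((if x = b then (s : ℝ) * Real.log (hF.abs (z b - z b')) else 0) -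
        if x = b' then (s : ℝ) * Real.log (hF.abs (z b - z b')) else 0) := by
  have hτ : z b' - z b ≠ 0 := hz _ _ hbb.symm
  set τ := z b' - z b with hτdef
  have hYn : Y ∈ strictUpper F (q₁ ∘ c) := by
    intro a a' h
    by_contra hne
    obtain ⟨ha, ha'⟩ := D.support hne
    simp only [Function.comp_apply, ha, ha'] at h
    omega
  have hcomb : D.comb 1 0 τ⁻¹ 1 = 1 + τ⁻¹ • Y := by
    rw [comb, unitComb, ← D.eq_mul]
    simp
  have hZY : center c z * Y = z b' • Y := by
    ext a a'
    rw [center, Matrix.diagonal_mul, Matrix.smul_apply, smul_eq_mul]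
    by_cases h : Y a a' = 0
    · rw [h, mul_zero, mul_zero]
    · rw [(D.support h).1]
  have hYZ : Y * center c z = z b • Y := by
    ext a a'
    rw [center, Matrix.mul_diagonal, Matrix.smul_apply, smul_eq_mul]
    by_cases h : Y a a' = 0
    · rw [h, zero_mul, mul_zero]
    · rw [(D.support h).2, mul_comm]
  have hYY : Y * Y = 0 := by
    ext a a'
    rw [Matrix.mul_apply]
    refine Finset.sum_eq_zero fun y _ => ?_
    by_contra h
    exact hbb ((D.support (left_ne_zero_of_mul h)).2.symm.trans
      (D.support (right_ne_zero_of_mul h)).1)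
  have hsol : unipSol c (ofHeight F (q₁ ∘ c)) z Y =
      D.combGL hbb τ 1 0 τ⁻¹ (by rw [mul_inv_cancel₀ hτ]; ring) *
        D.combGL hbb 0 (-1) 1 τ (by ring) := by
    have hval : ((D.combGL hbb τ 1 0 τ⁻¹ (by rw [mul_inv_cancel₀ hτ]; ring) *
        D.combGL hbb 0 (-1) 1 τ (by ring) : GL ι F) : Matrix ι ι F) = 1 + τ⁻¹ • Y := by
      rw [← hcomb]
      change D.comb τ 1 0 τ⁻¹ * D.comb 0 (-1) 1 τ = _
      rw [D.comb_mul hbb]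
      congr 1
      · ring
      · ring
      · ring
      · rw [inv_mul_cancel₀ hτ]; ring
    refine unipSol_eq hz hYn ?_ ?_
    · rw [hval, add_sub_cancel_left]
      exact (strictUpper F _).smul_mem _ hYn
    · rw [hval, mul_add, mul_one, add_mul, one_mul, mul_smul_comm, hZY, smul_mul_assoc, mul_add,
        hYZ, hYY, add_zero, smul_smul, smul_smul, add_assoc, add_right_inj]
      have h1 : τ⁻¹ * z b' = 1 + τ⁻¹ * z b := by
        have h2 := inv_mul_cancel₀ hτ
        rw [hτdef, mul_sub, ← hτdef] at h2
        linear_combination h2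
      rw [h1, add_smul, one_smul]
  have hlog : Real.log (hF.abs τ) = Real.log (hF.abs (z b - z b')) := by rw [hF.abs_sub_comm]
  have hpow : ∀ {t : F}, t ≠ 0 → Real.log (hF.abs (t ^ s)) = s * Real.log (hF.abs t) := by
    intro t ht
    have := hF.log_abs_prod (Finset.univ : Finset (Fin s)) (fun _ => t) fun _ _ => ht
    simpa using this
  have hinv : Real.log (hF.abs τ⁻¹) = - Real.log (hF.abs τ) := by
    have := hF.log_abs_mul hτ (inv_ne_zero hτ)
    rw [mul_inv_cancel₀ hτ, hF.abs_one, Real.log_one] at this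
    linarith
  rw [hsol, iwasawaH_upper_mul hF hq₂ (D.comb_mem_upper h₂ _ _ _), add_comm]
  congr 1
  change Real.log (hF.abs (blockDet c x (D.comb τ 1 0 τ⁻¹))) = _
  rw [D.blockDet_comb hbb]
  by_cases h1 : x = b
  · have h2 : x ≠ b' := fun h => hbb (h1.symm.trans h)
    rw [if_pos h1, if_pos h1, if_neg h2, hpow hτ, hlog, sub_zero]
  · rw [if_neg h1, if_neg h1]
    by_cases h2 : x = b'
    · rw [if_pos h2, if_pos h2, hpow (inv_ne_zero hτ), hinv, hlog]
      ring
    · rw [if_neg h2, if_neg h2, hF.abs_one, Real.log_one, sub_zero]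

/-- After multiplication by `|α(Z)|^(s⟨λ, α^∨⟩)`, with `s` the rank of `Y`, the weight of `Y` has a
nonzero limit. -/
theorem tendsto_weight (D : BlockFactorization c b b' Y s) {q₁ q₂ : β → ℕ}
    (hq₂ : q₂.Injective) (h₁ : q₁ b' < q₁ b) (h₂ : q₂ b < q₂ b') (hbb : b ≠ b') (l : β → ℂ) :
    Tendsto (fun z => rootFactor hF (b, b') s l z * Complex.exp (-pairing l
        (iwasawaH hF c (ofHeight F (q₂ ∘ c)) (unipSol c (ofHeight F (q₁ ∘ c)) z Y))))
      (𝓝[regular F β] 0) (𝓝 (Complex.exp (-pairing l (iwasawaH hF c (ofHeight F (q₂ ∘ c))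
        (D.combGL hbb 0 (-1) 1 0 (by ring)))))) := by
  have := hF.isTopologicalDivisionRing
  have hlim : ∀ x, Tendsto (fun z : β → F => iwasawaH hF c (ofHeight F (q₂ ∘ c))
        (D.combGL hbb 0 (-1) 1 (z b' - z b) (by ring)) x) (𝓝[regular F β] 0)
      (𝓝 (iwasawaH hF c (ofHeight F (q₂ ∘ c)) (D.combGL hbb 0 (-1) 1 0 (by ring)) x)) := by
    refine fun x => tendsto_iwasawaH hF hq₂ ?_ x
    have hc : Continuous fun z : β → F => D.comb 0 (-1) 1 (z b' - z b) := by
      refine continuous_matrix fun a a' => ?_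
      simp only [comb_apply]
      fun_prop
    have h := (hc.tendsto 0).mono_left (nhdsWithin_le_nhds (s := regular F β))
    simp only [Pi.zero_apply, sub_zero] at h
    exact h
  refine (tendsto_exp_neg_pairing l hlim).congr' ?_
  filter_upwards [self_mem_nhdsWithin] with z hz
  have hp : (pairing l fun x => (if x = b then (s : ℝ) * Real.log (hF.abs (z b - z b')) else 0) -
        if x = b' then (s : ℝ) * Real.log (hF.abs (z b - z b')) else 0) =
      ((s * Real.log (hF.abs (z b - z b')) : ℝ) : ℂ) * coroot l (b, b') := by
    rw [pairing_sub, pairing, pairing, coroot]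
    simp only [apply_ite Complex.ofReal, mul_ite, Complex.ofReal_zero, mul_zero,
      Finset.sum_ite_eq', Finset.mem_univ, if_true]
    simp
    ring
  have hH : iwasawaH hF c (ofHeight F (q₂ ∘ c)) (unipSol c (ofHeight F (q₁ ∘ c)) z Y) = _ :=
    funext fun x => D.iwasawaH_unipSol hF hq₂ h₁ h₂ hbb hz x
  rw [hH, pairing_add, hp, rootFactor_eq_exp hF (b, b') s l hz hbb, ← Complex.exp_add]
  congr 1
  ring

end BlockFactorization

end BlockDet

section Exponent

variable {F : Type*} [Field F] [TopologicalSpace F] (hF : LocalField F)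
  {ι β : Type*} [Fintype ι] [DecidableEq ι] [Fintype β] [DecidableEq β] {c : ι → β} {b b' : β}

theorem nhdsWithin_regular_neBot (F β : Type*) [Field F] [TopologicalSpace F] [Fintype β]
    (hF : LocalField F) : (𝓝[regular F β] (0 : β → F)).NeBot := by
  have := hF.charZero
  have := hF.isTopologicalDivisionRing
  obtain ⟨u, hu0, hu⟩ := hF.exists_tendsto_zero
  let e := Fintype.equivFin β
  have h1 : Tendsto (fun n => (fun x => u n * ((e x : ℕ) : F) : β → F)) atTop (𝓝 0) := by
    rw [tendsto_pi_nhds]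
    intro x
    simpa using hu.mul_const ((e x : ℕ) : F)
  refine mem_closure_iff_nhdsWithin_neBot.1 (mem_closure_of_tendsto h1 (Eventually.of_forall
    fun n x y hxy => ?_))
  rw [← mul_sub]
  refine mul_ne_zero (hu0 n) (sub_ne_zero.2 fun h => hxy (e.injective (Fin.ext ?_)))
  exact_mod_cast h

theorem rootFactor_add {α : β × β} (hα : α.1 ≠ α.2) (ρ σ : ℝ) (l : β → ℂ) {z : β → F}
    (hz : z ∈ regular F β) :
    rootFactor hF α (ρ + σ) l z = rootFactor hF α ρ l z * rootFactor hF α σ l z := by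
  rw [rootFactor_eq_exp hF α _ l hz hα, rootFactor_eq_exp hF α _ l hz hα,
    rootFactor_eq_exp hF α _ l hz hα, ← Complex.exp_add]
  congr 1
  push_cast
  ring

theorem tendsto_rootFactor_zero (α : β × β) {ρ : ℝ} (hρ : 0 < ρ) {l : β → ℂ}
    (hl : 0 < (coroot l α).re) :
    Tendsto (fun z : β → F => rootFactor hF α ρ l z) (𝓝[regular F β] 0) (𝓝 0) := by
  have := hF.isTopologicalDivisionRing
  have hre : 0 < ((ρ : ℂ) * coroot l α).re := by
    rw [Complex.re_ofReal_mul]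
    exact mul_pos hρ hl
  have h1 : Continuous fun z : β → F =>
      ((hF.abs (z α.1 - z α.2) : ℝ) : ℂ) ^ ((ρ : ℂ) * coroot l α) :=
    (Complex.continuous_ofReal_cpow_const hre).comp (hF.continuous_abs.comp (by fun_prop))
  have h2 := (h1.tendsto 0).mono_left (nhdsWithin_le_nhds (s := regular F β))
  simp only [Pi.zero_apply, sub_zero, hF.abs_zero, Complex.ofReal_zero] at h2
  rwa [Complex.zero_cpow fun h => by rw [h] at hre; exact lt_irrefl _ hre] at h2

/-- The exponent `ρ(α)` is the smaller of the sizes of the two blocks. -/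
theorem isExponent_min (hc : c.Surjective) (hbb : b ≠ b') :
    IsExponent hF c (b, b')
      ((min (Fintype.card {a // c a = b}) (Fintype.card {a // c a = b'}) : ℕ) : ℝ) := by
  have := hF.charZero
  set ρ := min (Fintype.card {a // c a = b}) (Fintype.card {a // c a = b'}) with hρ
  refine ⟨Nat.cast_nonneg _, fun P hP P' hP' hr hr' l hl => ?_⟩
  obtain ⟨q₁, hq₁, rfl⟩ := exists_height hc hP
  obtain ⟨q₂, hq₂, rfl⟩ := exists_height hc hP'
  rw [roots_ofHeight hc hq₁] at hr
  rw [roots_ofHeight hc hq₂] at hr'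
  have h₁ : q₁ b' < q₁ b := hr
  have h₂ : q₂ b < q₂ b' := hr'
  have key : ∀ Y, ∃ w : ℂ, Y ∈ (ofHeight F (q₁ ∘ c)).nil ∩ leviLie F c (b, b') →
      Tendsto (fun z => rootFactor hF (b, b') ρ l z * Complex.exp (-pairing l
        (iwasawaH hF c (ofHeight F (q₂ ∘ c)) (unipSol c (ofHeight F (q₁ ∘ c)) z Y))))
      (𝓝[regular F β] 0) (𝓝 w) := by
    intro Y
    by_cases hY : Y ∈ (ofHeight F (q₁ ∘ c)).nil ∩ leviLie F c (b, b')
    · have hsupp : ∀ a a', Y a a' ≠ 0 → c a = b' ∧ c a' = b := by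
        intro a a' h
        have h1 : q₁ (c a) < q₁ (c a') := not_le.1 fun h' => h (nil_ofHeight.1 hY.1 a a' h')
        rcases hY.2 a a' h with h2 | ⟨h2, h3⟩ | h2
        · rw [h2] at h1
          exact absurd h1 (lt_irrefl _)
        · rw [h2, h3] at h1
          exact absurd h1 (lt_asymm h₁)
        · exact h2
      obtain ⟨s, ⟨D⟩⟩ := exists_blockFactorization hsupp
      have hs : s ≤ ρ := le_min D.le_card_left D.le_card_right
      have hlim := D.tendsto_weight hF hq₂ h₁ h₂ hbb l
      rcases eq_or_lt_of_le hs with h | h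
      · exact ⟨_, fun _ => by rw [← h]; exact hlim⟩
      · -- when the rank is smaller than the exponent, the limit vanishes
        have hpos : (0 : ℝ) < ρ - s := sub_pos.2 (by exact_mod_cast h)
        refine ⟨_, fun _ => ((tendsto_rootFactor_zero hF (b, b') hpos hl).mul hlim).congr' ?_⟩
        filter_upwards [self_mem_nhdsWithin] with z hz
        rw [← mul_assoc, ← rootFactor_add hF hbb _ _ l hz, sub_add_cancel]
    · exact ⟨0, fun h => absurd h hY⟩
  choose w hw using key
  refine ⟨w, fun Y hY => hw Y hY, ?_⟩
  obtain ⟨Y, ⟨D⟩⟩ := exists_blockFactorization_of_le (F := F) (c := c) (min_le_left _ _ : ρ ≤ _)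
    (min_le_right _ _)
  have hY : Y ∈ (ofHeight F (q₁ ∘ c)).nil ∩ leviLie F c (b, b') := by
    refine ⟨nil_ofHeight.2 fun a a' h => ?_, fun a a' h => Or.inr (Or.inr (D.support h))⟩
    by_contra hne
    obtain ⟨ha, ha'⟩ := D.support hne
    simp only [Function.comp_apply, ha, ha'] at h
    omega
  have := nhdsWithin_regular_neBot F β hF
  refine ⟨Y, hY, ?_⟩
  rw [tendsto_nhds_unique (hw Y hY) (D.tendsto_weight hF hq₂ h₁ h₂ hbb l)]
  exact Complex.exp_ne_zero _

theorem exists_injective_lt (hbb : b ≠ b') : ∃ q : β → ℕ, q.Injective ∧ q b < q b' := by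
  refine ⟨fun x => if x = b then 0 else (Fintype.equivFin β x : ℕ) + 1, fun x y h => ?_, ?_⟩
  · by_cases hx : x = b <;> by_cases hy : y = b
    · rw [hx, hy]
    · simp [hx, hy] at h
    · simp [hx, hy] at h
    · simp only [if_neg hx, if_neg hy, add_left_inj] at h
      exact (Fintype.equivFin β).injective (Fin.ext h)
  · simp [hbb.symm]

/-- If the limit exists with the exponent `ρ`, then it vanishes identically with any larger one. -/
theorem IsExponent.not_lt (hc : c.Surjective) (hbb : b ≠ b') {ρ σ : ℝ}
    (hρ : IsExponent hF c (b, b') ρ) (hσ : IsExponent hF c (b, b') σ) : ¬ ρ < σ := by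
  intro hlt
  have := hF.charZero
  obtain ⟨q₁, hq₁, h₁⟩ := exists_injective_lt hbb.symm
  obtain ⟨q₂, hq₂, h₂⟩ := exists_injective_lt hbb
  have hl : 0 < (coroot (Pi.single b 1 : β → ℂ) (b, b')).re := by simp [coroot, hbb.symm]
  have hr : (b, b').swap ∈ roots c (ofHeight F (q₁ ∘ c)) := (roots_ofHeight hc hq₁).2 h₁
  have hr' : (b, b') ∈ roots c (ofHeight F (q₂ ∘ c)) := (roots_ofHeight hc hq₂).2 h₂
  obtain ⟨w, hw, -⟩ := hρ.2 _ (ofHeight_mem_parabolicsWithLevi hq₁) _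
    (ofHeight_mem_parabolicsWithLevi hq₂) hr hr' _ hl
  obtain ⟨w', hw', Y, hY, hne⟩ := hσ.2 _ (ofHeight_mem_parabolicsWithLevi hq₁) _
    (ofHeight_mem_parabolicsWithLevi hq₂) hr hr' _ hl
  have h0 := (tendsto_rootFactor_zero hF (b, b') (sub_pos.2 hlt) hl).mul (hw Y hY)
  rw [zero_mul] at h0
  have := nhdsWithin_regular_neBot F β hF
  refine hne (tendsto_nhds_unique (hw' Y hY) (h0.congr' ?_))
  filter_upwards [self_mem_nhdsWithin] with z hz
  rw [← mul_assoc, ← rootFactor_add hF hbb _ _ _ hz, sub_add_cancel]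

theorem existsUnique_isExponent (hc : c.Surjective) (hbb : b ≠ b') :
    ∃! ρ : ℝ, IsExponent hF c (b, b') ρ :=
  ⟨_, isExponent_min hF hc hbb, fun _ hσ => le_antisymm
    (not_lt.1 (IsExponent.not_lt hF hc hbb (isExponent_min hF hc hbb) hσ))
    (not_lt.1 (IsExponent.not_lt hF hc hbb hσ (isExponent_min hF hc hbb)))⟩

theorem exponent_eq (hc : c.Surjective) (hbb : b ≠ b') :
    exponent hF c (b, b') =
      ((min (Fintype.card {a // c a = b}) (Fintype.card {a // c a = b'}) : ℕ) : ℝ) :=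
  (existsUnique_isExponent hF hc hbb).unique
    (Classical.epsilon_spec ⟨_, isExponent_min hF hc hbb⟩) (isExponent_min hF hc hbb)

end Exponent

/-! ### The comparison formula -/

section Comparison

variable {r : ℕ} {d : ℕ → ℕ}

theorem stdLevel_surjective (hd : 0 < d r) : (stdLevel r d).Surjective := by
  intro x
  have hx := x.isLt
  refine ⟨⟨⟨r - 1, by omega⟩, ⟨x, ?_⟩, ⟨0, ?_⟩⟩, Fin.ext rfl⟩
  · simp only
    omega
  · have : r - 1 + 1 = r := by omega
    simpa [this] using hd

theorem stdExponent_of_le {x u : Fin r} (h : u ≤ x) :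
    stdExponent d x u = Fintype.card {a : StdIndex r d // stdLevel r d a = x} := by
  rw [Fintype.card_subtype, stdExponent]
  congr 1
  refine Finset.filter_congr fun a _ => ⟨fun h' => h'.1, fun h' => ⟨h', ?_⟩⟩
  have h1 : (a.2.1 : ℕ) = x := congrArg (fun y : Fin r => (y : ℕ)) h'
  have h2 := a.2.1.isLt
  have h3 : (u : ℕ) ≤ x := h
  omega

theorem stdExponent_le_card (x u : Fin r) :
    stdExponent d x u ≤ Fintype.card {a : StdIndex r d // stdLevel r d a = x} := by
  rw [Fintype.card_subtype, stdExponent]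
  exact Finset.card_le_card fun a ha => by simp_all

/-- The number of Jordan chains through both of two levels is the exponent of the corresponding
root: since the sets of chains through the levels are nested, it is the smaller of two dimensions. -/
theorem stdExponent_eq_min (x u : Fin r) :
    stdExponent d x u = min (Fintype.card {a : StdIndex r d // stdLevel r d a = x})
      (Fintype.card {a : StdIndex r d // stdLevel r d a = u}) := by
  refine le_antisymm (le_min (stdExponent_le_card x u) ?_) ?_
  · rw [stdExponent_comm]
    exact stdExponent_le_card u x
  · rcases le_total u x with h | h
    · rw [stdExponent_of_le h]
      exact min_le_left _ _
    · rw [stdExponent_comm, stdExponent_of_le h]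
      exact min_le_right _ _

variable {F : Type*} [Field F] {q q₁ q₂ : Fin r → ℕ}

theorem permGL_conj_stdNilpotent (hq : q.Injective) :
    ((permGL F (stdPerm (d := d) hq) : GL (StdIndex r d) F) : Matrix _ _ F) *
      stdNilpotent F r d * (((permGL F (stdPerm (d := d) hq))⁻¹ : GL (StdIndex r d) F) :
        Matrix _ _ F) = richardsonElt F d hq := permGL_conj _ _

/-- If `gXg⁻¹` lies in `𝔫_P`, then `g` belongs to `P w_P`. -/
theorem mul_permGL_inv_mem_upper (hq : q.Injective) {g : GL (StdIndex r d) F}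
    (hg : (g : Matrix (StdIndex r d) (StdIndex r d) F) * stdNilpotent F r d *
      ((g⁻¹ : GL (StdIndex r d) F) : Matrix (StdIndex r d) (StdIndex r d) F) ∈
        strictUpper F (q ∘ stdLevel r d)) :
    ((g * (permGL F (stdPerm hq))⁻¹ : GL (StdIndex r d) F) :
      Matrix (StdIndex r d) (StdIndex r d) F) ∈ upper F (q ∘ stdLevel r d) := by
  set w := permGL F (stdPerm (d := d) hq) with hw
  have h1 := (isChainHeight_stdPerm (d := d) hq).mem_upper_of_conj_mem' (g := w⁻¹ * g) (by
    rw [← submatrix_mem_strictUpper, ← permGL_conj, ← hw]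
    convert hg using 1
    rw [_root_.mul_inv_rev, inv_inv, Units.val_mul, Units.val_mul]
    simp only [mul_assoc, Units.mul_inv_cancel_left, Units.mul_inv, mul_one])
  rw [← submatrix_mem_upper, ← permGL_conj, ← hw] at h1
  convert h1 using 1
  rw [Units.val_mul, Units.val_mul, Units.mul_inv_cancel_left]

variable [TopologicalSpace F] (hF : LocalField F)

/-- The function `R_P` in terms of the permutation `stdPerm`; any other admissible choice of `w_P`
differs from it by an element of `P ∩ K`. -/
theorem richardsonH_ofHeight (hq : q.Injective) (g : GL (StdIndex r d) F) :
    richardsonH hF (stdLevel r d) (stdNilpotent F r d) (ofHeight F (q ∘ stdLevel r d)) g =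
      iwasawaH hF (stdLevel r d) (ofHeight F (q ∘ stdLevel r d))
        (permGL F (stdPerm hq) * g) := by
  have := hF.charZero
  have hex : ∃ w : GL (StdIndex r d) F, w ∈ weyl F (StdIndex r d) ∧
      (ofHeight F (q ∘ stdLevel r d)).conj w⁻¹ ∈ richardsonParabolics (stdNilpotent F r d) := by
    refine ⟨permGL F (stdPerm hq), permGL_mem_weyl _, ?_⟩
    rw [conj_permGL_ofHeight]
    exact ⟨nil_ofHeight.2 (isChainHeight_stdPerm hq).stdNilpotent_mem,
      (isChainHeight_stdPerm hq).mem_richardson⟩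
  have hspec := Classical.epsilon_spec hex
  rw [richardsonH]
  generalize Classical.epsilon (fun w : GL (StdIndex r d) F => w ∈ weyl F (StdIndex r d) ∧
    (ofHeight F (q ∘ stdLevel r d)).conj w⁻¹ ∈ richardsonParabolics (stdNilpotent F r d)) = w
    at hspec
  obtain ⟨hw, hX, -⟩ := hspec
  obtain ⟨σ, rfl⟩ := exists_permGL_of_mem_weyl hw
  rw [conj_permGL_ofHeight, nil_ofHeight, ← submatrix_mem_strictUpper, ← permGL_conj] at hX
  have ht := mul_permGL_inv_mem_upper hq hX
  have hK := hF.isStandardCompact (ι := StdIndex r d)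
  have htK : permGL F σ * (permGL F (stdPerm hq))⁻¹ ∈ hF.maxCompact :=
    hK.mul_mem (hK.perm_mem _ _ rfl) (hK.inv_mem (hK.perm_mem _ _ rfl))
  funext x
  rw [show permGL F σ * g = (permGL F σ * (permGL F (stdPerm hq))⁻¹) *
    (permGL F (stdPerm hq) * g) by group, iwasawaH_upper_mul hF hq ht,
    hF.abs_blockDet_of_mem_maxCompact hq ht htK, Real.log_one, zero_add]

/-- The limit of the weight is given by the functions `R_P`: here `Y = p₀X_{q₁}p₀⁻¹` with
`p₀ = kg⁻¹w₁⁻¹` in `P₁`, so that `R_{P₁}(g)` is minus the Levi part of `p₀`, and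
`w₂w₁⁻¹p₀⁻¹ = w₂gk⁻¹`. -/
theorem tendsto_weightAt (hd : 0 < d r) (hq₁ : q₁.Injective) (hq₂ : q₂.Injective) (l : Fin r → ℂ)
    {Y : Matrix (StdIndex r d) (StdIndex r d) F}
    (hY : Y ∈ strictUpper F (q₁ ∘ stdLevel r d)) {g k : GL (StdIndex r d) F}
    (hk : k ∈ hF.maxCompact)
    (h : ((k⁻¹ : GL (StdIndex r d) F) : Matrix (StdIndex r d) (StdIndex r d) F) * Y * k =
      ((g⁻¹ : GL (StdIndex r d) F) : Matrix (StdIndex r d) (StdIndex r d) F) *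
        stdNilpotent F r d * g) :
    Tendsto (fun z => weightAt hF (stdLevel r d) (ofHeight F (q₁ ∘ stdLevel r d))
        (ofHeight F (q₂ ∘ stdLevel r d)) l z Y) (𝓝[regular F (Fin r)] 0)
      (𝓝 (Complex.exp (pairing l
        (richardsonH hF (stdLevel r d) (stdNilpotent F r d) (ofHeight F (q₁ ∘ stdLevel r d)) g -
          richardsonH hF (stdLevel r d) (stdNilpotent F r d)
            (ofHeight F (q₂ ∘ stdLevel r d)) g)))) := by
  have := hF.charZero
  have hc := stdLevel_surjective hd
  have hK := hF.isStandardCompact (ι := StdIndex r d)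
  set w₁ := permGL F (stdPerm (d := d) hq₁) with hw₁
  set w₂ := permGL F (stdPerm (d := d) hq₂) with hw₂
  have hYX : Y = ((k * g⁻¹ : GL (StdIndex r d) F) : Matrix (StdIndex r d) (StdIndex r d) F) *
      stdNilpotent F r d * (((k * g⁻¹)⁻¹ : GL (StdIndex r d) F) : Matrix _ _ F) := by
    rw [conj_eq_iff] at h
    rw [_root_.mul_inv_rev, inv_inv, Units.val_mul, Units.val_mul, mul_assoc, mul_assoc,
      ← mul_assoc _ g.val, ← mul_assoc _ (stdNilpotent F r d * g.val),
      ← mul_assoc g⁻¹.val, ← mul_assoc k.val, ← h, mul_assoc, Units.mul_inv, mul_one]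
  have hp₀ := mul_permGL_inv_mem_upper hq₁ (g := k * g⁻¹) (hYX ▸ hY)
  set p₀ := k * g⁻¹ * w₁⁻¹ with hp₀def
  have hYp : Y = (p₀ : Matrix (StdIndex r d) (StdIndex r d) F) * richardsonElt F d hq₁ *
      ((p₀⁻¹ : GL (StdIndex r d) F) : Matrix _ _ F) := by
    rw [← permGL_conj_stdNilpotent, ← hw₁, hYX, hp₀def, _root_.mul_inv_rev (k * g⁻¹) w₁⁻¹, inv_inv,
      Units.val_mul (k * g⁻¹), Units.val_mul w₁]
    simp only [mul_assoc, Units.inv_mul_cancel_left]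
  have hlim := tendsto_weight_aux hF hq₁ hq₂ hp₀ l
  rw [← hYp] at hlim
  have hH : (fun x => Real.log (hF.abs (blockDet (stdLevel r d) x
          (p₀ : Matrix (StdIndex r d) (StdIndex r d) F))) +
        iwasawaH hF (stdLevel r d) (ofHeight F (q₂ ∘ stdLevel r d)) (w₂ * w₁⁻¹ * p₀⁻¹) x) =
      fun x => richardsonH hF (stdLevel r d) (stdNilpotent F r d)
          (ofHeight F (q₂ ∘ stdLevel r d)) g x -
        richardsonH hF (stdLevel r d) (stdNilpotent F r d)
          (ofHeight F (q₁ ∘ stdLevel r d)) g x := by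
    funext x
    rw [richardsonH_ofHeight hF hq₁, richardsonH_ofHeight hF hq₂, ← hw₁, ← hw₂,
      show w₂ * w₁⁻¹ * p₀⁻¹ = (w₂ * g) * k⁻¹ by rw [hp₀def]; group,
      iwasawaH_mul_compact hF hq₂ _ (hK.inv_mem hk)]
    have h1 := iwasawaH_upper_mul hF hq₁ hp₀ (w₁ * g) x
    have h2 := iwasawaH_mul_eq_log hF (c := stdLevel r d) hq₁ (p := 1) one_mem_upper hk x
    rw [show p₀ * (w₁ * g) = 1 * k by rw [hp₀def]; group, h2, Units.val_one, blockDet_one,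
      hF.abs_one, Real.log_one] at h1
    linarith
  have hlimit : -pairing l (fun x => Real.log (hF.abs (blockDet (stdLevel r d) x
          (p₀ : Matrix (StdIndex r d) (StdIndex r d) F))) +
        iwasawaH hF (stdLevel r d) (ofHeight F (q₂ ∘ stdLevel r d)) (w₂ * w₁⁻¹ * p₀⁻¹) x) =
      pairing l
        (richardsonH hF (stdLevel r d) (stdNilpotent F r d) (ofHeight F (q₁ ∘ stdLevel r d)) g -
          richardsonH hF (stdLevel r d) (stdNilpotent F r d)
            (ofHeight F (q₂ ∘ stdLevel r d)) g) := by
    rw [hH, pairing_sub, neg_sub, ← pairing_sub]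
    rfl
  rw [← hlimit]
  classical
  refine hlim.congr fun z => ?_
  rw [weightAt]
  congr 1
  refine Finset.prod_congr ?_ fun α hα => ?_
  · refine Finset.filter_congr fun α _ => ?_
    rw [roots_ofHeight hc hq₁, roots_ofHeight hc hq₂]
    exact Iff.rfl
  · have hα' : α.1 ≠ α.2 := by
      have : q₂ α.1 < q₂ α.2 := by
        simp only [roots_ofHeight hc hq₂, Finset.mem_filter] at hα
        exact hα.2.1
      exact fun h => by rw [h] at this; exact lt_irrefl _ this
    rw [show α = (α.1, α.2) from rfl, exponent_eq hF hc hα', stdExponent_eq_min]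

end Comparison

end ArthurGM
open ArthurGM in
theorem mainTheorem10 {F : Type*} [Field F] [TopologicalSpace F] (hF : LocalField F)
    (r : ℕ) (hr : 1 ≤ r) (d : ℕ → ℕ) (hd : 0 < d r)
    (P₁ : Parabolic F (StdIndex r d)) (hP₁ : P₁ ∈ parabolicsWithLevi F (stdLevel r d)) :
    -- the objects entering the definition of the weights are well defined
    (∀ α : Fin r × Fin r, α.1 ≠ α.2 → ∃! ρ : ℝ, IsExponent hF (stdLevel r d) α ρ) ∧
    (∀ z ∈ regular F (Fin r), ∀ Y ∈ P₁.nil, ∃! n : GL (StdIndex r d) F, n ∈ P₁.unip ∧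
      ((n⁻¹ : GL (StdIndex r d) F) : Matrix (StdIndex r d) (StdIndex r d) F) *
        center (stdLevel r d) z * n = center (stdLevel r d) z + Y) ∧
    ∀ P₂ ∈ parabolicsWithLevi F (stdLevel r d), ∀ l : Fin r → ℂ,
    ∀ Y ∈ P₁.nil ∩ richardson P₁,
      -- the limit defining the weight exists
      Tendsto (fun z => weightAt hF (stdLevel r d) P₁ P₂ l z Y) (𝓝[regular F (Fin r)] 0)
        (𝓝 (weight hF (stdLevel r d) P₁ P₂ l Y)) ∧
      -- the comparison formula
      (∀ g : GL (StdIndex r d) F, ∀ k ∈ hF.maxCompact (ι := StdIndex r d),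
        ((k⁻¹ : GL (StdIndex r d) F) : Matrix (StdIndex r d) (StdIndex r d) F) * Y * k =
          ((g⁻¹ : GL (StdIndex r d) F) : Matrix (StdIndex r d) (StdIndex r d) F) *
            stdNilpotent F r d * g →
        weight hF (stdLevel r d) P₁ P₂ l Y =
          Complex.exp (pairing l
            (richardsonH hF (stdLevel r d) (stdNilpotent F r d) P₁ g -
              richardsonH hF (stdLevel r d) (stdNilpotent F r d) P₂ g))) ∧
      -- the invariance under conjugation
      (∀ p ∈ P₁.points ∩ hF.maxCompact,
        weight hF (stdLevel r d) P₁ P₂ l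
            ((p : Matrix (StdIndex r d) (StdIndex r d) F) * Y *
              ((p⁻¹ : GL (StdIndex r d) F) : Matrix (StdIndex r d) (StdIndex r d) F)) =
          weight hF (stdLevel r d) P₁ P₂ l Y) := by
  have := hF.charZero
  have hc := stdLevel_surjective hd
  have hK := hF.isStandardCompact (ι := StdIndex r d)
  have hne := nhdsWithin_regular_neBot F (Fin r) hF
  obtain ⟨q₁, hq₁, rfl⟩ := exists_height hc hP₁
  refine ⟨fun α hα => existsUnique_isExponent hF hc hα,
    fun z hz Y hY => existsUnique_unipSol hz (nil_ofHeight.1 hY), ?_⟩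
  rintro P₂ hP₂ l Y ⟨hYn, hYr⟩
  obtain ⟨q₂, hq₂, rfl⟩ := exists_height hc hP₂
  have hY := nil_ofHeight.1 hYn
  have hweight : ∀ {Y' : Matrix (StdIndex r d) (StdIndex r d) F},
      Y' ∈ strictUpper F (q₁ ∘ stdLevel r d) → ∀ {g k : GL (StdIndex r d) F},
      k ∈ hF.maxCompact →
      ((k⁻¹ : GL (StdIndex r d) F) : Matrix (StdIndex r d) (StdIndex r d) F) * Y' * k =
        ((g⁻¹ : GL (StdIndex r d) F) : Matrix (StdIndex r d) (StdIndex r d) F) *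
          stdNilpotent F r d * g →
      weight hF (stdLevel r d) (ofHeight F (q₁ ∘ stdLevel r d))
        (ofHeight F (q₂ ∘ stdLevel r d)) l Y' = _ :=
    fun hY' _ _ hk h => (tendsto_weightAt hF hd hq₁ hq₂ l hY' hk h).limUnder_eq
  obtain ⟨g₀, hg₀⟩ := (isChainHeight_stdPerm (d := d) hq₁).mem_orbit_of_mem_richardson
    (stdPerm hq₁) rfl hYr
  have h₀ : (1 : GL (StdIndex r d) F)⁻¹.val * Y * (1 : GL (StdIndex r d) F).val =
      (g₀⁻¹)⁻¹.val * stdNilpotent F r d * g₀⁻¹.val := by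
    rw [inv_one, Units.val_one, one_mul, mul_one, inv_inv, hg₀]
  refine ⟨?_, fun g k hk h => hweight hY hk h, ?_⟩
  · rw [hweight hY hK.one_mem h₀]
    exact tendsto_weightAt hF hd hq₁ hq₂ l hY hK.one_mem h₀
  · rintro p ⟨hp, hpK⟩
    rw [points_ofHeight] at hp
    rw [hweight hY hK.one_mem h₀]
    refine hweight (strictUpper_mul_upper (upper_mul_strictUpper hp hY) (upper_inv hp)) hpK ?_
    rw [← h₀, inv_one, Units.val_one, one_mul, mul_one]
    simp only [mul_assoc, Units.inv_mul, mul_one, Units.inv_mul_cancel_left]
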